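/- Setting. Let $\mu$ be the Gaussian white noise measure on $\mathcal S'(\mathbb R)$ (real tempered distributions, Borel $\sigma$-field), determined by $\int e^{i\langle x,\xi\rangle}\,d\mu(x)=e^{-\frac12|\xi|^2_{L^2(\mathbb R)}}$ for $\xi\in\mathcal S(\mathbb R)$, and let $I_n$ be the $n$-fold Wiener integral on symmetric functions in $L^2(\mathbb R^n)$. For $\lambda\in\mathbb R$ let $\mathcal G_\lambda$ be the space of (for $\lambda<0$ formal) chaos expansions $\Phi=\sum_{n\ge0}I_n(\Phi^{(n)})$, with symmetric $\Phi^{(n)}\in L^2(\mathbb R^n)$, such that $$\|\Phi\|_\lambda^2=\sum_{n\ge0}n!\,e^{2\lambda n}\,|\Phi^{(n)}|^2_{L^2(\mathbb R^n)}<\infty ,$$ and put $\mathcal G=\bigcap_{\lambda>0}\mathcal G_\lambda\subset L^2(\mu)$, $\mathcal G^*=\bigcup_{\lambda>0}\mathcal G_{-\lambda}$, and $\langle\!\langle\Phi,\psi\rangle\!\rangle=\sum_n n!\,(\Phi^{(n)},\psi^{(n)})_{L^2(\mathbb R^n)}$ for $\Phi\in\mathcal G^*$, $\psi\in\mathcal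 G$. The product $\phi\Phi=\Phi\phi\in\mathcal G^*$ of $\phi\in\mathcal G$ and $\Phi\in\mathcal G^*$ is defined by $\langle\!\langle\phi\Phi,\psi\rangle\!\rangle=\langle\!\langle\Phi,\psi\phi\rangle\!\rangle$ for all $\psi\in\mathcal G$, where $\psi\phi\in\mathcal G$ is the pointwise product of random variables. The stochastic derivative is $D_t\phi=\sum_{n\ge1}nI_{n-1}(\phi^{(n)}(\cdot,t))$ (defined for almost all $t$). The Skorohod integral of a $\mathcal G^*$-valued process $\Phi$ on $[0,T]$ is $\int_0^T\Phi(t)\,\delta B(t)=\sum_{n\ge0}I_{n+1}(\widehat{\Phi}^{(n)})$, where $\widehat\Phi^{(n)}$ is the symmetrization in all $n+1$ variables of $(x,t)\mapsto\mathbf 1_{[0,T]}(t)\,\Phi(t)^{(n)}(x)\in L^2(\mathbb R^{n+1})$, whenever this expansion is in $\mathcal G^*$. Integrals $dt$ of $\mathcal G^*$-valued processes are Pettis integrals with respect to the test space $\mathcal G$, with values in $\mathcal G^*$. Theorem (integration by parts). Let $T\ge0$, let $\phi\in\mathcal G$, and let $\Phi(t)\in\mathcal G^*$ for all $t\in[0,T]$,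 where $t\mapsto\langle\!\langle\Phi(t),\psi\rangle\!\rangle$ is Lebesgue measurable on $[0,T]$ for all $\psi\in\mathcal G$. Suppose that for some $\lambda>0$ and some $\nu>\frac12\ln(2+\sqrt2)$ $$\int_0^T\|\Phi(t)\|_{-\lambda+\nu}^2\,dt<\infty .$$ Then the product $\phi\Phi(t)$ exists in $\mathcal G^*$ for all $t\in[0,T]$; $t\mapsto\phi\Phi(t)$ and $\Phi$ are Skorohod integrable over $[0,T]$; the product $\phi\int_0^T\Phi(t)\,\delta B(t)$ exists in $\mathcal G^*$; for almost all $t\in[0,T]$ one has $D_t\phi\in\mathcal G$ and the product $\Phi(t)D_t\phi$ exists in $\mathcal G^*$; $t\mapsto\Phi(t)D_t\phi$ is Pettis integrable over $[0,T]$; and $$\int_0^T\phi\,\Phi(t)\,\delta B(t)=\phi\int_0^T\Phi(t)\,\delta B(t)-\int_0^T\Phi(t)\,D_t\phi\,dt ,$$ where all three terms lie in $\mathcal G^*$. -/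

import Mathlib

open MeasureTheory
open scoped SchwartzMap ENNReal

noncomputable section

namespace WhiteNoise

/-! ### The white noise space -/

/-- The space `S'(ℝ)` of real tempered distributions: continuous linear functionals on the real
Schwartz space. The pairing of `ω` with `ξ` is the evaluation `ω ξ`. -/
abbrev Dist : Type := 𝓢(ℝ, ℝ) →L[ℝ] ℝ

/-- The σ-algebra on `S'(ℝ)` generated by all evaluations `ω ↦ ω ξ`. As `S(ℝ)` is a separable
Fréchet space, it is the Borel σ-algebra of `S'(ℝ)`. -/
instance : MeasurableSpace Dist :=
  ⨆ ξ : 𝓢(ℝ, ℝ), MeasurableSpace.comap (fun ω : Dist => ω ξ) (borel ℝ)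

/-- `μ` is the Gaussian white noise measure on `S'(ℝ)`: the probability measure with characteristic
functional `∫ exp (i ω(ξ)) dμ(ω) = exp (- |ξ|² / 2)`, where `|ξ|` is the `L²(ℝ)` norm. -/
structure IsWhiteNoiseMeasure (μ : Measure Dist) : Prop where
  isProbabilityMeasure : IsProbabilityMeasure μ
  charFunctional : ∀ ξ : 𝓢(ℝ, ℝ),
    ∫ ω, Complex.exp (Complex.I * (ω ξ : ℂ)) ∂μ
      = Complex.exp (-(1 / 2) * ((∫ t, ξ t ^ 2 : ℝ) : ℂ))

/-! ### Multiple Wiener integrals and chaos expansions -/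

/-- Sequences of kernels `F n ∈ L²(ℝⁿ)`, the coefficients of (possibly formal) chaos expansions
`∑ₙ Iₙ(F n)`. -/
abbrev Kernels : Type := (n : ℕ) → Lp ℝ 2 (volume : Measure (Fin n → ℝ))

/-- An element of `L²(ℝⁿ)` is symmetric. -/
def IsSymm {n : ℕ} (f : Lp ℝ 2 (volume : Measure (Fin n → ℝ))) : Prop :=
  ∀ σ : Equiv.Perm (Fin n), (fun x => f (x ∘ σ)) =ᵐ[volume] f

/-- The `L²(ℝ)` norm of a Schwartz function. -/
def l2Norm (ξ : 𝓢(ℝ, ℝ)) : ℝ := Real.sqrt (∫ t, ξ t ^ 2)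

/-- The graph of the `n`-fold Wiener integral `Iₙ` from symmetric functions in `L²(ℝⁿ)` to
`(L²) = L²(S'(ℝ), μ)`: the continuous linear extension of
`Iₙ(ξ ⊗ ⋯ ⊗ ξ) = |ξ|ⁿ Heₙ(⟨·, ξ⟩ / |ξ|)`, with `Heₙ` the `n`-th Hermite polynomial. (For `ξ = 0` the
right-hand side is `0` if `n ≥ 1`, and it is `1` if `n = 0`.) -/
def wienerGraph (μ : Measure Dist) (n : ℕ) :
    Set (Lp ℝ 2 (volume : Measure (Fin n → ℝ)) × Lp ℝ 2 μ) :=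
  closure (Submodule.span ℝ
    {p : Lp ℝ 2 (volume : Measure (Fin n → ℝ)) × Lp ℝ 2 μ | ∃ ξ : 𝓢(ℝ, ℝ),
      (p.1 =ᵐ[volume] fun x => ∏ i, ξ (x i)) ∧
      (p.2 =ᵐ[μ] fun ω =>
        l2Norm ξ ^ n * Polynomial.aeval (ω ξ / l2Norm ξ) (Polynomial.hermite n))} :
    Set (Lp ℝ 2 (volume : Measure (Fin n → ℝ)) × Lp ℝ 2 μ))

/-- The random variable `X ∈ (L²)` has the chaos expansion `X = ∑ₙ Iₙ(F n)`, convergent in `(L²)`. -/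
def HasChaos (μ : Measure Dist) (F : Kernels) (X : Lp ℝ 2 μ) : Prop :=
  ∃ Y : ℕ → Lp ℝ 2 μ, (∀ n, (F n, Y n) ∈ wienerGraph μ n) ∧ HasSum Y X

/-! ### The spaces `G_l`, `G` and `G*`

By the Wiener–Itô decomposition a random variable is identified with the sequence of the symmetric
kernels of its chaos expansion, and so is a generalized random variable. -/

/-- `‖F‖_l² = ∑ₙ n! e^{2 l n} |F n|²`, as an extended nonnegative real. -/
def normSq (l : ℝ) (F : Kernels) : ℝ≥0∞ :=
  ∑' n : ℕ, ENNReal.ofReal ((n.factorial : ℝ) * Real.exp (2 * l * n)) * ‖F n‖ₑ ^ 2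

/-- The space `G_l`. -/
def GSpace (l : ℝ) : Set Kernels := {F | (∀ n, IsSymm (F n)) ∧ normSq l F < ∞}

/-- The test random variables `G`, the intersection of all `G_l`, `l > 0`. -/
def G : Set Kernels := {F | ∀ l : ℝ, 0 < l → F ∈ GSpace l}

/-- The generalized random variables `G*`, the union of all `G_{-l}`, `l > 0`. -/
def GStar : Set Kernels := {F | ∃ l : ℝ, 0 < l ∧ F ∈ GSpace (-l)}

/-- The pairing `⟪Φ, ψ⟫ = ∑ₙ n! (Φ n, ψ n)`; the series converges absolutely for `Φ ∈ G*` and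
`ψ ∈ G`. -/
def pairing (Φ ψ : Kernels) : ℝ := ∑' n : ℕ, (n.factorial : ℝ) * inner ℝ (Φ n) (ψ n)

/-! ### Products -/

/-- `ρ` is the pointwise product `ψ φ` of random variables: the random variables with kernels
`ψ`, `φ`, `ρ` satisfy `Z = X Y` almost surely. -/
def IsPointwiseProduct (μ : Measure Dist) (ψ φ ρ : Kernels) : Prop :=
  ∃ X Y Z : Lp ℝ 2 μ, HasChaos μ ψ X ∧ HasChaos μ φ Y ∧ HasChaos μ ρ Z ∧
    Z =ᵐ[μ] fun ω => X ω * Y ω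

/-- `Ψ ∈ G*` is the product `φ Φ` of `φ ∈ G` and `Φ ∈ G*`: for all `ψ ∈ G` the pointwise product
`ψ φ` is in `G`, and `⟪Ψ, ψ⟫ = ⟪Φ, ψ φ⟫`. -/
def IsProduct (μ : Measure Dist) (φ Φ Ψ : Kernels) : Prop :=
  Ψ ∈ GStar ∧
    ∀ ψ ∈ G, ∃ ρ ∈ G, IsPointwiseProduct μ ψ φ ρ ∧ pairing Ψ ψ = pairing Φ ρ

/-- The product `φ Φ` is well defined. -/
def HasProduct (μ : Measure Dist) (φ Φ : Kernels) : Prop := ∃ Ψ, IsProduct μ φ Φ Ψ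

open Classical in
/-- The product `φ Φ` (and `0` if it is not defined). -/
def product (μ : Measure Dist) (φ Φ : Kernels) : Kernels :=
  if h : HasProduct μ φ Φ then h.choose else 0

/-! ### Stochastic derivative, Skorohod integral, Pettis integral -/

open Classical in
/-- The stochastic derivative `D_t F = ∑ₙ n I_{n-1}(F n (·, t))`: its `n`-th kernel is
`(n + 1) F (n + 1) (·, t)`. For almost all `t` the slices are square integrable. -/
def stochDeriv (t : ℝ) (F : Kernels) : Kernels := fun n =>
  if h : MemLp (fun x : Fin n → ℝ =>
      ((n : ℝ) + 1) * F (n + 1) (Fin.snoc (α := fun _ => ℝ) x t)) 2 volume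
  then h.toLp _ else 0

/-- `Ψ ∈ G*` is the Skorohod integral over `ℝ` of the `G*`-valued process `Φ`: its kernel of order
`0` vanishes, and that of order `n + 1` is the symmetrization in all variables of
`g (x, t) = (Φ t) n x`, a square integrable function on `ℝⁿ⁺¹`. -/
def IsSkorohodIntegral (Φ : ℝ → Kernels) (Ψ : Kernels) : Prop :=
  (∀ᵐ t : ℝ, Φ t ∈ GStar) ∧ Ψ ∈ GStar ∧ Ψ 0 = 0 ∧
    ∀ n : ℕ, ∃ g : Lp ℝ 2 (volume : Measure (Fin (n + 1) → ℝ)),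
      (∀ᵐ t : ℝ, (fun x : Fin n → ℝ => g (Fin.snoc (α := fun _ => ℝ) x t))
        =ᵐ[volume] Φ t n) ∧
      Ψ (n + 1) =ᵐ[volume] fun x =>
        ((n + 1).factorial : ℝ)⁻¹ * ∑ σ : Equiv.Perm (Fin (n + 1)), g (x ∘ σ)

/-- `Φ` is Skorohod integrable over the set `S`. -/
def SkorohodIntegrableOn (S : Set ℝ) (Φ : ℝ → Kernels) : Prop :=
  ∃ Ψ, IsSkorohodIntegral (S.indicator Φ) Ψ

open Classical in
/-- The Skorohod integral of `Φ` over `S` (and `0` if `Φ` is not integrable). -/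
def skorohod (S : Set ℝ) (Φ : ℝ → Kernels) : Kernels :=
  if h : SkorohodIntegrableOn S Φ then h.choose else 0

/-- `Ψ ∈ G*` is the Pettis integral over `S` of the `G*`-valued process `Φ`: for all `ψ ∈ G` the
function `t ↦ ⟪Φ t, ψ⟫` is (measurable and) integrable over `S`, with integral `⟪Ψ, ψ⟫`. -/
def IsPettisIntegral (S : Set ℝ) (Φ : ℝ → Kernels) (Ψ : Kernels) : Prop :=
  (∀ᵐ t ∂volume.restrict S, Φ t ∈ GStar) ∧ Ψ ∈ GStar ∧
    ∀ ψ ∈ G, IntegrableOn (fun t => pairing (Φ t) ψ) S ∧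
      pairing Ψ ψ = ∫ t in S, pairing (Φ t) ψ

/-- `Φ` is Pettis integrable over `S`, with integral in `G*`. -/
def PettisIntegrableOn (S : Set ℝ) (Φ : ℝ → Kernels) : Prop := ∃ Ψ, IsPettisIntegral S Φ Ψ

open Classical in
/-- The Pettis integral of `Φ` over `S` (and `0` if `Φ` is not integrable). -/
def pettis (S : Set ℝ) (Φ : ℝ → Kernels) : Kernels :=
  if h : PettisIntegrableOn S Φ then h.choose else 0

/-- `Φ` is weakly measurable on `S`: all functions `t ↦ ⟪Φ t, ψ⟫`, `ψ ∈ G`, are Lebesgue measurable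
on `S`. -/
def WeaklyMeasurableOn (S : Set ℝ) (Φ : ℝ → Kernels) : Prop :=
  ∀ ψ ∈ G, AEMeasurable (fun t => pairing (Φ t) ψ) (volume.restrict S)

end WhiteNoise

end

open MeasureTheory
open scoped SchwartzMap ENNReal

noncomputable section

namespace WhiteNoise

open Filter Topology

/-! The formula is the Leibniz rule for the stochastic derivative, read through duality. The
Skorohod integral is the adjoint of `D`: `⟪∫ Φ δB, ψ⟫ = ∫ ⟪Φ(t), D_t ψ⟫ dt` for `ψ ∈ G`
(`IsSkorohodIntegral.integrable_pairing`). Testing `φ ∫ Φ δB` on `ψ` gives `∫ ⟪Φ(t), D_t(ψ φ)⟫ dt`,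
and `D_t(ψ φ) = ψ D_t φ + φ D_t ψ` (`sliceDeriv_mul`) splits this into `∫ ⟪Φ(t) D_t φ, ψ⟫ dt` and `∫
⟪φ Φ(t), D_t ψ⟫ dt = ⟪∫ φ Φ δB, ψ⟫`. Elements of `G*` are determined by their pairings with `G`
(`eq_of_pairing_eq`).

The analytic work is to make all terms meaningful, and the key is that `G` is an algebra with
continuous product: `‖ψ φ‖_a ≤ 8 ‖ψ‖_{a+2} ‖φ‖_{a+2}` for `a ≥ 0` (`normSq_mul_le`, for squared
norms). This rests on hypercontractivity within a fixed chaos, `√E[p⁴] ≤ 3ⁿ E[p²]`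
(`sqrt_expect_pow_four_le`). That is proved by induction on `n` from the number operator identity `∫
E[∂_t p ∂_t q] dt = n E[p q]`. Since the norms of `G` carry arbitrary exponential weights, the
factors `3ⁿ` cost only a shift of the index. By duality, multiplication by `φ ∈ G` maps `G_{-l}` to
`G_{-(l+2)}` for `l > 0` (`exists_product`, `normSq_product_le`). Similarly `D` and the Skorohod
integral each cost one unit of the index.

The algebra is done on formal polynomials in the variables `ω ξ`. For them, Gaussian integration by
parts comes from the characteristic functional, chaos kernels are expectations of iterated
derivatives, and the Leibniz rule is that of a derivation. Polarization shows that Hermite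
polynomials span all polynomials and that the tensors `ξ ⊗ ⋯ ⊗ ξ` are total in symmetric `L²`; this
identifies the Wiener integral with the closure of the polynomial one. Polynomials are dense in `G`,
and product and Leibniz rule pass to the limit. -/

/-! ### Gaussian integration by parts for polynomial random variables -/

/-- The `L²(ℝ)` inner product of Schwartz functions. -/
def ip (ξ η : 𝓢(ℝ, ℝ)) : ℝ := inner ℝ (ξ.toLp 2 volume) (η.toLp 2 volume)

lemma ip_eq_integral (ξ η : 𝓢(ℝ, ℝ)) : ip ξ η = ∫ t, ξ t * η t := by
  rw [ip, L2.inner_def]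
  refine integral_congr_ae ?_
  filter_upwards [ξ.coeFn_toLp 2 volume, η.coeFn_toLp 2 volume] with t h1 h2
  simp [h1, h2, mul_comm]

lemma toLp_add (ξ η : 𝓢(ℝ, ℝ)) :
    (ξ + η).toLp 2 volume = ξ.toLp 2 volume + η.toLp 2 volume :=
  map_add (SchwartzMap.toLpCLM ℝ ℝ 2 volume) ξ η

lemma toLp_smul (a : ℝ) (ξ : 𝓢(ℝ, ℝ)) : (a • ξ).toLp 2 volume = a • ξ.toLp 2 volume :=
  map_smul (SchwartzMap.toLpCLM ℝ ℝ 2 volume) a ξ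

lemma toLp_zero : (0 : 𝓢(ℝ, ℝ)).toLp 2 volume = 0 :=
  map_zero (SchwartzMap.toLpCLM ℝ ℝ 2 volume)

lemma ip_comm (ξ η : 𝓢(ℝ, ℝ)) : ip ξ η = ip η ξ := real_inner_comm _ _

lemma ip_add_right (ξ η ζ : 𝓢(ℝ, ℝ)) : ip ξ (η + ζ) = ip ξ η + ip ξ ζ := by
  simp [ip, toLp_add, inner_add_right]

lemma ip_smul_right (a : ℝ) (ξ η : 𝓢(ℝ, ℝ)) : ip ξ (a • η) = a * ip ξ η := by
  simp [ip, toLp_smul, inner_smul_right]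

lemma ip_zero_right (ξ : 𝓢(ℝ, ℝ)) : ip ξ 0 = 0 := by simp [ip, toLp_zero]

lemma ip_self_nonneg (ξ : 𝓢(ℝ, ℝ)) : 0 ≤ ip ξ ξ := real_inner_self_nonneg

lemma ip_self_eq (ξ : 𝓢(ℝ, ℝ)) : ip ξ ξ = ∫ t, ξ t ^ 2 := by
  rw [ip_eq_integral]
  simp only [pow_two]

lemma l2Norm_sq (ξ : 𝓢(ℝ, ℝ)) : l2Norm ξ ^ 2 = ip ξ ξ := by
  rw [l2Norm, ← ip_self_eq, Real.sq_sqrt (ip_self_nonneg ξ)]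

lemma ip_add_smul_self (ξ η : 𝓢(ℝ, ℝ)) (s : ℝ) :
    ip (η + s • ξ) (η + s • ξ) = ip η η + 2 * s * ip ξ η + s ^ 2 * ip ξ ξ := by
  rw [ip_add_right, ip_smul_right, ip_comm _ η, ip_comm _ ξ, ip_add_right, ip_add_right,
    ip_smul_right, ip_smul_right, ip_comm η ξ]
  ring

lemma measurable_apply (ξ : 𝓢(ℝ, ℝ)) : Measurable fun ω : Dist => ω ξ :=
  Measurable.of_comap_le
    (le_iSup (fun ξ : 𝓢(ℝ, ℝ) => MeasurableSpace.comap (fun ω : Dist => ω ξ) (borel ℝ)) ξ)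

/-- Polynomials in the random variables `ω ↦ ω ξ`. -/
abbrev Poly : Type := MvPolynomial 𝓢(ℝ, ℝ) ℝ

/-- The polynomial random variable given by `p`. -/
def rv (p : Poly) (ω : Dist) : ℝ := MvPolynomial.eval (fun ξ => ω ξ) p

@[simp] lemma rv_add (p q : Poly) (ω : Dist) : rv (p + q) ω = rv p ω + rv q ω := by simp [rv]
@[simp] lemma rv_sub (p q : Poly) (ω : Dist) : rv (p - q) ω = rv p ω - rv q ω := by simp [rv]
@[simp] lemma rv_mul (p q : Poly) (ω : Dist) : rv (p * q) ω = rv p ω * rv q ω := by simp [rv]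
@[simp] lemma rv_pow (p : Poly) (n : ℕ) (ω : Dist) : rv (p ^ n) ω = rv p ω ^ n := by simp [rv]
@[simp] lemma rv_C (a : ℝ) (ω : Dist) : rv (MvPolynomial.C a) ω = a := by simp [rv]
@[simp] lemma rv_one (ω : Dist) : rv 1 ω = 1 := by simp [rv]
@[simp] lemma rv_zero (ω : Dist) : rv 0 ω = 0 := by simp [rv]
@[simp] lemma rv_X (ξ : 𝓢(ℝ, ℝ)) (ω : Dist) : rv (MvPolynomial.X ξ) ω = ω ξ := by simp [rv]
@[simp] lemma rv_smul (a : ℝ) (p : Poly) (ω : Dist) : rv (a • p) ω = a * rv p ω := by simp [rv]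

variable {μ : Measure Dist}

/-- The characteristic functional at `s • ξ`, as a function of `s`, is the characteristic function
of a centred Gaussian of variance `|ξ|²`. It serves to make all moments finite. -/
lemma map_apply_eq_gaussianReal (hμ : IsWhiteNoiseMeasure μ) (ξ : 𝓢(ℝ, ℝ)) :
    μ.map (fun ω : Dist => ω ξ)
      = ProbabilityTheory.gaussianReal 0 (ip ξ ξ).toNNReal := by
  have := hμ.isProbabilityMeasure
  have : IsProbabilityMeasure (μ.map (fun ω : Dist => ω ξ)) :=
    Measure.isProbabilityMeasure_map (measurable_apply ξ).aemeasurable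
  refine Measure.ext_of_charFun ?_
  ext s
  rw [ProbabilityTheory.charFun_gaussianReal, charFun_apply_real,
    integral_map (measurable_apply ξ).aemeasurable (by fun_prop)]
  have h := hμ.charFunctional (s • ξ)
  rw [← ip_self_eq, ip_smul_right, ip_comm, ip_smul_right] at h
  convert h using 2
  · ext ω
    simp only [map_smul, smul_eq_mul]
    push_cast
    ring_nf
  · rw [Real.coe_toNNReal _ (ip_self_nonneg ξ)]
    push_cast
    ring

lemma memLp_apply (hμ : IsWhiteNoiseMeasure μ) (ξ : 𝓢(ℝ, ℝ)) (r : ℝ≥0∞) (hr : r ≠ ∞) :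
    MemLp (fun ω : Dist => ω ξ) r μ := by
  have h := ProbabilityTheory.memLp_id_gaussianReal' (μ := 0)
    (v := (ip ξ ξ).toNNReal) r hr
  rw [← map_apply_eq_gaussianReal hμ ξ] at h
  exact h.comp_of_map (measurable_apply ξ).aemeasurable

lemma memLp_rv (hμ : IsWhiteNoiseMeasure μ) (p : Poly) (r : ℝ≥0∞) (hr : r ≠ ∞) :
    MemLp (rv p) r μ := by
  have := hμ.isProbabilityMeasure
  induction p using MvPolynomial.induction_on generalizing r with
  | C a =>
    simp only [funext (rv_C a)]
    exact memLp_const a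
  | add p q hp hq =>
    simp only [funext (rv_add p q)]
    exact (hp r hr).add (hq r hr)
  | mul_X p ξ hp =>
    simp only [funext (rv_mul p _), rv_X]
    -- Hölder with exponents `2r, 2r`. The induction runs over all `r`, so doubling the exponent at
    -- each factor is harmless.
    have h2 : (2 : ℝ≥0∞) * r ≠ ∞ := ENNReal.mul_ne_top (by simp) hr
    have : ENNReal.HolderTriple (2 * r) (2 * r) r := ⟨by
      rw [ENNReal.mul_inv (by simp) (by simp), ← add_mul, ENNReal.inv_two_add_inv_two, one_mul]⟩
    exact (memLp_apply hμ ξ _ h2).mul (hp _ h2)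

lemma integrable_rv (hμ : IsWhiteNoiseMeasure μ) (p : Poly) : Integrable (rv p) μ :=
  memLp_one_iff_integrable.mp (memLp_rv hμ p 1 (by simp))

/-- The derivation of `Poly` in the direction `ξ`. -/
def dirDeriv (ξ : 𝓢(ℝ, ℝ)) : Derivation ℝ Poly Poly :=
  MvPolynomial.mkDerivation ℝ fun η => MvPolynomial.C (ip ξ η)

/-- The derivation of `Poly` in the direction of the Dirac measure at `t`, which is the stochastic
derivative of polynomial random variables. -/
def ptDeriv (t : ℝ) : Derivation ℝ Poly Poly :=
  MvPolynomial.mkDerivation ℝ fun η => MvPolynomial.C (η t)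

lemma dirDeriv_X (ξ η : 𝓢(ℝ, ℝ)) :
    dirDeriv ξ (MvPolynomial.X η) = MvPolynomial.C (ip ξ η) := by
  simp [dirDeriv]

lemma ptDeriv_X (t : ℝ) (η : 𝓢(ℝ, ℝ)) :
    ptDeriv t (MvPolynomial.X η) = MvPolynomial.C (η t) := by
  simp [ptDeriv]

/-- The Fourier transform of the complex measure `p μ`. -/
def fourier (μ : Measure Dist) (p : Poly) (η : 𝓢(ℝ, ℝ)) : ℂ :=
  ∫ ω, (rv p ω : ℂ) * Complex.exp (Complex.I * (ω η : ℂ)) ∂μ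

lemma integrable_fourier (hμ : IsWhiteNoiseMeasure μ) (p : Poly) (η : 𝓢(ℝ, ℝ)) :
    Integrable (fun ω : Dist => (rv p ω : ℂ) * Complex.exp (Complex.I * (ω η : ℂ))) μ := by
  refine (integrable_rv hμ p).ofReal.mul_bdd (c := 1) ?_ (ae_of_all _ fun ω => ?_)
  · exact (Complex.measurable_exp.comp
      ((Complex.measurable_ofReal.comp (measurable_apply η)).const_mul _)).aestronglyMeasurable
  · rw [mul_comm, Complex.norm_exp_ofReal_mul_I]

lemma fourier_add (hμ : IsWhiteNoiseMeasure μ) (p q : Poly) (η : 𝓢(ℝ, ℝ)) :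
    fourier μ (p + q) η = fourier μ p η + fourier μ q η := by
  rw [fourier, fourier, fourier,
    ← integral_add (integrable_fourier hμ p η) (integrable_fourier hμ q η)]
  simp [add_mul]

lemma fourier_C_mul (a : ℝ) (p : Poly) (η : 𝓢(ℝ, ℝ)) :
    fourier μ (MvPolynomial.C a * p) η = a * fourier μ p η := by
  rw [fourier, fourier, ← integral_const_mul]
  simp [mul_assoc]

lemma hasDerivAt_const_mul_cexp (z : ℂ) (a b s : ℝ) :
    HasDerivAt (fun s : ℝ => z * Complex.exp (Complex.I * ((a + s * b : ℝ) : ℂ)))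
      (Complex.I * (z * b * Complex.exp (Complex.I * ((a + s * b : ℝ) : ℂ)))) s := by
  have h1 : HasDerivAt (fun s : ℝ => Complex.I * ((a + s * b : ℝ) : ℂ)) (Complex.I * (b : ℂ)) s := by
    refine HasDerivAt.const_mul _ (HasDerivAt.ofReal_comp ?_)
    simpa using ((hasDerivAt_id s).mul_const b).const_add a
  refine ((h1.cexp).const_mul z).congr_deriv ?_
  ring

/-- Differentiation under the integral, dominated by `|p X_ζ|` because the exponential has modulus
one. Multiplying `p` by a variable thereby becomes a derivative in `η`. -/
lemma hasDerivAt_fourier (hμ : IsWhiteNoiseMeasure μ) (p : Poly) (η ζ : 𝓢(ℝ, ℝ)) :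
    HasDerivAt (fun s : ℝ => fourier μ p (η + s • ζ))
      (Complex.I * fourier μ (p * MvPolynomial.X ζ) η) 0 := by
  have key := hasDerivAt_integral_of_dominated_loc_of_deriv_le (μ := μ) (x₀ := (0 : ℝ))
    (F := fun (s : ℝ) (ω : Dist) =>
      (rv p ω : ℂ) * Complex.exp (Complex.I * (ω (η + s • ζ) : ℂ)))
    (F' := fun (s : ℝ) (ω : Dist) => Complex.I *
      ((rv (p * MvPolynomial.X ζ) ω : ℂ) * Complex.exp (Complex.I * (ω (η + s • ζ) : ℂ))))
    (bound := fun ω => ‖rv (p * MvPolynomial.X ζ) ω‖) (s := Set.univ) univ_mem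
    (Eventually.of_forall fun s => (integrable_fourier hμ p _).aestronglyMeasurable)
    (integrable_fourier hμ p (η + (0 : ℝ) • ζ))
    ((integrable_fourier hμ (p * MvPolynomial.X ζ) (η + (0 : ℝ) • ζ)).aestronglyMeasurable.const_mul
      Complex.I)
    (ae_of_all _ fun ω s _ => ?_) (integrable_rv hμ _).norm (ae_of_all _ fun ω s _ => ?_)
  · have h := key.2
    rw [integral_const_mul] at h
    simp only [zero_smul, add_zero] at h
    exact h
  · rw [norm_mul, norm_mul, mul_comm Complex.I (ω _ : ℂ), Complex.norm_exp_ofReal_mul_I]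
    simp
  · simpa using hasDerivAt_const_mul_cexp (rv p ω) (ω η) (ω ζ) s

lemma fourier_one (hμ : IsWhiteNoiseMeasure μ) (η : 𝓢(ℝ, ℝ)) :
    fourier μ 1 η = Complex.exp (-(1 / 2) * (ip η η : ℂ)) := by
  have := hμ.charFunctional η
  rw [← ip_self_eq] at this
  simpa [fourier] using this

/-- The free `η` makes the induction on `p` work: passing from `p` to `p X_ζ` is differentiation
along `ζ`, and the product rule applied to `⟨ξ, η⟩ · fourier μ p η` produces the new term `⟨ξ, ζ⟩ p`
of `∂_ξ (p X_ζ)`. The base case differentiates `exp (-|η|² / 2)`. The value at `η = 0` is Gaussian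
integration by parts. -/
lemma fourier_X_mul (hμ : IsWhiteNoiseMeasure μ) (p : Poly) (ξ η : 𝓢(ℝ, ℝ)) :
    fourier μ (MvPolynomial.X ξ * p) η
      = fourier μ (dirDeriv ξ p) η + Complex.I * ip ξ η * fourier μ p η := by
  induction p using MvPolynomial.induction_on generalizing ξ η with
  | C a =>
    have h1 := hasDerivAt_fourier hμ 1 η ξ
    have h2 : HasDerivAt (fun s : ℝ => fourier μ 1 (η + s • ξ))
        (-(ip ξ η : ℂ) * fourier μ 1 η) 0 := by
      have h3 : HasDerivAt (fun s : ℝ => -(1 / 2) *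
          ((ip η η + 2 * s * ip ξ η + s ^ 2 * ip ξ ξ : ℝ) : ℂ)) (-(1 / 2) * (2 * ip ξ η : ℝ)) 0 := by
        refine HasDerivAt.const_mul _ (HasDerivAt.ofReal_comp ?_)
        have h4 : HasDerivAt (fun s : ℝ => ip η η + 2 * s * ip ξ η + s ^ 2 * ip ξ ξ)
            (2 * 1 * ip ξ η + ((2 : ℕ) * 0 ^ (2 - 1) * 1) * ip ξ ξ) 0 :=
          ((((hasDerivAt_id (0 : ℝ)).const_mul 2).mul_const _).const_add _).add
            (((hasDerivAt_id (0 : ℝ)).pow 2).mul_const _)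
        simpa using h4
      have h5 := h3.cexp
      simp only [fourier_one hμ, ip_add_smul_self]
      convert h5 using 1
      push_cast
      simp
      ring
    have h6 := h1.unique h2
    have h7 : fourier μ (MvPolynomial.X ξ) η = Complex.I * ip ξ η * fourier μ 1 η := by
      rw [one_mul] at h6
      linear_combination (-Complex.I) * h6
        + (fourier μ (MvPolynomial.X ξ) η) * Complex.I_mul_I
    rw [mul_comm, fourier_C_mul, h7, ← mul_one (MvPolynomial.C a), fourier_C_mul]
    rw [mul_one, MvPolynomial.derivation_C, ← mul_one (0 : Poly), ← MvPolynomial.C_0, fourier_C_mul]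
    push_cast
    ring
  | add p q hp hq =>
    rw [mul_add, fourier_add hμ, hp, hq, map_add, fourier_add hμ, fourier_add hμ]
    ring
  | mul_X p ζ hp =>
    have h1 := hasDerivAt_fourier hμ (MvPolynomial.X ξ * p) η ζ
    have h2 := hasDerivAt_fourier hμ (dirDeriv ξ p) η ζ
    have h3 : HasDerivAt (fun s : ℝ => Complex.I * (ip ξ (η + s • ζ) : ℂ))
        (Complex.I * (ip ξ ζ : ℝ)) 0 := by
      refine HasDerivAt.const_mul _ (HasDerivAt.ofReal_comp ?_)
      simp only [ip_add_right, ip_smul_right]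
      simpa using ((hasDerivAt_id (0 : ℝ)).mul_const (ip ξ ζ)).const_add (ip ξ η)
    have h4 := h2.add (h3.mul (hasDerivAt_fourier hμ p η ζ))
    have h5 := h1.unique (h4.congr_of_eventuallyEq
      (Eventually.of_forall fun s => hp ξ (η + s • ζ)))
    have h6 : dirDeriv ξ (p * MvPolynomial.X ζ)
        = MvPolynomial.C (ip ξ ζ) * p + dirDeriv ξ p * MvPolynomial.X ζ := by
      rw [Derivation.leibniz, dirDeriv_X, smul_eq_mul, smul_eq_mul]
      ring
    rw [h6, fourier_add hμ, fourier_C_mul]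
    simp only [zero_smul, add_zero] at h5
    rw [mul_assoc] at h5
    linear_combination (-Complex.I) * h5
        + (fourier μ (MvPolynomial.X ξ * (p * MvPolynomial.X ζ)) η
          - fourier μ (dirDeriv ξ p * MvPolynomial.X ζ) η
          - Complex.I * ip ξ η * fourier μ (p * MvPolynomial.X ζ) η
          - ip ξ ζ * fourier μ p η) * Complex.I_mul_I

/-- The expectation of polynomial random variables. -/
def expect (μ : Measure Dist) (p : Poly) : ℝ := ∫ ω, rv p ω ∂μ

lemma expect_add (hμ : IsWhiteNoiseMeasure μ) (p q : Poly) :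
    expect μ (p + q) = expect μ p + expect μ q := by
  simp [expect, integral_add (integrable_rv hμ p) (integrable_rv hμ q)]

lemma expect_sub (hμ : IsWhiteNoiseMeasure μ) (p q : Poly) :
    expect μ (p - q) = expect μ p - expect μ q := by
  simp [expect, integral_sub (integrable_rv hμ p) (integrable_rv hμ q)]

lemma expect_smul (a : ℝ) (p : Poly) : expect μ (a • p) = a * expect μ p := by
  simp [expect, integral_const_mul]

lemma expect_zero : expect μ 0 = 0 := by simp [expect]

lemma expect_one (hμ : IsWhiteNoiseMeasure μ) : expect μ 1 = 1 := by
  have := hμ.isProbabilityMeasure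
  simp [expect]

lemma expect_X_mul (hμ : IsWhiteNoiseMeasure μ) (ξ : 𝓢(ℝ, ℝ)) (p : Poly) :
    expect μ (MvPolynomial.X ξ * p) = expect μ (dirDeriv ξ p) := by
  have h := fourier_X_mul hμ p ξ 0
  have h0 : ∀ q : Poly, fourier μ q 0 = (expect μ q : ℂ) := fun q => by
    simp [fourier, expect, integral_complex_ofReal]
  rw [h0, h0, ip_zero_right] at h
  have h1 : (expect μ (MvPolynomial.X ξ * p) : ℂ) = (expect μ (dirDeriv ξ p) : ℂ) := by
    simpa using h
  exact_mod_cast h1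

/-! ### Hermite polynomials -/

/-- The linear form `∑ c ξ X_ξ`. -/
def lin : (𝓢(ℝ, ℝ) →₀ ℝ) →ₗ[ℝ] Poly := Finsupp.linearCombination ℝ MvPolynomial.X

/-- The Schwartz function `∑ c ξ ξ`. -/
def tot : (𝓢(ℝ, ℝ) →₀ ℝ) →ₗ[ℝ] 𝓢(ℝ, ℝ) := Finsupp.linearCombination ℝ id

lemma lin_single (ξ : 𝓢(ℝ, ℝ)) (a : ℝ) : lin (Finsupp.single ξ a) = a • MvPolynomial.X ξ := by
  simp [lin]

lemma tot_single (ξ : 𝓢(ℝ, ℝ)) (a : ℝ) : tot (Finsupp.single ξ a) = a • ξ := by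
  simp [tot]

/-- The polynomials `lin c` and `X (tot c)` differ but give the same random variable. Hermite
polynomials are built on `lin c` because `lin` is linear, which polarization requires. -/
lemma rv_lin (c : 𝓢(ℝ, ℝ) →₀ ℝ) (ω : Dist) : rv (lin c) ω = ω (tot c) := by
  induction c using Finsupp.induction_linear with
  | zero => simp
  | add c d hc hd => simp [hc, hd]
  | single ξ a => simp [lin_single, tot_single]

lemma dirDeriv_lin (ξ : 𝓢(ℝ, ℝ)) (c : 𝓢(ℝ, ℝ) →₀ ℝ) :
    dirDeriv ξ (lin c) = MvPolynomial.C (ip ξ (tot c)) := by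
  induction c using Finsupp.induction_linear with
  | zero => simp [ip_zero_right]
  | add c d hc hd => simp [hc, hd, ip_add_right]
  | single η a =>
    rw [lin_single, tot_single, Derivation.map_smul, dirDeriv_X, ip_smul_right,
      MvPolynomial.smul_eq_C_mul, MvPolynomial.C_mul]

lemma ptDeriv_lin (t : ℝ) (c : 𝓢(ℝ, ℝ) →₀ ℝ) :
    ptDeriv t (lin c) = MvPolynomial.C (tot c t) := by
  induction c using Finsupp.induction_linear with
  | zero => simp
  | add c d hc hd => simp [hc, hd]
  | single η a =>
    rw [lin_single, tot_single, Derivation.map_smul, ptDeriv_X, MvPolynomial.smul_eq_C_mul,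
      smul_apply, smul_eq_mul, MvPolynomial.C_mul]

lemma expect_lin_mul (hμ : IsWhiteNoiseMeasure μ) (c : 𝓢(ℝ, ℝ) →₀ ℝ) (p : Poly) :
    expect μ (lin c * p) = expect μ (dirDeriv (tot c) p) := by
  rw [← expect_X_mul hμ]
  simp [expect, rv_lin]

/-- The Hermite polynomial `|ξ|ⁿ Heₙ(⟨·, ξ⟩ / |ξ|)` with `ξ = tot c`. -/
def herm (c : 𝓢(ℝ, ℝ) →₀ ℝ) : ℕ → Poly
  | 0 => 1
  | 1 => lin c
  | n + 2 => lin c * herm c (n + 1)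
      - MvPolynomial.C (((n : ℝ) + 1) * ip (tot c) (tot c)) * herm c n

lemma herm_add_two (c : 𝓢(ℝ, ℝ) →₀ ℝ) (n : ℕ) :
    herm c (n + 2) = lin c * herm c (n + 1)
      - MvPolynomial.C (((n : ℝ) + 1) * ip (tot c) (tot c)) * herm c n := rfl

/-- Only the value of `D` on `lin c` enters, so one induction serves both `dirDeriv` and `ptDeriv`.
-/
lemma derivation_herm (D : Derivation ℝ Poly Poly) (c : 𝓢(ℝ, ℝ) →₀ ℝ) (a : ℝ)
    (h : D (lin c) = MvPolynomial.C a) (n : ℕ) :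
    D (herm c (n + 1)) = MvPolynomial.C (((n : ℝ) + 1) * a) * herm c n := by
  induction n using Nat.strong_induction_on with
  | _ n ih =>
    match n with
    | 0 => simp [herm, h]
    | 1 =>
      have h0 : D (herm c 1) = MvPolynomial.C a := by simpa [herm] using h
      have h1 : herm c 1 = lin c := rfl
      rw [herm_add_two, map_sub, Derivation.leibniz, h0, Derivation.leibniz, h, h1, herm]
      rw [MvPolynomial.derivation_C]
      simp only [smul_eq_mul, mul_zero, zero_add, Derivation.map_one_eq_zero, Nat.cast_one,
        MvPolynomial.C_mul, MvPolynomial.C_add, MvPolynomial.C_1]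
      ring
    | k + 2 =>
      have h1 := ih (k + 1) (by omega)
      have h2 := ih k (by omega)
      rw [herm_add_two, map_sub, Derivation.leibniz, Derivation.leibniz, h, h1, h2, herm_add_two]
      rw [MvPolynomial.derivation_C]
      simp only [smul_eq_mul, Nat.cast_add, Nat.cast_one, Nat.cast_ofNat, MvPolynomial.C_mul, MvPolynomial.C_add, MvPolynomial.C_1,
        map_ofNat]
      ring

lemma herm_succ (c : 𝓢(ℝ, ℝ) →₀ ℝ) (n : ℕ) :
    herm c (n + 1) = lin c * herm c n - dirDeriv (tot c) (herm c n) := by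
  cases n with
  | zero => simp [herm]
  | succ n => rw [derivation_herm _ c _ (dirDeriv_lin _ c), herm]

/-- Raising is adjoint to differentiation: integration by parts turns `lin c` into a derivative of
the product `herm c n * p`, and the part falling on `herm c n` is what `herm_succ` subtracts.
Iterating it yields orthogonality. -/
lemma expect_herm_succ_mul (hμ : IsWhiteNoiseMeasure μ) (c : 𝓢(ℝ, ℝ) →₀ ℝ) (n : ℕ) (p : Poly) :
    expect μ (herm c (n + 1) * p) = expect μ (herm c n * dirDeriv (tot c) p) := by
  rw [herm_succ, sub_mul, expect_sub hμ, mul_assoc, expect_lin_mul hμ, Derivation.leibniz,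
    expect_add hμ, smul_eq_mul, smul_eq_mul, mul_comm p]
  ring

lemma expect_herm_mul_herm (hμ : IsWhiteNoiseMeasure μ) (c d : 𝓢(ℝ, ℝ) →₀ ℝ) (n m : ℕ) :
    expect μ (herm c n * herm d m)
      = if n = m then (n.factorial : ℝ) * ip (tot c) (tot d) ^ n else 0 := by
  induction n generalizing m with
  | zero =>
    cases m with
    | zero => simp [herm, expect_one hμ]
    | succ m =>
      rw [mul_comm, expect_herm_succ_mul hμ]
      simp [herm, expect_zero]
  | succ n ih =>
    cases m with
    | zero =>
      rw [expect_herm_succ_mul hμ]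
      simp [herm, expect_zero]
    | succ m =>
      rw [expect_herm_succ_mul hμ, derivation_herm _ d _ (dirDeriv_lin _ d),
        mul_left_comm, ← MvPolynomial.smul_eq_C_mul, expect_smul, ih]
      by_cases h : n = m
      · subst h
        simp only [if_true, Nat.factorial_succ]
        push_cast
        ring
      · simp [h]

lemma derivative_hermite_succ (n : ℕ) :
    Polynomial.derivative (Polynomial.hermite (n + 1))
      = ((n : Polynomial ℤ) + 1) * Polynomial.hermite n := by
  induction n with
  | zero => simp
  | succ n ih =>
    rw [Polynomial.hermite_succ (n + 1)]
    simp only [Polynomial.derivative_sub, Polynomial.derivative_mul, Polynomial.derivative_X, ih,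
      Polynomial.derivative_add, Polynomial.derivative_natCast, Polynomial.derivative_one]
    have h := Polynomial.hermite_succ n
    push_cast
    linear_combination (-(n : Polynomial ℤ) - 1) * h

lemma hermite_add_two (n : ℕ) :
    Polynomial.hermite (n + 2) = Polynomial.X * Polynomial.hermite (n + 1)
      - ((n : Polynomial ℤ) + 1) * Polynomial.hermite n := by
  rw [Polynomial.hermite_succ (n + 1), derivative_hermite_succ]

lemma rv_herm (c : 𝓢(ℝ, ℝ) →₀ ℝ) (n : ℕ) (ω : Dist) :
    rv (herm c n) ω = l2Norm (tot c) ^ n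
      * Polynomial.aeval (ω (tot c) / l2Norm (tot c)) (Polynomial.hermite n) := by
  -- If the norm vanishes then `tot c = 0` and both sides are zero, so the convention for division
  -- by zero does no harm.
  have hω : ω (tot c) = l2Norm (tot c) * (ω (tot c) / l2Norm (tot c)) := by
    by_cases h : l2Norm (tot c) = 0
    · have h1 : ip (tot c) (tot c) = 0 := by rw [← l2Norm_sq, h]; simp
      have h2 : (tot c).toLp 2 volume = 0 := inner_self_eq_zero.mp h1
      have h3 : tot c = 0 := by
        refine SchwartzMap.injective_toLp 2 volume ?_
        exact h2.trans toLp_zero.symm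
      simp [h3]
    · field_simp
  induction n using Nat.strong_induction_on with
  | _ n ih =>
    match n with
    | 0 => simp [herm]
    | 1 => simpa [herm, rv_lin] using hω
    | k + 2 =>
      rw [herm, hermite_add_two, rv_sub, rv_mul, rv_mul, ih (k + 1) (by omega), ih k (by omega),
        rv_lin, rv_C, ← l2Norm_sq]
      simp only [map_sub, map_mul, Polynomial.aeval_X, map_add, map_natCast, map_one]
      linear_combination (l2Norm (tot c) ^ (k + 1) *
        Polynomial.aeval (ω (tot c) / l2Norm (tot c)) (Polynomial.hermite (k + 1))) * hω

/-! ### Homogeneous polynomial chaos -/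

/-- The polynomial random variables in the `n`-th Wiener chaos. -/
def chaos (n : ℕ) : Submodule ℝ Poly := Submodule.span ℝ (Set.range fun c => herm c n)

lemma herm_mem_chaos (c : 𝓢(ℝ, ℝ) →₀ ℝ) (n : ℕ) : herm c n ∈ chaos n :=
  Submodule.subset_span ⟨c, rfl⟩

/-- Polarization: if a polynomial curve stays in a subspace, so do its coefficients. A functional
vanishing on `W` but not on `v k` would give a nonzero real polynomial vanishing everywhere. -/
lemma mem_of_forall_sum_pow_smul_mem {E : Type*} [AddCommGroup E] [Module ℝ E]
    (W : Submodule ℝ E) (N : ℕ) (v : ℕ → E)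
    (h : ∀ s : ℝ, ∑ k ∈ Finset.range N, s ^ k • v k ∈ W) {k : ℕ} (hk : k < N) : v k ∈ W := by
  by_contra hv
  obtain ⟨f, hf, hW⟩ := Submodule.exists_le_ker_of_notMem hv
  set P : Polynomial ℝ := ∑ k ∈ Finset.range N, Polynomial.C (f (v k)) * Polynomial.X ^ k with hP
  have h0 : P = 0 := by
    refine Polynomial.funext fun s => ?_
    have h1 : f (∑ k ∈ Finset.range N, s ^ k • v k) = 0 := hW (h s)
    rw [map_sum] at h1
    simp only [map_smul, smul_eq_mul] at h1
    simp only [hP, Polynomial.eval_finsetSum, Polynomial.eval_mul, Polynomial.eval_C,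
      Polynomial.eval_pow, Polynomial.eval_X, Polynomial.eval_zero]
    rw [← h1]
    exact Finset.sum_congr rfl fun k _ => mul_comm _ _
  have h2 : P.coeff k = f (v k) := by
    simp [hP, Polynomial.coeff_C_mul, Polynomial.coeff_X_pow, hk]
  rw [h0, Polynomial.coeff_zero] at h2
  exact hf h2.symm

lemma span_lin_pow_eq_top :
    Submodule.span ℝ (Set.range fun x : (𝓢(ℝ, ℝ) →₀ ℝ) × ℕ => lin x.1 ^ x.2) = ⊤ := by
  set W := Submodule.span ℝ (Set.range fun x : (𝓢(ℝ, ℝ) →₀ ℝ) × ℕ => lin x.1 ^ x.2) with hW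
  have hmem : ∀ c n, lin c ^ n ∈ W := fun c n => Submodule.subset_span ⟨(c, n), rfl⟩
  have h1 : ∀ (ξ : 𝓢(ℝ, ℝ)) (p : Poly), p ∈ W → p * MvPolynomial.X ξ ∈ W := by
    intro ξ p hp
    induction hp using Submodule.span_induction with
    | mem x hx =>
      obtain ⟨⟨c, n⟩, rfl⟩ := hx
      -- The coefficient of `s` in `(s X_ξ + lin c)ⁿ⁺¹` is `(n + 1) X_ξ (lin c)ⁿ`; hence the span is
      -- stable under multiplication by variables.
      have h2 := mem_of_forall_sum_pow_smul_mem W (n + 2)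
        (fun k => ((n + 1).choose k : ℝ) • (MvPolynomial.X ξ ^ k * lin c ^ (n + 1 - k)))
        (fun s => ?_) (k := 1) (by omega)
      · simp only [pow_one, Nat.choose_one_right, Nat.add_sub_cancel] at h2
        have h3 := W.smul_mem (((n + 1 : ℕ) : ℝ)⁻¹) h2
        rwa [smul_smul, inv_mul_cancel₀ (by positivity), one_smul, mul_comm] at h3
      · have h3 := hmem (s • Finsupp.single ξ 1 + c) (n + 1)
        rw [map_add, map_smul, lin_single, one_smul, add_pow] at h3
        convert h3 using 2 with k hk
        rw [smul_pow, smul_mul_assoc, smul_mul_assoc, MvPolynomial.smul_eq_C_mul _ (Nat.cast _),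
          map_natCast, mul_comm (Nat.cast _) (_ * _)]
    | zero => simp
    | add x y _ _ hx hy => simpa [add_mul] using W.add_mem hx hy
    | smul a x _ hx => simpa [smul_mul_assoc] using W.smul_mem a hx
  refine eq_top_iff.mpr fun p _ => ?_
  induction p using MvPolynomial.induction_on with
  | C a =>
    have := W.smul_mem a (hmem 0 0)
    simpa [MvPolynomial.smul_eq_C_mul] using this
  | add p q hp hq => exact W.add_mem (hp trivial) (hq trivial)
  | mul_X p ξ hp => exact h1 ξ p (hp trivial)

/-- The three-term recursion makes the span of `herm c 0, herm c 1, …` stable under multiplication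
by `lin c`, so it contains all powers of `lin c`, and these span the polynomials. -/
lemma iSup_chaos : ⨆ n, chaos n = ⊤ := by
  refine eq_top_iff.mpr ?_
  rw [← span_lin_pow_eq_top, Submodule.span_le]
  rintro _ ⟨⟨c, n⟩, rfl⟩
  have hmem : ∀ n, herm c n ∈ Submodule.span ℝ (Set.range (herm c)) :=
    fun n => Submodule.subset_span ⟨n, rfl⟩
  have h1 : ∀ p ∈ Submodule.span ℝ (Set.range (herm c)),
      lin c * p ∈ Submodule.span ℝ (Set.range (herm c)) := by
    intro p hp
    induction hp using Submodule.span_induction with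
    | mem x hx =>
      obtain ⟨n, rfl⟩ := hx
      cases n with
      | zero => simpa [herm] using hmem 1
      | succ n =>
        have := Submodule.add_mem _ (hmem (n + 2))
          (Submodule.smul_mem _ (((n : ℝ) + 1) * ip (tot c) (tot c)) (hmem n))
        rwa [herm, MvPolynomial.smul_eq_C_mul, sub_add_cancel] at this
    | zero => simp
    | add x y _ _ hx hy => simpa [mul_add] using Submodule.add_mem _ hx hy
    | smul a x _ hx => simpa using Submodule.smul_mem _ a hx
  have h2 : lin c ^ n ∈ Submodule.span ℝ (Set.range (herm c)) := by
    induction n with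
    | zero => simpa [herm] using hmem 0
    | succ n ih => rw [pow_succ']; exact h1 _ ih
  refine (Submodule.span_le.mpr ?_) h2
  rintro _ ⟨k, rfl⟩
  exact Submodule.mem_iSup_of_mem k (herm_mem_chaos c k)

lemma exists_sum_chaos (p : Poly) :
    ∃ (N : ℕ) (f : ℕ → Poly), (∀ n, f n ∈ chaos n) ∧ p = ∑ n ∈ Finset.range N, f n := by
  have hp : p ∈ ⨆ n, chaos n := by rw [iSup_chaos]; trivial
  obtain ⟨f, hf, rfl⟩ := (Submodule.mem_iSup_iff_exists_finsupp _ _).mp hp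
  obtain ⟨N, hN⟩ := f.support.exists_nat_subset_range
  exact ⟨N, f, hf, Finsupp.sum_of_support_subset _ hN _ (by simp)⟩

lemma ptDeriv_herm_succ (t : ℝ) (c : 𝓢(ℝ, ℝ) →₀ ℝ) (n : ℕ) :
    ptDeriv t (herm c (n + 1)) = (((n : ℝ) + 1) * tot c t) • herm c n := by
  rw [derivation_herm _ c _ (ptDeriv_lin t c), MvPolynomial.smul_eq_C_mul]

lemma ptDeriv_herm_zero (t : ℝ) (c : 𝓢(ℝ, ℝ) →₀ ℝ) : ptDeriv t (herm c 0) = 0 := by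
  simp [herm]

lemma ptDeriv_mem_chaos {n : ℕ} {p : Poly} (hp : p ∈ chaos (n + 1)) (t : ℝ) :
    ptDeriv t p ∈ chaos n := by
  induction hp using Submodule.span_induction with
  | mem x hx =>
    obtain ⟨c, rfl⟩ := hx
    simp only [ptDeriv_herm_succ]
    exact Submodule.smul_mem _ _ (herm_mem_chaos c n)
  | zero => simp
  | add x y _ _ hx hy => simpa using Submodule.add_mem _ hx hy
  | smul a x _ hx => simpa using Submodule.smul_mem _ a hx

lemma ptDeriv_eq_zero_of_mem_chaos {p : Poly} (hp : p ∈ chaos 0) (t : ℝ) : ptDeriv t p = 0 := by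
  induction hp using Submodule.span_induction with
  | mem x hx =>
    obtain ⟨c, rfl⟩ := hx
    simp [herm]
  | zero => simp
  | add x y _ _ hx hy => simp [hx, hy]
  | smul a x _ hx => simp [hx]

/-! ### Hypercontractivity -/

lemma expect_ptDeriv_mul_aux (hμ : IsWhiteNoiseMeasure μ) {n : ℕ} {p : Poly} (hp : p ∈ chaos n)
    (m : ℕ) (d : 𝓢(ℝ, ℝ) →₀ ℝ) :
    Integrable (fun t => expect μ (ptDeriv t p * ptDeriv t (herm d m))) ∧
      ∫ t, expect μ (ptDeriv t p * ptDeriv t (herm d m)) = n * expect μ (p * herm d m) := by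
  induction hp using Submodule.span_induction with
  | mem x hx =>
    obtain ⟨c, rfl⟩ := hx
    cases n with
    | zero => simp [ptDeriv_herm_zero, expect_zero]
    | succ n =>
      cases m with
      | zero =>
        simp only [ptDeriv_herm_zero, mul_zero, expect_zero, integral_zero,
          expect_herm_mul_herm hμ]
        simp
      | succ m =>
        have h1 : ∀ t, expect μ (ptDeriv t (herm c (n + 1)) * ptDeriv t (herm d (m + 1)))
            = (((n : ℝ) + 1) * (m + 1) * expect μ (herm c n * herm d m)) * (tot c t * tot d t) := by
          intro t
          rw [ptDeriv_herm_succ, ptDeriv_herm_succ, smul_mul_smul_comm, expect_smul]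
          ring
        have h2 : Integrable (fun t => tot c t * tot d t) :=
          ((tot c).memLp 2 volume).integrable_mul ((tot d).memLp 2 volume)
        simp only [h1]
        refine ⟨h2.const_mul _, ?_⟩
        rw [integral_const_mul, ← ip_eq_integral, expect_herm_mul_herm hμ, expect_herm_mul_herm hμ]
        by_cases h : n = m
        · subst h
          simp only [if_true, Nat.factorial_succ]
          push_cast
          ring
        · simp [h]
  | zero => simp [expect_zero]
  | add x y _ _ hx hy =>
    simp only [map_add, add_mul, expect_add hμ]
    exact ⟨hx.1.add hy.1, by rw [integral_add hx.1 hy.1, hx.2, hy.2]; ring⟩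
  | smul a x _ hx =>
    simp only [Derivation.map_smul, smul_mul_assoc, expect_smul]
    exact ⟨hx.1.const_mul _, by rw [integral_const_mul, hx.2]; ring⟩

/-- The operator `∫ ∂_t^* ∂_t dt` is the number operator, with eigenvalue `n` on the `n`-th chaos.
The second factor is arbitrary because hypercontractivity uses it with `q = p³`. -/
lemma expect_ptDeriv_mul (hμ : IsWhiteNoiseMeasure μ) {n : ℕ} {p : Poly} (hp : p ∈ chaos n)
    (q : Poly) :
    Integrable (fun t => expect μ (ptDeriv t p * ptDeriv t q)) ∧
      ∫ t, expect μ (ptDeriv t p * ptDeriv t q) = n * expect μ (p * q) := by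
  have hq : q ∈ ⨆ n, chaos n := by rw [iSup_chaos]; trivial
  induction hq using Submodule.iSup_induction' with
  | mem m x hx =>
    induction hx using Submodule.span_induction with
    | mem x hx =>
      obtain ⟨d, rfl⟩ := hx
      exact expect_ptDeriv_mul_aux hμ hp m d
    | zero => simp [expect_zero]
    | add x y _ _ hx hy =>
      simp only [map_add, mul_add, expect_add hμ]
      exact ⟨hx.1.add hy.1, by rw [integral_add hx.1 hy.1, hx.2, hy.2]⟩
    | smul a x _ hx =>
      simp only [Derivation.map_smul, mul_smul_comm, expect_smul]
      exact ⟨hx.1.const_mul _, by rw [integral_const_mul, hx.2]; ring⟩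
  | zero => simp [expect_zero]
  | add x y _ _ hx hy =>
    simp only [map_add, mul_add, expect_add hμ]
    exact ⟨hx.1.add hy.1, by rw [integral_add hx.1 hy.1, hx.2, hy.2]⟩

lemma expect_sq_nonneg (p : Poly) : 0 ≤ expect μ (p ^ 2) :=
  integral_nonneg fun ω => by simpa using sq_nonneg (rv p ω)

lemma expect_mul_le (hμ : IsWhiteNoiseMeasure μ) (p q : Poly) :
    expect μ (p * q) ≤ √(expect μ (p ^ 2)) * √(expect μ (q ^ 2)) := by
  rw [← Real.sqrt_mul (expect_sq_nonneg p)]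
  refine Real.le_sqrt_of_sq_le ?_
  have h : ∀ s : ℝ, 0 ≤ expect μ (p ^ 2) * (s * s) + (2 * expect μ (p * q)) * s
      + expect μ (q ^ 2) := by
    intro s
    have h1 := expect_sq_nonneg (μ := μ) (s • p + q)
    have h2 : (s • p + q) ^ 2 = (s * s) • p ^ 2 + (2 * s) • (p * q) + q ^ 2 := by
      simp only [MvPolynomial.smul_eq_C_mul, MvPolynomial.C_mul]
      rw [show (MvPolynomial.C (2 : ℝ) : Poly) = 2 from map_ofNat _ 2]
      ring
    rw [h2, expect_add hμ, expect_add hμ, expect_smul, expect_smul] at h1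
    linarith
  have := discrim_le_zero h
  rw [discrim] at this
  nlinarith

/-- Hypercontractivity on the `n`-th chaos. -/
theorem sqrt_expect_pow_four_le (hμ : IsWhiteNoiseMeasure μ) {n : ℕ} {p : Poly}
    (hp : p ∈ chaos n) : √(expect μ (p ^ 4)) ≤ 3 ^ n * expect μ (p ^ 2) := by
  induction n generalizing p with
  | zero =>
    obtain ⟨a, rfl⟩ : ∃ a : ℝ, p = MvPolynomial.C a := by
      induction hp using Submodule.span_induction with
      | mem x hx =>
        obtain ⟨c, rfl⟩ := hx
        exact ⟨1, by simp [herm]⟩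
      | zero => exact ⟨0, by simp⟩
      | add x y _ _ hx hy =>
        obtain ⟨a, rfl⟩ := hx
        obtain ⟨b, rfl⟩ := hy
        exact ⟨a + b, by simp⟩
      | smul a x _ hx =>
        obtain ⟨b, rfl⟩ := hx
        exact ⟨a * b, by simp [MvPolynomial.smul_eq_C_mul]⟩
    have := hμ.isProbabilityMeasure
    have h4 : expect μ (MvPolynomial.C a ^ 4) = (a ^ 2) ^ 2 := by
      simp [expect]
      ring
    have h2 : expect μ (MvPolynomial.C a ^ 2) = a ^ 2 := by simp [expect]
    rw [h4, h2, Real.sqrt_sq (sq_nonneg a)]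
    simp
  | succ n ih =>
    set Q := √(expect μ (p ^ 4)) with hQ
    have h4 : ∀ q : Poly, expect μ (q ^ 4) = expect μ ((q ^ 2) ^ 2) := fun q => by
      rw [← pow_mul]
    have hnn : 0 ≤ expect μ (p ^ 4) := by rw [h4]; exact expect_sq_nonneg _
    obtain ⟨hi1, he1⟩ := expect_ptDeriv_mul hμ hp (p ^ 3)
    obtain ⟨hi2, he2⟩ := expect_ptDeriv_mul hμ hp p
    -- Here `∂_t p³ = 3 p² ∂_t p`, Cauchy–Schwarz separates `p²` from `(∂_t p)²`, and the induction
    -- hypothesis applies to `∂_t p`, which lies one chaos lower. Integrating over `t` turns both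
    -- sides into multiples of `n + 1`.
    have hle : ∀ t, expect μ (ptDeriv t p * ptDeriv t (p ^ 3))
        ≤ (3 * Q * 3 ^ n) * expect μ (ptDeriv t p * ptDeriv t p) := by
      intro t
      have h5 : ptDeriv t p * ptDeriv t (p ^ 3) = (3 : ℝ) • (p ^ 2 * ptDeriv t p ^ 2) := by
        rw [Derivation.leibniz_pow, MvPolynomial.smul_eq_C_mul,
          show (MvPolynomial.C (3 : ℝ) : Poly) = 3 from map_ofNat _ 3]
        simp
        ring
      rw [h5, expect_smul, ← pow_two]
      have h6 := expect_mul_le hμ (p ^ 2) (ptDeriv t p ^ 2)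
      rw [← h4, ← h4, ← hQ] at h6
      have h7 := ih (ptDeriv_mem_chaos hp t)
      have h8 := mul_le_mul_of_nonneg_left h7 (Real.sqrt_nonneg (expect μ (p ^ 4)))
      rw [← hQ] at h8
      nlinarith
    have h9 := integral_mono hi1 (hi2.const_mul _) hle
    rw [integral_const_mul, he1, he2, ← pow_succ', ← pow_two] at h9
    have h10 : expect μ (p ^ 4) = Q * Q := (Real.mul_self_sqrt hnn).symm
    have hn : (0 : ℝ) < ((n + 1 : ℕ) : ℝ) := by positivity
    have h11 : Q * Q ≤ Q * (3 ^ (n + 1) * expect μ (p ^ 2)) := by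
      have h12 : ((n + 1 : ℕ) : ℝ) * (Q * Q)
          ≤ ((n + 1 : ℕ) : ℝ) * (Q * (3 ^ (n + 1) * expect μ (p ^ 2))) := by
        calc _ = ((n + 1 : ℕ) : ℝ) * expect μ (p ^ (3 + 1)) := by rw [h10]
          _ ≤ _ := h9
          _ = _ := by ring
      exact le_of_mul_le_mul_left h12 hn
    rcases (Real.sqrt_nonneg (expect μ (p ^ 4))).eq_or_lt with h0 | h0
    · rw [hQ, ← h0]
      have := expect_sq_nonneg (μ := μ) p
      positivity
    · exact le_of_mul_le_mul_left h11 h0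

/-! ### Slices of square integrable functions -/

/-- The space `L²(ℝⁿ)`. -/
abbrev L2 (n : ℕ) : Type := Lp ℝ 2 (volume : Measure (Fin n → ℝ))

lemma enorm_sq_eq_lintegral {α E : Type*} [MeasurableSpace α] [NormedAddCommGroup E]
    {m : Measure α} (f : Lp E 2 m) : ‖f‖ₑ ^ 2 = ∫⁻ x, ‖f x‖ₑ ^ 2 ∂m := by
  rw [Lp.enorm_def]
  have h := eLpNorm_nnreal_pow_eq_lintegral (f := f) (μ := m) (p := 2) (by simp)
  simpa using h

lemma memLp_two_iff_lintegral {α E : Type*} [MeasurableSpace α] [NormedAddCommGroup E]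
    {m : Measure α} {f : α → E} (hf : AEStronglyMeasurable f m) :
    MemLp f 2 m ↔ ∫⁻ x, ‖f x‖ₑ ^ 2 ∂m < ∞ := by
  have h := eLpNorm_nnreal_pow_eq_lintegral (f := f) (μ := m) (p := 2) (by simp)
  have h2 : ∫⁻ x, ‖f x‖ₑ ^ 2 ∂m = eLpNorm f 2 m ^ 2 := by simpa using h.symm
  rw [h2, ENNReal.pow_lt_top_iff]
  simp [MemLp, hf]

/-- Appending a last coordinate. -/
def snocR {n : ℕ} (z : ℝ × (Fin n → ℝ)) : Fin (n + 1) → ℝ :=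
  Fin.snoc (α := fun _ => ℝ) z.2 z.1

lemma measurePreserving_snocR (n : ℕ) :
    MeasurePreserving (snocR (n := n)) (volume.prod volume) volume := by
  have h := (volume_preserving_piFinSuccAbove (fun _ : Fin (n + 1) => ℝ) (Fin.last n)).symm
  have h2 : ⇑(MeasurableEquiv.piFinSuccAbove (fun _ : Fin (n + 1) => ℝ) (Fin.last n)).symm
      = snocR := by
    ext z : 1
    exact Fin.insertNth_last' z.1 z.2
  rw [h2] at h
  exact h

lemma ae_ae_snocR {n : ℕ} {P : (Fin (n + 1) → ℝ) → Prop} (h : ∀ᵐ y, P y) :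
    ∀ᵐ t : ℝ, ∀ᵐ x : Fin n → ℝ, P (snocR (t, x)) :=
  Measure.ae_ae_of_ae_prod ((measurePreserving_snocR n).quasiMeasurePreserving.ae h)

lemma lintegral_snocR {n : ℕ} {f : (Fin (n + 1) → ℝ) → ℝ≥0∞} (hf : AEMeasurable f) :
    ∫⁻ y, f y = ∫⁻ t : ℝ, ∫⁻ x : Fin n → ℝ, f (snocR (t, x)) := by
  have hm := measurePreserving_snocR n
  rw [← hm.map_eq] at hf ⊢
  rw [lintegral_map' hf hm.measurable.aemeasurable]
  exact lintegral_prod _ (hf.comp_measurable hm.measurable)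

lemma memLp_snocR {n : ℕ} (f : L2 (n + 1)) :
    ∀ᵐ t : ℝ, MemLp (fun x : Fin n → ℝ => f (snocR (t, x))) 2 volume := by
  have hsm : StronglyMeasurable fun z : ℝ × (Fin n → ℝ) => f (snocR z) :=
    (Lp.stronglyMeasurable f).comp_measurable (measurePreserving_snocR n).measurable
  have h := enorm_sq_eq_lintegral f
  rw [lintegral_snocR ((Lp.stronglyMeasurable f).enorm.pow_const 2).aemeasurable] at h
  have h1 : ∫⁻ t : ℝ, ∫⁻ x : Fin n → ℝ, ‖f (snocR (t, x))‖ₑ ^ 2 ≠ ∞ := by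
    rw [← h]
    simp
  have hmeas : Measurable fun t : ℝ => ∫⁻ x : Fin n → ℝ, ‖f (snocR (t, x))‖ₑ ^ 2 :=
    (hsm.enorm.pow_const 2).lintegral_prod_right'
  filter_upwards [ae_lt_top hmeas h1] with t ht
  exact (memLp_two_iff_lintegral
    (hsm.comp_measurable measurable_prodMk_left).aestronglyMeasurable).mpr ht

open Classical in
/-- The slice `f (·, t)`. -/
def slice {n : ℕ} (f : L2 (n + 1)) (t : ℝ) : L2 n :=
  if h : MemLp (fun x : Fin n → ℝ => f (snocR (t, x))) 2 volume then h.toLp _ else 0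

lemma slice_ae {n : ℕ} (f : L2 (n + 1)) :
    ∀ᵐ t : ℝ, slice f t =ᵐ[volume] fun x => f (snocR (t, x)) := by
  filter_upwards [memLp_snocR f] with t ht
  rw [slice, dif_pos ht]
  exact ht.coeFn_toLp

lemma slice_eq_of_ae {n : ℕ} (f : L2 (n + 1)) {u : ℝ → L2 n}
    (h : ∀ᵐ t : ℝ, ∀ᵐ x : Fin n → ℝ, f (snocR (t, x)) = u t x) :
    ∀ᵐ t : ℝ, slice f t = u t := by
  filter_upwards [slice_ae f, h] with t h1 h2
  exact Lp.ext (h1.trans h2)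

lemma slice_add {n : ℕ} (f g : L2 (n + 1)) :
    ∀ᵐ t : ℝ, slice (f + g) t = slice f t + slice g t := by
  filter_upwards [slice_ae (f + g), slice_ae f, slice_ae g, ae_ae_snocR (Lp.coeFn_add f g)]
    with t h1 h2 h3 h4
  refine Lp.ext ?_
  filter_upwards [h1, h2, h3, h4, Lp.coeFn_add (slice f t) (slice g t)] with x k1 k2 k3 k4 k5
  rw [k1, k4, k5, Pi.add_apply, Pi.add_apply, k2, k3]

lemma slice_smul {n : ℕ} (a : ℝ) (f : L2 (n + 1)) :
    ∀ᵐ t : ℝ, slice (a • f) t = a • slice f t := by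
  filter_upwards [slice_ae (a • f), slice_ae f, ae_ae_snocR (Lp.coeFn_smul a f)] with t h1 h2 h4
  refine Lp.ext ?_
  filter_upwards [h1, h2, h4, Lp.coeFn_smul a (slice f t)] with x k1 k2 k4 k5
  rw [k1, k4, k5, Pi.smul_apply, Pi.smul_apply, k2]

/-- Pettis' measurability theorem in a separable Hilbert space: `u` is the pointwise limit of the
partial sums of its expansion in a Hilbert basis. Countability of the basis makes the filter of
finite subsets countably generated. -/
lemma aestronglyMeasurable_of_inner {E α : Type*} [NormedAddCommGroup E] [InnerProductSpace ℝ E]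
    [CompleteSpace E] [TopologicalSpace.SeparableSpace E] [MeasurableSpace α] {m : Measure α}
    {u : α → E} (h : ∀ e : E, AEStronglyMeasurable (fun t => (inner ℝ (u t) e : ℝ)) m) :
    AEStronglyMeasurable u m := by
  obtain ⟨w, b, hb⟩ := exists_hilbertBasis ℝ E
  have hw : w.Countable := by
    -- Orthonormal vectors are at distance `√2 > 1`, so their balls of radius `1/2` are disjoint.
    refine Set.PairwiseDisjoint.countable_of_isOpen (s := fun e => Metric.ball e (1 / 2))
      (fun x hx y hy hxy => ?_) (fun _ _ => Metric.isOpen_ball)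
      (fun e _ => ⟨e, Metric.mem_ball_self (by norm_num)⟩)
    refine Metric.ball_disjoint_ball ?_
    have ho := b.orthonormal
    rw [hb] at ho
    have h1 : ‖x - y‖ * ‖x - y‖ = 2 := by
      have hx1 : ‖x‖ = 1 := ho.1 ⟨x, hx⟩
      have hy1 : ‖y‖ = 1 := ho.1 ⟨y, hy⟩
      have h0 : inner ℝ x y = 0 := ho.2 (i := ⟨x, hx⟩) (j := ⟨y, hy⟩) (by simpa using hxy)
      rw [norm_sub_mul_self_real, hx1, hy1, h0]
      norm_num
    rw [dist_eq_norm]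
    nlinarith [norm_nonneg (x - y)]
  have : Countable w := hw
  refine aestronglyMeasurable_of_tendsto_ae (u := (atTop : Filter (Finset w)))
    (f := fun s t => ∑ i ∈ s, (inner ℝ (u t) (b i) : ℝ) • b i) (fun s => ?_) (ae_of_all _ fun t => ?_)
  · exact Finset.aestronglyMeasurable_fun_sum s fun i _ => (h (b i)).smul_const _
  · have h2 := b.hasSum_repr (u t)
    simp only [b.repr_apply_apply, real_inner_comm] at h2
    exact h2

instance : Fact ((2 : ℝ≥0∞) ≠ ∞) := ⟨by simp⟩

instance (n : ℕ) : TopologicalSpace.SeparableSpace (L2 n) := inferInstance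

lemma aestronglyMeasurable_slice {n : ℕ} (f : L2 (n + 1)) : AEStronglyMeasurable (slice f) := by
  refine aestronglyMeasurable_of_inner fun e => ?_
  have h1 : AEStronglyMeasurable (fun t : ℝ => ∫ x, f (snocR (t, x)) * e x) := by
    have h2 : StronglyMeasurable fun z : ℝ × (Fin n → ℝ) => f (snocR z) * e z.2 :=
      ((Lp.stronglyMeasurable f).comp_measurable (measurePreserving_snocR n).measurable).mul
        ((Lp.stronglyMeasurable e).comp_measurable measurable_snd)
    exact h2.integral_prod_right'.aestronglyMeasurable
  refine h1.congr ?_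
  filter_upwards [slice_ae f] with t ht
  rw [L2.inner_def]
  refine integral_congr_ae ?_
  filter_upwards [ht] with x hx
  simp [hx, mul_comm]

lemma lintegral_enorm_slice {n : ℕ} (f : L2 (n + 1)) : ∫⁻ t, ‖slice f t‖ₑ ^ 2 = ‖f‖ₑ ^ 2 := by
  rw [enorm_sq_eq_lintegral f,
    lintegral_snocR ((Lp.stronglyMeasurable f).enorm.pow_const 2).aemeasurable]
  refine lintegral_congr_ae ?_
  filter_upwards [slice_ae f] with t ht
  rw [enorm_sq_eq_lintegral]
  refine lintegral_congr_ae ?_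
  filter_upwards [ht] with x hx
  rw [hx]

lemma memLp_slice {n : ℕ} (f : L2 (n + 1)) : MemLp (slice f) 2 volume := by
  rw [memLp_two_iff_lintegral (aestronglyMeasurable_slice f), lintegral_enorm_slice]
  simp

/-- The isometry `L²(ℝⁿ⁺¹) → L²(ℝ; L²(ℝⁿ))`. -/
def sliceL (n : ℕ) : L2 (n + 1) →ₗᵢ[ℝ] Lp (L2 n) 2 (volume : Measure ℝ) where
  toFun f := (memLp_slice f).toLp _
  map_add' f g := by
    rw [← MemLp.toLp_add]
    exact MemLp.toLp_congr _ _ (slice_add f g)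
  map_smul' a f := by
    rw [RingHom.id_apply, ← MemLp.toLp_const_smul]
    exact MemLp.toLp_congr _ _ (slice_smul a f)
  norm_map' f := by
    have h : ‖(memLp_slice f).toLp (slice f)‖ₑ ^ 2 = ‖f‖ₑ ^ 2 := by
      rw [enorm_sq_eq_lintegral, ← lintegral_enorm_slice f]
      refine lintegral_congr_ae ?_
      filter_upwards [(memLp_slice f).coeFn_toLp] with t ht
      rw [ht]
    have h2 := (ENNReal.pow_right_strictMono (n := 2) (by simp)).injective h
    simpa using congrArg ENNReal.toReal h2

lemma sliceL_ae {n : ℕ} (f : L2 (n + 1)) : sliceL n f =ᵐ[volume] slice f :=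
  (memLp_slice f).coeFn_toLp

lemma slice_sub {n : ℕ} (f g : L2 (n + 1)) :
    ∀ᵐ t : ℝ, slice (f - g) t = slice f t - slice g t := by
  filter_upwards [sliceL_ae (f - g), sliceL_ae f, sliceL_ae g,
    Lp.coeFn_sub (sliceL n f) (sliceL n g)] with t h1 h2 h3 h4
  rw [← h1, map_sub, h4, ← h2, ← h3, Pi.sub_apply]

lemma integrable_inner_slice {n : ℕ} (f g : L2 (n + 1)) :
    Integrable fun t => (inner ℝ (slice f t) (slice g t) : ℝ) := by
  refine (L2.integrable_inner (𝕜 := ℝ) (sliceL n f) (sliceL n g)).congr ?_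
  filter_upwards [sliceL_ae f, sliceL_ae g] with t h1 h2
  rw [h1, h2]

lemma integral_inner_slice {n : ℕ} (f g : L2 (n + 1)) :
    ∫ t, (inner ℝ (slice f t) (slice g t) : ℝ) = inner ℝ f g := by
  rw [← (sliceL n).inner_map_map, L2.inner_def]
  refine integral_congr_ae ?_
  filter_upwards [sliceL_ae f, sliceL_ae g] with t h1 h2
  rw [h1, h2]

lemma eq_of_slice_eq {n : ℕ} {f g : L2 (n + 1)} (h : ∀ᵐ t, slice f t = slice g t) : f = g := by
  refine (sliceL n).injective (Lp.ext ?_)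
  exact (sliceL_ae f).trans (EventuallyEq.trans h (sliceL_ae g).symm)

/-- A square integrable function with values in `L²(ℝⁿ)` comes from an element of `L²(ℝⁿ⁺¹)`. -/
lemma exists_slice_eq {n : ℕ} {u : ℝ → L2 n} (hu : MemLp u 2 volume) :
    ∃ g : L2 (n + 1), ∀ᵐ t, slice g t = u t := by
  -- A step function `1_s(t) c` comes from `1_s(t) c(x)`, and the range of the isometry `sliceL` is
  -- closed, so the property passes to limits.
  refine MemLp.induction (p := 2) (by simp) (fun u => ∃ g : L2 (n + 1), ∀ᵐ t, slice g t = u t)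
    (fun c s hs hfin => ?_) (fun f g _ _ _ hf hg => ?_) ?_ (fun f g hfg _ hf => ?_) hu
  · have hm : Measurable fun y : Fin (n + 1) → ℝ =>
        s.indicator (fun _ => (1 : ℝ)) (y (Fin.last n)) * c (Fin.init y) := by
      refine ((measurable_const.indicator hs).comp (measurable_pi_apply _)).mul
        ((Lp.stronglyMeasurable c).measurable.comp ?_)
      exact measurable_pi_lambda _ fun i => measurable_pi_apply _
    have h1 : ∀ (t : ℝ) (x : Fin n → ℝ), s.indicator (fun _ => (1 : ℝ)) (snocR (t, x) (Fin.last n))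
        * c (Fin.init (snocR (t, x))) = s.indicator (fun _ => (1 : ℝ)) t * c x := by
      intro t x
      simp [snocR]
    have h2 : MemLp (fun y : Fin (n + 1) → ℝ =>
        s.indicator (fun _ => (1 : ℝ)) (y (Fin.last n)) * c (Fin.init y)) 2 volume := by
      rw [memLp_two_iff_lintegral hm.aestronglyMeasurable,
        lintegral_snocR (hm.enorm.pow_const 2).aemeasurable]
      simp only [h1, enorm_mul, mul_pow]
      have h3 : ∀ t : ℝ, ∫⁻ x, ‖s.indicator (fun _ => (1 : ℝ)) t‖ₑ ^ 2 * ‖c x‖ₑ ^ 2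
          = s.indicator (fun _ => ‖c‖ₑ ^ 2) t := by
        intro t
        rw [lintegral_const_mul' _ _ (by simp), ← enorm_sq_eq_lintegral]
        by_cases ht : t ∈ s <;> simp [ht]
      simp only [h3]
      rw [lintegral_indicator hs, lintegral_const]
      exact ENNReal.mul_lt_top (by simp) (by simpa using hfin)
    refine ⟨h2.toLp _, slice_eq_of_ae _ ?_⟩
    filter_upwards [ae_ae_snocR h2.coeFn_toLp] with t ht
    by_cases hts : t ∈ s
    · filter_upwards [ht] with x hx
      rw [hx, h1]
      simp [hts]
    · filter_upwards [ht] with x hx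
      rw [hx, h1]
      simp [hts]
  · obtain ⟨f', hf'⟩ := hf
    obtain ⟨g', hg'⟩ := hg
    refine ⟨f' + g', ?_⟩
    filter_upwards [hf', hg', slice_add f' g'] with t h1 h2 h3
    rw [h3, h1, h2, Pi.add_apply]
  · have h : {f : Lp (L2 n) 2 (volume : Measure ℝ) | ∃ g : L2 (n + 1), ∀ᵐ t, slice g t = f t}
        = Set.range (sliceL n) := by
      ext f
      refine exists_congr fun g => ⟨fun h => ?_, fun h => ?_⟩
      · exact Lp.ext ((sliceL_ae g).trans h)
      · rw [← h]
        exact (sliceL_ae g).symm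
    rw [h]
    exact (sliceL n).isometry.isClosedEmbedding.isClosed_range
  · obtain ⟨f', hf'⟩ := hf
    refine ⟨f', ?_⟩
    filter_upwards [hf', hfg] with t h1 h2
    rw [h1, h2]

/-! ### Permutations of the variables and symmetric functions -/

lemma measurePreserving_comp_perm {n : ℕ} (σ : Equiv.Perm (Fin n)) :
    MeasurePreserving (fun x : Fin n → ℝ => x ∘ σ) volume volume := by
  have h := volume_measurePreserving_piCongrLeft (fun _ : Fin n => ℝ) σ.symm
  convert h using 1
  ext x i
  simp [MeasurableEquiv.piCongrLeft, Equiv.piCongrLeft, Equiv.piCongrLeft']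

/-- Permutation of the variables. -/
def permL {n : ℕ} (σ : Equiv.Perm (Fin n)) : L2 n →ₗᵢ[ℝ] L2 n :=
  Lp.compMeasurePreservingₗᵢ ℝ (fun x : Fin n → ℝ => x ∘ σ) (measurePreserving_comp_perm σ)

lemma permL_ae {n : ℕ} (σ : Equiv.Perm (Fin n)) (f : L2 n) :
    permL σ f =ᵐ[volume] fun x => f (x ∘ σ) :=
  Lp.coeFn_compMeasurePreserving f (measurePreserving_comp_perm σ)

lemma isSymm_iff {n : ℕ} (f : L2 n) : IsSymm f ↔ ∀ σ, permL σ f = f := by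
  refine forall_congr' fun σ => ⟨fun h => Lp.ext ((permL_ae σ f).trans h), fun h => ?_⟩
  have := permL_ae σ f
  rw [h] at this
  exact this.symm

lemma permL_mul {n : ℕ} (σ τ : Equiv.Perm (Fin n)) (f : L2 n) :
    permL σ (permL τ f) = permL (σ * τ) f := by
  refine Lp.ext ?_
  filter_upwards [permL_ae σ (permL τ f), permL_ae (σ * τ) f,
    (measurePreserving_comp_perm σ).quasiMeasurePreserving.ae (permL_ae τ f)] with x h1 h2 h3
  rw [h1, h2, h3]
  rfl

/-- The subspace of symmetric functions. -/
def symmSub (n : ℕ) : Submodule ℝ (L2 n) where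
  carrier := {f | IsSymm f}
  add_mem' {f g} hf hg := by
    rw [Set.mem_ofPred_eq, isSymm_iff] at *
    intro σ
    rw [map_add, hf, hg]
  zero_mem' := by
    rw [Set.mem_ofPred_eq, isSymm_iff]
    simp
  smul_mem' a f hf := by
    rw [Set.mem_ofPred_eq, isSymm_iff] at *
    intro σ
    rw [map_smul, hf]

lemma mem_symmSub {n : ℕ} {f : L2 n} : f ∈ symmSub n ↔ IsSymm f := Iff.rfl

lemma isClosed_symmSub (n : ℕ) : IsClosed (symmSub n : Set (L2 n)) := by
  have h : (symmSub n : Set (L2 n)) = ⋂ σ, {f | permL σ f = f} := by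
    ext f
    simp [mem_symmSub, isSymm_iff]
  rw [h]
  exact isClosed_iInter fun σ => isClosed_eq (permL σ).continuous continuous_id

/-- The symmetrization. -/
def symL (n : ℕ) : L2 n →ₗ[ℝ] L2 n :=
  ((n.factorial : ℝ)⁻¹) • ∑ σ : Equiv.Perm (Fin n), (permL σ).toLinearMap

lemma symL_apply {n : ℕ} (f : L2 n) : symL n f = (n.factorial : ℝ)⁻¹ • ∑ σ, permL σ f := by
  simp [symL]

lemma symL_ae {n : ℕ} (f : L2 n) :
    symL n f =ᵐ[volume] fun x => (n.factorial : ℝ)⁻¹ * ∑ σ : Equiv.Perm (Fin n), f (x ∘ σ) := by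
  rw [symL_apply]
  filter_upwards [Lp.coeFn_smul (n.factorial : ℝ)⁻¹ (∑ σ, permL σ f),
    Lp.coeFn_fun_finsetSum Finset.univ fun σ => permL σ f,
    ae_all_iff.mpr fun σ => permL_ae σ f] with x h1 h2 h3
  rw [h1, Pi.smul_apply, h2, smul_eq_mul]
  simp [h3]

lemma symL_of_isSymm {n : ℕ} {f : L2 n} (hf : IsSymm f) : symL n f = f := by
  rw [isSymm_iff] at hf
  rw [symL_apply]
  simp only [hf, Finset.sum_const, Finset.card_univ, Fintype.card_perm, Fintype.card_fin]
  rw [← Nat.cast_smul_eq_nsmul ℝ, smul_smul, inv_mul_cancel₀ (by positivity), one_smul]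

lemma isSymm_symL {n : ℕ} (f : L2 n) : IsSymm (symL n f) := by
  rw [isSymm_iff]
  intro σ
  rw [symL_apply, map_smul, map_sum]
  congr 1
  simp only [permL_mul]
  exact Fintype.sum_equiv (Equiv.mulLeft σ) _ _ fun τ => rfl

lemma norm_symL_le {n : ℕ} (f : L2 n) : ‖symL n f‖ ≤ ‖f‖ := by
  rw [symL_apply, norm_smul]
  have h : ‖∑ σ : Equiv.Perm (Fin n), permL σ f‖ ≤ n.factorial * ‖f‖ := by
    refine (norm_sum_le _ _).trans ?_
    simp [Fintype.card_perm]
  rw [norm_inv, RCLike.norm_natCast]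
  calc _ ≤ (n.factorial : ℝ)⁻¹ * (n.factorial * ‖f‖) := by gcongr
    _ = ‖f‖ := by rw [← mul_assoc, inv_mul_cancel₀ (by positivity), one_mul]

lemma inner_permL_of_isSymm {n : ℕ} {f : L2 n} (hf : IsSymm f) (σ : Equiv.Perm (Fin n)) (g : L2 n) :
    inner ℝ f (permL σ g) = inner ℝ f g := by
  conv_lhs => rw [← (isSymm_iff f).mp hf σ]
  exact (permL σ).inner_map_map f g

lemma inner_symL_of_isSymm {n : ℕ} {f : L2 n} (hf : IsSymm f) (g : L2 n) :
    inner ℝ f (symL n g) = inner ℝ f g := by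
  rw [symL_apply, inner_smul_right, inner_sum]
  simp only [inner_permL_of_isSymm hf, Finset.sum_const, Finset.card_univ, Fintype.card_perm,
    Fintype.card_fin, nsmul_eq_mul]
  rw [← mul_assoc, inv_mul_cancel₀ (by positivity), one_mul]

/-- The extension of a permutation of `Fin n` to `Fin (n + 1)` that fixes the last element. -/
def extendPerm {n : ℕ} (σ : Equiv.Perm (Fin n)) : Equiv.Perm (Fin (n + 1)) :=
  finSuccEquivLast.permCongr.symm (Equiv.optionCongr σ)

lemma snocR_comp_extendPerm {n : ℕ} (σ : Equiv.Perm (Fin n)) (t : ℝ) (x : Fin n → ℝ) :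
    snocR (t, x) ∘ extendPerm σ = snocR (t, x ∘ σ) := by
  ext i
  refine Fin.lastCases ?_ (fun i => ?_) i
  · simp [snocR, extendPerm, Equiv.permCongr]
  · simp [snocR, extendPerm, Equiv.permCongr]

lemma isSymm_slice {n : ℕ} {f : L2 (n + 1)} (hf : IsSymm f) : ∀ᵐ t, IsSymm (slice f t) := by
  have h : ∀ σ : Equiv.Perm (Fin n), ∀ᵐ t : ℝ, ∀ᵐ x : Fin n → ℝ,
      f (snocR (t, x ∘ σ)) = f (snocR (t, x)) := by
    intro σ
    filter_upwards [ae_ae_snocR (hf (extendPerm σ))] with t ht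
    filter_upwards [ht] with x hx
    rwa [snocR_comp_extendPerm] at hx
  filter_upwards [slice_ae f, ae_all_iff.mpr h] with t h1 h2 σ
  filter_upwards [h1, h2 σ, (measurePreserving_comp_perm σ).quasiMeasurePreserving.ae h1]
    with x k1 k2 k3
  rw [k3, k1, k2]

/-! ### Tensor products of Schwartz functions -/

lemma memLp_tensor {n : ℕ} (ξ : Fin n → 𝓢(ℝ, ℝ)) :
    MemLp (fun x : Fin n → ℝ => ∏ i, ξ i (x i)) 2 volume := by
  have hc : Continuous fun x : Fin n → ℝ => ∏ i, ξ i (x i) :=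
    continuous_finsetProd _ fun i _ => (ξ i).continuous.comp (continuous_apply i)
  rw [memLp_two_iff_integrable_sq hc.aestronglyMeasurable]
  simp only [← Finset.prod_pow]
  exact Integrable.fintype_prod (f := fun i t => ξ i t ^ 2) fun i => ((ξ i).memLp 2 volume).integrable_sq

/-- The function `∏ ξᵢ(xᵢ)` in `L²(ℝⁿ)`. -/
def tensor {n : ℕ} (ξ : Fin n → 𝓢(ℝ, ℝ)) : L2 n := (memLp_tensor ξ).toLp _

lemma tensor_ae {n : ℕ} (ξ : Fin n → 𝓢(ℝ, ℝ)) :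
    tensor ξ =ᵐ[volume] fun x => ∏ i, ξ i (x i) := (memLp_tensor ξ).coeFn_toLp

lemma inner_tensor {n : ℕ} (ξ η : Fin n → 𝓢(ℝ, ℝ)) :
    inner ℝ (tensor ξ) (tensor η) = ∏ i, ip (ξ i) (η i) := by
  simp only [ip_eq_integral]
  rw [← integral_fintype_prod_volume_eq_prod (fun i t => ξ i t * η i t), L2.inner_def]
  refine integral_congr_ae ?_
  filter_upwards [tensor_ae ξ, tensor_ae η] with x h1 h2
  simp [h1, h2, Finset.prod_mul_distrib, mul_comm]

lemma permL_tensor {n : ℕ} (σ : Equiv.Perm (Fin n)) (ξ : Fin n → 𝓢(ℝ, ℝ)) :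
    permL σ (tensor ξ) = tensor (ξ ∘ σ.symm) := by
  refine Lp.ext ?_
  filter_upwards [permL_ae σ (tensor ξ), tensor_ae (ξ ∘ σ.symm),
    (measurePreserving_comp_perm σ).quasiMeasurePreserving.ae (tensor_ae ξ)] with x h1 h2 h3
  rw [h1, h2, h3]
  exact Fintype.prod_equiv σ _ _ fun i => by simp

lemma isSymm_tensor_const {n : ℕ} (ξ : 𝓢(ℝ, ℝ)) : IsSymm (tensor fun _ : Fin n => ξ) := by
  rw [isSymm_iff]
  intro σ
  rw [permL_tensor]
  rfl

lemma slice_tensor {n : ℕ} (ξ : Fin (n + 1) → 𝓢(ℝ, ℝ)) :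
    ∀ᵐ t, slice (tensor ξ) t = ξ (Fin.last n) t • tensor fun i => ξ i.castSucc := by
  refine slice_eq_of_ae _ ?_
  filter_upwards [ae_ae_snocR (tensor_ae ξ)] with t ht
  filter_upwards [ht, tensor_ae fun i => ξ i.castSucc,
    Lp.coeFn_smul (ξ (Fin.last n) t) (tensor fun i => ξ i.castSucc)] with x h1 h2 h3
  rw [h1, h3, Pi.smul_apply, h2, Fin.prod_univ_castSucc]
  simp [snocR, mul_comm]

lemma tensor_add_smul {n : ℕ} (ξ η : 𝓢(ℝ, ℝ)) (s : ℝ) :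
    (tensor fun _ : Fin n => η + s • ξ) = ∑ k ∈ Finset.range (n + 1), s ^ k •
      ∑ A ∈ Finset.powersetCard k Finset.univ, tensor fun i => if i ∈ A then ξ else η := by
  have h : (tensor fun _ : Fin n => η + s • ξ) = ∑ A ∈ (Finset.univ : Finset (Fin n)).powerset,
      s ^ A.card • tensor fun i => if i ∈ A then ξ else η := by
    refine Lp.ext ?_
    filter_upwards [tensor_ae fun _ : Fin n => η + s • ξ,
      Lp.coeFn_fun_finsetSum (Finset.univ : Finset (Fin n)).powerset
        fun A => s ^ A.card • tensor fun i => if i ∈ A then ξ else η,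
      ae_all_iff.mpr fun A : Finset (Fin n) =>
        Lp.coeFn_smul (s ^ A.card) (tensor fun i => if i ∈ A then ξ else η),
      ae_all_iff.mpr fun A : Finset (Fin n) => tensor_ae fun i => if i ∈ A then ξ else η]
      with x h1 h2 h3 h4
    rw [h1, h2]
    simp only [h3, Pi.smul_apply, h4, add_apply, smul_apply, smul_eq_mul]
    rw [Finset.prod_congr rfl fun i _ => add_comm (η (x i)) (s * ξ (x i)), Finset.prod_add]
    refine Finset.sum_congr rfl fun A _ => ?_
    rw [Finset.prod_mul_distrib, Finset.prod_const, mul_assoc]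
    congr 1
    rw [← Finset.prod_mul_prod_compl A, ← Finset.compl_eq_univ_sdiff]
    congr 1
    · exact Finset.prod_congr rfl fun i hi => by simp [hi]
    · exact Finset.prod_congr rfl fun i hi => by simp [Finset.mem_compl.mp hi]
  rw [h, Finset.sum_powerset, Finset.card_univ, Fintype.card_fin]
  refine Finset.sum_congr rfl fun k _ => ?_
  rw [Finset.smul_sum]
  exact Finset.sum_congr rfl fun A hA => by rw [(Finset.mem_powersetCard.mp hA).2]

lemma ae_eq_zero_of_forall_integral_schwartz {f : ℝ → ℝ} (hf : MemLp f 2 volume)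
    (h : ∀ ξ : 𝓢(ℝ, ℝ), ∫ t, ξ t * f t = 0) : f =ᵐ[volume] 0 := by
  have h1 : ∀ g : Lp ℝ 2 (volume : Measure ℝ), inner ℝ (hf.toLp f) g = 0 := by
    intro g
    refine (SchwartzMap.denseRange_toLpCLM (E := ℝ) (F := ℝ) (p := 2)
      (μ := (volume : Measure ℝ)) (by simp)).induction_on
      (p := fun g => inner ℝ (hf.toLp f) g = (0 : ℝ)) g ?_ ?_
    · exact isClosed_eq (continuous_const.inner continuous_id) continuous_const
    · intro ξ
      rw [L2.inner_def, ← h ξ]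
      refine integral_congr_ae ?_
      filter_upwards [hf.coeFn_toLp, ξ.coeFn_toLp 2 volume] with t k1 k2
      rw [SchwartzMap.toLpCLM_apply, k1, k2]
      simp
  have h2 : hf.toLp f = 0 := inner_self_eq_zero.mp (h1 (hf.toLp f))
  have h3 := hf.coeFn_toLp
  rw [h2] at h3
  exact h3.symm.trans (Lp.coeFn_zero _ _ _)

/-- Totality of the tensors `ξ ⊗ ⋯ ⊗ ξ`, by induction on `n`. The coefficient of `s` in `(η + s
ξ)^{⊗(n+1)}`, with the symmetry of `f`, shows that `f` is orthogonal to `η^{⊗n} ⊗ ξ`. Varying `ξ`,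
almost every slice of `f` is orthogonal to `η^{⊗n}`, and slices are symmetric. -/
lemma eq_zero_of_forall_inner_tensor {n : ℕ} {f : L2 n} (hf : IsSymm f)
    (h : ∀ ξ : 𝓢(ℝ, ℝ), inner ℝ f (tensor fun _ => ξ) = (0 : ℝ)) : f = 0 := by
  induction n with
  | zero =>
    have h1 := h 0
    rw [L2.inner_def] at h1
    have h2 : ∀ᵐ x : Fin 0 → ℝ, (inner ℝ (f x) ((tensor fun _ : Fin 0 => (0 : 𝓢(ℝ, ℝ))) x) : ℝ)
        = f default := by
      filter_upwards [tensor_ae fun _ : Fin 0 => (0 : 𝓢(ℝ, ℝ))] with x hx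
      rw [hx, Subsingleton.elim x default]
      simp
    rw [integral_congr_ae h2, integral_const] at h1
    have h3 : f default = 0 := by
      have : (volume : Measure (Fin 0 → ℝ)).real Set.univ = 1 := by
        rw [Measure.real, volume_pi, Measure.pi_of_empty]
        simp
      rw [this] at h1
      simpa using h1
    refine Lp.ext ?_
    filter_upwards [Lp.coeFn_zero ℝ 2 (volume : Measure (Fin 0 → ℝ))] with x hx
    rw [hx, Subsingleton.elim x default, h3]
    rfl
  | succ n ih =>
    have h1 : ∀ ξ η : 𝓢(ℝ, ℝ),
        inner ℝ f (tensor fun i : Fin (n + 1) => if i = Fin.last n then ξ else η) = (0 : ℝ) := by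
      intro ξ η
      have h2 := mem_of_forall_sum_pow_smul_mem (⊥ : Submodule ℝ ℝ) (n + 2)
        (fun k => inner ℝ f (∑ A ∈ Finset.powersetCard k Finset.univ,
          tensor fun i : Fin (n + 1) => if i ∈ A then ξ else η)) (fun s => ?_) (k := 1) (by omega)
      · have h3 : ∀ j : Fin (n + 1), inner ℝ f (tensor fun i => if i = j then ξ else η)
            = inner ℝ f (tensor fun i => if i = Fin.last n then ξ else η) := by
          intro j
          rw [← inner_permL_of_isSymm hf (Equiv.swap j (Fin.last n)) (tensor _), permL_tensor]
          congr 2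
          ext1 i
          simp only [Function.comp, Equiv.symm_swap, Equiv.swap_apply_eq_iff, Equiv.swap_apply_left]
        rw [Finset.powersetCard_one, Finset.sum_map, inner_sum] at h2
        simp only [Function.Embedding.coeFn_mk, Finset.mem_singleton, h3, Finset.sum_const,
          Finset.card_univ, Fintype.card_fin, Submodule.mem_bot] at h2
        have h4 : ((n + 1 : ℕ) : ℝ) ≠ 0 := by positivity
        rw [nsmul_eq_mul] at h2
        exact (mul_eq_zero.mp h2).resolve_left h4
      · have h3 := h (η + s • ξ)
        rw [tensor_add_smul, inner_sum] at h3
        simpa [inner_smul_right] using h3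
    have h2 : ∀ η : 𝓢(ℝ, ℝ), ∀ᵐ t, inner ℝ (slice f t) (tensor fun _ : Fin n => η) = (0 : ℝ) := by
      intro η
      have hm : MemLp (fun t => (inner ℝ (slice f t) (tensor fun _ : Fin n => η) : ℝ)) 2 volume :=
        (memLp_slice f).inner_const _
      refine ae_eq_zero_of_forall_integral_schwartz hm fun ξ => ?_
      rw [← h1 ξ η, ← integral_inner_slice]
      refine integral_congr_ae ?_
      filter_upwards [slice_tensor fun i : Fin (n + 1) => if i = Fin.last n then ξ else η] with t ht
      rw [ht, inner_smul_right]
      simp [Fin.castSucc_ne_last]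
    -- The null set in `h2` depends on `η`; a countable dense set of tensors provides one null set
    -- for all of them.
    obtain ⟨D, hDs, hDc, hDd⟩ := TopologicalSpace.IsSeparable.exists_countable_dense_subset
      (s := Set.range fun η : 𝓢(ℝ, ℝ) => tensor fun _ : Fin n => η)
      (TopologicalSpace.IsSeparable.of_separableSpace _)
    have h3 : ∀ᵐ t, ∀ e ∈ D, inner ℝ (slice f t) e = (0 : ℝ) := by
      rw [ae_ball_iff hDc]
      intro e he
      obtain ⟨η, rfl⟩ := hDs he
      exact h2 η
    refine eq_of_slice_eq ?_
    have h0 : ∀ᵐ t, slice (0 : L2 (n + 1)) t = 0 := by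
      simpa using slice_smul (0 : ℝ) (0 : L2 (n + 1))
    filter_upwards [h3, isSymm_slice hf, h0] with t k1 k2 k3
    rw [k3]
    refine ih k2 fun η => ?_
    have hcl : IsClosed {e : L2 n | inner ℝ (slice f t) e = (0 : ℝ)} :=
      isClosed_eq (continuous_const.inner continuous_id) continuous_const
    exact (closure_minimal (s := D) k1 hcl) (hDd ⟨η, rfl⟩)

/-! ### Kernels of polynomial random variables -/

/-- The kernel `x ↦ E[∂_{x₁} ⋯ ∂_{xₙ} p] / n!` of order `n` of a polynomial random variable. -/
def kerFun (μ : Measure Dist) : (n : ℕ) → Poly → (Fin n → ℝ) → ℝ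
  | 0, p, _ => expect μ p
  | n + 1, p, x => ((n : ℝ) + 1)⁻¹ * kerFun μ n (ptDeriv (x (Fin.last n)) p) (Fin.init x)

lemma kerFun_add (hμ : IsWhiteNoiseMeasure μ) (n : ℕ) (p q : Poly) (x : Fin n → ℝ) :
    kerFun μ n (p + q) x = kerFun μ n p x + kerFun μ n q x := by
  induction n generalizing p q with
  | zero => exact expect_add hμ p q
  | succ n ih => simp only [kerFun, map_add, ih, mul_add]

lemma kerFun_smul (n : ℕ) (a : ℝ) (p : Poly) (x : Fin n → ℝ) :
    kerFun μ n (a • p) x = a * kerFun μ n p x := by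
  induction n generalizing p with
  | zero => exact expect_smul a p
  | succ n ih => simp only [kerFun, Derivation.map_smul, ih, mul_left_comm]

lemma kerFun_zero (n : ℕ) (x : Fin n → ℝ) : kerFun μ n 0 x = 0 := by
  simpa using kerFun_smul (μ := μ) n 0 0 x

lemma kerFun_herm (hμ : IsWhiteNoiseMeasure μ) (c : 𝓢(ℝ, ℝ) →₀ ℝ) (n m : ℕ) (x : Fin n → ℝ) :
    kerFun μ n (herm c m) x = if n = m then ∏ i, tot c (x i) else 0 := by
  induction n generalizing m with
  | zero =>
    have h := expect_herm_mul_herm hμ c c 0 m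
    simp only [herm, one_mul, Nat.factorial_zero, Nat.cast_one, pow_zero] at h
    simp [kerFun, h]
  | succ n ih =>
    cases m with
    | zero => simp [kerFun, ptDeriv_herm_zero, kerFun_zero]
    | succ m =>
      rw [kerFun, ptDeriv_herm_succ, kerFun_smul, ih]
      by_cases h : n = m
      · subst h
        simp only [if_true, Fin.prod_univ_castSucc, Fin.init]
        field_simp
      · simp [h]

lemma memLp_kerFun (hμ : IsWhiteNoiseMeasure μ) (n : ℕ) (p : Poly) :
    MemLp (kerFun μ n p) 2 volume := by
  have hp : p ∈ ⨆ n, chaos n := by rw [iSup_chaos]; trivial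
  have h0 : MemLp (kerFun μ n 0) 2 volume := by
    simp only [funext (kerFun_zero n)]
    exact MemLp.zero
  have hadd : ∀ p q, MemLp (kerFun μ n p) 2 volume → MemLp (kerFun μ n q) 2 volume →
      MemLp (kerFun μ n (p + q)) 2 volume := by
    intro p q hp hq
    simp only [funext (kerFun_add hμ n p q)]
    exact hp.add hq
  induction hp using Submodule.iSup_induction' with
  | mem m x hx =>
    induction hx using Submodule.span_induction with
    | mem x hx =>
      obtain ⟨c, rfl⟩ := hx
      simp only [funext (kerFun_herm hμ c n m)]
      by_cases h : n = m
      · simpa [h] using memLp_tensor fun _ => tot c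
      · simp [h]
    | zero => exact h0
    | add x y _ _ hx hy => exact hadd x y hx hy
    | smul a x _ hx =>
      simp only [funext (kerFun_smul n a x)]
      exact hx.const_mul a
  | zero => exact h0
  | add x y _ _ hx hy => exact hadd x y hx hy

/-- The kernel of order `n` as an element of `L²(ℝⁿ)`. -/
def ker (hμ : IsWhiteNoiseMeasure μ) (n : ℕ) : Poly →ₗ[ℝ] L2 n where
  toFun p := (memLp_kerFun hμ n p).toLp _
  map_add' p q := by
    rw [← MemLp.toLp_add]
    exact MemLp.toLp_congr _ _ (ae_of_all _ (kerFun_add hμ n p q))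
  map_smul' a p := by
    rw [RingHom.id_apply, ← MemLp.toLp_const_smul]
    exact MemLp.toLp_congr _ _ (ae_of_all _ (kerFun_smul n a p))

lemma ker_ae (hμ : IsWhiteNoiseMeasure μ) (n : ℕ) (p : Poly) :
    ker hμ n p =ᵐ[volume] kerFun μ n p := (memLp_kerFun hμ n p).coeFn_toLp

lemma ker_herm (hμ : IsWhiteNoiseMeasure μ) (n : ℕ) (c : 𝓢(ℝ, ℝ) →₀ ℝ) :
    ker hμ n (herm c n) = tensor fun _ => tot c := by
  refine Lp.ext ?_
  filter_upwards [ker_ae hμ n (herm c n), tensor_ae fun _ : Fin n => tot c] with x h1 h2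
  rw [h1, h2, kerFun_herm hμ]
  simp

lemma ker_eq_zero_of_mem_chaos (hμ : IsWhiteNoiseMeasure μ) {n m : ℕ} (h : n ≠ m) {p : Poly}
    (hp : p ∈ chaos m) : ker hμ n p = 0 := by
  have h1 : chaos m ≤ LinearMap.ker (ker hμ n) := by
    refine Submodule.span_le.mpr ?_
    rintro _ ⟨c, rfl⟩
    refine Lp.ext ?_
    filter_upwards [ker_ae hμ n (herm c m), Lp.coeFn_zero ℝ 2 (volume : Measure (Fin n → ℝ))]
      with x h1 h2
    rw [h1, h2, kerFun_herm hμ]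
    simp [h]
  exact h1 hp

/-- In `kerFun` the derivative at the last variable is the first to be taken, so fixing that
variable leaves the kernel of `∂_t p`. This makes `ptDeriv t` the stochastic derivative on kernels.
-/
lemma slice_ker (hμ : IsWhiteNoiseMeasure μ) (n : ℕ) (p : Poly) :
    ∀ᵐ t, slice (ker hμ (n + 1) p) t = ((n : ℝ) + 1)⁻¹ • ker hμ n (ptDeriv t p) := by
  refine slice_eq_of_ae _ ?_
  filter_upwards [ae_ae_snocR (ker_ae hμ (n + 1) p)] with t ht
  filter_upwards [ht, ker_ae hμ n (ptDeriv t p),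
    Lp.coeFn_smul ((n : ℝ) + 1)⁻¹ (ker hμ n (ptDeriv t p))] with x h1 h2 h3
  rw [h1, h3, Pi.smul_apply, h2]
  simp [kerFun, snocR]

lemma ker_sum_chaos (hμ : IsWhiteNoiseMeasure μ) {f : ℕ → Poly} (hf : ∀ n, f n ∈ chaos n)
    (N n : ℕ) : ker hμ n (∑ m ∈ Finset.range N, f m) = if n < N then ker hμ n (f n) else 0 := by
  rw [map_sum]
  split_ifs with h
  · exact Finset.sum_eq_single n
      (fun m _ hm => ker_eq_zero_of_mem_chaos hμ (Ne.symm hm) (hf m))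
      (fun hn => absurd (Finset.mem_range.mpr h) hn)
  · refine Finset.sum_eq_zero fun m hm => ker_eq_zero_of_mem_chaos hμ ?_ (hf m)
    have := Finset.mem_range.mp hm
    omega

lemma isSymm_ker (hμ : IsWhiteNoiseMeasure μ) (n : ℕ) (p : Poly) : IsSymm (ker hμ n p) := by
  obtain ⟨N, f, hf, rfl⟩ := exists_sum_chaos p
  rw [ker_sum_chaos hμ hf]
  split_ifs with h
  · have h1 : chaos n ≤ (symmSub n).comap (ker hμ n) := by
      refine Submodule.span_le.mpr ?_
      rintro _ ⟨c, rfl⟩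
      simp only [Submodule.comap_coe, Set.mem_preimage, ker_herm]
      exact isSymm_tensor_const _
    exact h1 (hf n)
  · exact (symmSub n).zero_mem

/-- A polynomial random variable as an element of `(L²)`. -/
def ev (hμ : IsWhiteNoiseMeasure μ) : Poly →ₗ[ℝ] Lp ℝ 2 μ where
  toFun p := (memLp_rv hμ p 2 (by simp)).toLp _
  map_add' p q := by
    rw [← MemLp.toLp_add]
    exact MemLp.toLp_congr _ _ (ae_of_all _ (rv_add p q))
  map_smul' a p := by
    rw [RingHom.id_apply, ← MemLp.toLp_const_smul]
    exact MemLp.toLp_congr _ _ (ae_of_all _ (rv_smul a p))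

lemma ev_ae (hμ : IsWhiteNoiseMeasure μ) (p : Poly) : ev hμ p =ᵐ[μ] rv p :=
  (memLp_rv hμ p 2 (by simp)).coeFn_toLp

lemma inner_ev (hμ : IsWhiteNoiseMeasure μ) (p q : Poly) :
    inner ℝ (ev hμ p) (ev hμ q) = expect μ (p * q) := by
  rw [L2.inner_def, expect]
  refine integral_congr_ae ?_
  filter_upwards [ev_ae hμ p, ev_ae hμ q] with ω h1 h2
  simp [h1, h2, mul_comm]

lemma norm_ev_sq (hμ : IsWhiteNoiseMeasure μ) (p : Poly) : ‖ev hμ p‖ ^ 2 = expect μ (p ^ 2) := by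
  rw [← real_inner_self_eq_norm_sq, inner_ev, pow_two]

/-- The Wiener isometry, checked on Hermite polynomials, where both sides are `n! ⟨ξ, η⟩ⁿ` for equal
orders and zero otherwise. Nothing is required of `q`: its components of other orders contribute to
neither side. -/
lemma inner_ev_of_mem_chaos (hμ : IsWhiteNoiseMeasure μ) {n : ℕ} {p : Poly} (hp : p ∈ chaos n)
    (q : Poly) :
    inner ℝ (ev hμ p) (ev hμ q) = (n.factorial : ℝ) * inner ℝ (ker hμ n p) (ker hμ n q) := by
  have hq : q ∈ ⨆ n, chaos n := by rw [iSup_chaos]; trivial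
  induction hp using Submodule.span_induction with
  | mem x hx =>
    obtain ⟨c, rfl⟩ := hx
    induction hq using Submodule.iSup_induction' with
    | mem m x hx =>
      induction hx using Submodule.span_induction with
      | mem x hx =>
        obtain ⟨d, rfl⟩ := hx
        rw [inner_ev, expect_herm_mul_herm hμ]
        by_cases h : n = m
        · subst h
          simp [ker_herm, inner_tensor]
        · simp [h, ker_eq_zero_of_mem_chaos hμ h (herm_mem_chaos d m)]
      | zero => simp
      | add x y _ _ hx hy => rw [map_add, map_add, inner_add_right, inner_add_right, hx, hy, mul_add]
      | smul a x _ hx =>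
        rw [map_smul, map_smul, inner_smul_right, inner_smul_right, hx, mul_left_comm]
    | zero => simp
    | add x y _ _ hx hy => rw [map_add, map_add, inner_add_right, inner_add_right, hx, hy, mul_add]
  | zero => simp
  | add x y _ _ hx hy => rw [map_add, map_add, inner_add_left, inner_add_left, hx, hy, mul_add]
  | smul a x _ hx =>
    rw [map_smul, map_smul, inner_smul_left, inner_smul_left, hx, mul_left_comm]

lemma norm_ev_sq_of_mem_chaos (hμ : IsWhiteNoiseMeasure μ) {n : ℕ} {p : Poly} (hp : p ∈ chaos n) :
    ‖ev hμ p‖ ^ 2 = (n.factorial : ℝ) * ‖ker hμ n p‖ ^ 2 := by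
  rw [← real_inner_self_eq_norm_sq, ← real_inner_self_eq_norm_sq, inner_ev_of_mem_chaos hμ hp]

/-- Bessel's inequality: the left-hand side is the squared norm of the orthogonal projection of `p`
to the `n`-th chaos. -/
lemma factorial_mul_norm_ker_sq_le (hμ : IsWhiteNoiseMeasure μ) (n : ℕ) (p : Poly) :
    (n.factorial : ℝ) * ‖ker hμ n p‖ ^ 2 ≤ ‖ev hμ p‖ ^ 2 := by
  obtain ⟨N, f, hf, hp⟩ := exists_sum_chaos p
  have hk := ker_sum_chaos hμ hf N n
  rw [← hp] at hk
  rw [hk]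
  split_ifs with h
  · rw [if_pos h] at hk
    have h1 := inner_ev_of_mem_chaos hμ (hf n) p
    rw [hk, real_inner_self_eq_norm_sq, ← norm_ev_sq_of_mem_chaos hμ (hf n)] at h1
    have h2 := real_inner_le_norm (ev hμ (f n)) (ev hμ p)
    rw [h1] at h2
    rw [← norm_ev_sq_of_mem_chaos hμ (hf n)]
    have h3 : ‖ev hμ (f n)‖ ≤ ‖ev hμ p‖ := by
      rcases (norm_nonneg (ev hμ (f n))).eq_or_lt with h0 | h0
      · rw [← h0]
        positivity
      · nlinarith
    gcongr
  · simp

lemma norm_ev_mul_sq_le (hμ : IsWhiteNoiseMeasure μ) {m n : ℕ} {p q : Poly} (hp : p ∈ chaos m)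
    (hq : q ∈ chaos n) :
    ‖ev hμ (p * q)‖ ^ 2 ≤ 3 ^ m * ‖ev hμ p‖ ^ 2 * (3 ^ n * ‖ev hμ q‖ ^ 2) := by
  have h := expect_mul_le hμ (p ^ 2) (q ^ 2)
  rw [← pow_mul, ← pow_mul] at h
  rw [norm_ev_sq, norm_ev_sq, norm_ev_sq, mul_pow]
  refine h.trans (mul_le_mul (sqrt_expect_pow_four_le hμ hp) (sqrt_expect_pow_four_le hμ hq)
    (Real.sqrt_nonneg _) ?_)
  have := expect_sq_nonneg (μ := μ) p
  positivity

/-- By the Leibniz rule each derivative lowers the order of one of the two factors, so more than `m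
+ n` derivatives annihilate the product. -/
lemma kerFun_mul_eq_zero (hμ : IsWhiteNoiseMeasure μ) {m n j : ℕ} (h : m + n < j) {p q : Poly}
    (hp : p ∈ chaos m) (hq : q ∈ chaos n) (x : Fin j → ℝ) : kerFun μ j (p * q) x = 0 := by
  induction j generalizing m n p q with
  | zero => omega
  | succ j ih =>
    have h1 : ∀ t (y : Fin j → ℝ), kerFun μ j (p * ptDeriv t q) y = 0 := by
      intro t y
      cases n with
      | zero => rw [ptDeriv_eq_zero_of_mem_chaos hq, mul_zero, kerFun_zero]
      | succ n => exact ih (by omega) hp (ptDeriv_mem_chaos hq t) y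
    have h2 : ∀ t (y : Fin j → ℝ), kerFun μ j (q * ptDeriv t p) y = 0 := by
      intro t y
      rw [mul_comm]
      cases m with
      | zero => rw [ptDeriv_eq_zero_of_mem_chaos hp, zero_mul, kerFun_zero]
      | succ m => exact ih (by omega) (ptDeriv_mem_chaos hp t) hq y
    rw [kerFun, Derivation.leibniz, kerFun_add hμ, smul_eq_mul, smul_eq_mul, h1, h2]
    simp

lemma ker_mul_eq_zero (hμ : IsWhiteNoiseMeasure μ) {m n j : ℕ} (h : m + n < j) {p q : Poly}
    (hp : p ∈ chaos m) (hq : q ∈ chaos n) : ker hμ j (p * q) = 0 := by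
  refine Lp.ext ?_
  filter_upwards [ker_ae hμ j (p * q), Lp.coeFn_zero ℝ 2 (volume : Measure (Fin j → ℝ))]
    with x h1 h2
  rw [h1, h2, kerFun_mul_eq_zero hμ h hp hq]
  rfl

/-! ### The norms of the spaces `G_l` -/

/-- The `n`-th term of `‖F‖_l²`. -/
def normTerm (l : ℝ) (F : Kernels) (n : ℕ) : ℝ :=
  (n.factorial : ℝ) * Real.exp (2 * l * n) * ‖F n‖ ^ 2

lemma normTerm_nonneg (l : ℝ) (F : Kernels) (n : ℕ) : 0 ≤ normTerm l F n := by
  unfold normTerm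
  positivity

lemma normSq_eq (l : ℝ) (F : Kernels) :
    normSq l F = ∑' n, ENNReal.ofReal (normTerm l F n) := by
  refine tsum_congr fun n => ?_
  rw [normTerm, ENNReal.ofReal_mul (p := _ * _) (by positivity), ENNReal.ofReal_pow (norm_nonneg _),
    ofReal_norm]

lemma normTerm_mono {l l' : ℝ} (h : l ≤ l') (F : Kernels) (n : ℕ) :
    normTerm l F n ≤ normTerm l' F n := by
  unfold normTerm
  gcongr

lemma normSq_mono {l l' : ℝ} (h : l ≤ l') (F : Kernels) : normSq l F ≤ normSq l' F := by
  rw [normSq_eq, normSq_eq]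
  exact ENNReal.tsum_le_tsum fun n => ENNReal.ofReal_le_ofReal (normTerm_mono h F n)

lemma normSq_neg (l : ℝ) (F : Kernels) : normSq l (-F) = normSq l F := by
  simp [normSq]

lemma normSq_zero (l : ℝ) : normSq l 0 = 0 := by simp [normSq]

lemma normSq_add_le (l : ℝ) (F H : Kernels) :
    normSq l (F + H) ≤ 2 * (normSq l F + normSq l H) := by
  simp only [normSq_eq]
  rw [← ENNReal.tsum_add, ← ENNReal.tsum_mul_left]
  refine ENNReal.tsum_le_tsum fun n => ?_
  have h0 : (2 : ℝ≥0∞) * (ENNReal.ofReal (normTerm l F n) + ENNReal.ofReal (normTerm l H n))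
      = ENNReal.ofReal (2 * (normTerm l F n + normTerm l H n)) := by
    rw [ENNReal.ofReal_mul (by norm_num), ENNReal.ofReal_add (normTerm_nonneg _ _ _)
      (normTerm_nonneg _ _ _), ENNReal.ofReal_ofNat]
  rw [h0]
  refine ENNReal.ofReal_le_ofReal ?_
  unfold normTerm
  have h1 : ‖F n + H n‖ ^ 2 ≤ 2 * (‖F n‖ ^ 2 + ‖H n‖ ^ 2) := by
    have := norm_add_le (F n) (H n)
    nlinarith [norm_nonneg (F n + H n), norm_nonneg (F n), norm_nonneg (H n),
      sq_nonneg (‖F n‖ - ‖H n‖)]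
  rw [Pi.add_apply]
  have h2 : 0 ≤ (n.factorial : ℝ) * Real.exp (2 * l * n) := by positivity
  nlinarith [mul_le_mul_of_nonneg_left h1 h2]

lemma normSq_sub_le (l : ℝ) (F H : Kernels) :
    normSq l (F - H) ≤ 2 * (normSq l F + normSq l H) := by
  rw [sub_eq_add_neg, ← normSq_neg l H]
  exact normSq_add_le l F (-H)

lemma ofReal_normTerm_le (l : ℝ) (F : Kernels) (n : ℕ) :
    ENNReal.ofReal (normTerm l F n) ≤ normSq l F := by
  rw [normSq_eq]
  exact ENNReal.le_tsum n

lemma enorm_sq_le_normSq (l : ℝ) (F : Kernels) (n : ℕ) :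
    ‖F n‖ₑ ^ 2 ≤ ENNReal.ofReal (Real.exp (-(2 * l * n))) * normSq l F := by
  have h1 : ‖F n‖ₑ ^ 2 = ENNReal.ofReal (‖F n‖ ^ 2) := by
    rw [ENNReal.ofReal_pow (norm_nonneg _), ofReal_norm]
  have h2 : ‖F n‖ ^ 2 ≤ Real.exp (-(2 * l * n)) * normTerm l F n := by
    rw [normTerm, Real.exp_neg]
    have h3 : (1 : ℝ) ≤ n.factorial := by exact_mod_cast n.factorial_pos
    field_simp
    nlinarith [sq_nonneg ‖F n‖]
  rw [h1]
  refine (ENNReal.ofReal_le_ofReal h2).trans ?_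
  rw [ENNReal.ofReal_mul (by positivity)]
  gcongr
  exact ofReal_normTerm_le l F n

lemma eq_zero_of_normSq_eq_zero {l : ℝ} {F : Kernels} (h : normSq l F = 0) : F = 0 := by
  ext1 n
  have h1 := enorm_sq_le_normSq l F n
  rw [h, mul_zero] at h1
  simpa using h1

/-- Lower semicontinuity of the norms. -/
lemma normSq_le_of_tendsto {l : ℝ} {F : ℕ → Kernels} {H : Kernels} {C : ℝ≥0∞}
    (h : ∀ n, Tendsto (fun k => F k n) atTop (𝓝 (H n))) (hC : ∀ᶠ k in atTop, normSq l (F k) ≤ C) :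
    normSq l H ≤ C := by
  rw [normSq_eq]
  refine ENNReal.tsum_le_of_sum_range_le fun N => ?_
  have h1 : Tendsto (fun k => ∑ n ∈ Finset.range N, ENNReal.ofReal (normTerm l (F k) n)) atTop
      (𝓝 (∑ n ∈ Finset.range N, ENNReal.ofReal (normTerm l H n))) := by
    refine tendsto_finsetSum _ fun n _ => ENNReal.tendsto_ofReal ?_
    exact ((h n).norm.pow 2).const_mul _
  refine le_of_tendsto h1 (hC.mono fun k hk => ?_)
  refine le_trans ?_ hk
  rw [normSq_eq]
  exact ENNReal.sum_le_tsum _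

/-- The kernels of a polynomial random variable. -/
def kers (hμ : IsWhiteNoiseMeasure μ) : Poly →ₗ[ℝ] Kernels := LinearMap.pi fun n => ker hμ n

lemma kers_apply (hμ : IsWhiteNoiseMeasure μ) (p : Poly) (n : ℕ) : kers hμ p n = ker hμ n p := rfl

lemma exp_two_gt : (6 : ℝ) < Real.exp 2 := by
  have h := Real.exp_one_gt_d9
  rw [show (2 : ℝ) = 1 + 1 by norm_num, Real.exp_add]
  nlinarith

lemma sum_range_half_pow_le (N : ℕ) : ∑ m ∈ Finset.range N, ((1 : ℝ) / 2) ^ m ≤ 2 := by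
  have h := (summable_geometric_two).sum_le_tsum (Finset.range N) fun m _ => by positivity
  rwa [tsum_geometric_two] at h

/-- The hypercontractive factor `√3 ^ m` is paid for by one unit of the index: Cauchy–Schwarz
against `e^{-m} √3 ^ m`, whose squares are at most `2^{-m}` since `e² > 6`. -/
lemma sq_sum_pow_mul_norm_ev_le (hμ : IsWhiteNoiseMeasure μ) (a : ℝ) (f : ℕ → Poly)
    (N : ℕ) :
    (∑ m ∈ Finset.range N, Real.exp ((a + 1) * m) * √3 ^ m * ‖ev hμ (f m)‖) ^ 2
      ≤ 2 * ∑ m ∈ Finset.range N, Real.exp (2 * (a + 2) * m) * ‖ev hμ (f m)‖ ^ 2 := by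
  have h1 : ∀ m : ℕ, Real.exp ((a + 1) * m) * √3 ^ m * ‖ev hμ (f m)‖
      = (Real.exp (-m) * √3 ^ m) * (Real.exp ((a + 2) * m) * ‖ev hμ (f m)‖) := by
    intro m
    rw [show (a + 1) * (m : ℝ) = -m + (a + 2) * m by ring, Real.exp_add]
    ring
  simp only [h1]
  refine (Finset.sum_mul_sq_le_sq_mul_sq _ _ _).trans ?_
  have h2 : ∀ m : ℕ, (Real.exp (-m) * √3 ^ m) ^ 2 ≤ (1 / 2) ^ m := by
    intro m
    have h3 : (Real.exp (-m) * √3 ^ m) ^ 2 = (3 / Real.exp 2) ^ m := by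
      rw [mul_pow, ← pow_mul, mul_comm m 2, pow_mul, Real.sq_sqrt (by norm_num), div_pow,
        ← Real.exp_nat_mul, ← Real.exp_nat_mul, div_eq_mul_inv, ← Real.exp_neg]
      push_cast
      ring_nf
    rw [h3]
    refine pow_le_pow_left₀ (by positivity) ?_ m
    rw [div_le_div_iff₀ (by positivity) (by norm_num)]
    linarith [exp_two_gt]
  refine mul_le_mul ((Finset.sum_le_sum fun m _ => h2 m).trans (sum_range_half_pow_le N))
    (le_of_eq (Finset.sum_congr rfl fun m _ => ?_)) (by positivity) (by norm_num)
  rw [mul_pow, ← Real.exp_nat_mul]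
  push_cast
  ring_nf

/-- Only pairs with `j ≤ m + n` contribute to the kernel of order `j`, and for these the weight
`e^{(a+1)j}` is at most the product of the weights of the two factors. The right-hand side does not
depend on `j`. -/
lemma exp_mul_norm_ker_mul_le (hμ : IsWhiteNoiseMeasure μ) {a : ℝ} (ha : 0 ≤ a) {f g : ℕ → Poly}
    (hf : ∀ n, f n ∈ chaos n) (hg : ∀ n, g n ∈ chaos n) (N M j : ℕ) :
    Real.exp ((a + 1) * j) * (√(j.factorial) *
      ‖ker hμ j ((∑ m ∈ Finset.range N, f m) * ∑ n ∈ Finset.range M, g n)‖)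
      ≤ (∑ m ∈ Finset.range N, Real.exp ((a + 1) * m) * √3 ^ m * ‖ev hμ (f m)‖)
        * ∑ n ∈ Finset.range M, Real.exp ((a + 1) * n) * √3 ^ n * ‖ev hμ (g n)‖ := by
  rw [Finset.sum_mul_sum, Finset.sum_mul_sum, map_sum]
  simp only [map_sum]
  have h1 : ∀ m n, Real.exp ((a + 1) * j) * (√(j.factorial) * ‖ker hμ j (f m * g n)‖)
      ≤ Real.exp ((a + 1) * m) * √3 ^ m * ‖ev hμ (f m)‖
        * (Real.exp ((a + 1) * n) * √3 ^ n * ‖ev hμ (g n)‖) := by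
    intro m n
    rcases lt_or_ge (m + n) j with h | h
    · rw [ker_mul_eq_zero hμ h (hf m) (hg n)]
      simp only [norm_zero, mul_zero]
      positivity
    · have h2 : √(j.factorial) * ‖ker hμ j (f m * g n)‖
          ≤ √3 ^ m * ‖ev hμ (f m)‖ * (√3 ^ n * ‖ev hμ (g n)‖) := by
        refine abs_le_of_sq_le_sq' ?_ (by positivity) |>.2
        rw [mul_pow, Real.sq_sqrt (by positivity)]
        refine (factorial_mul_norm_ker_sq_le hμ j _).trans
          ((norm_ev_mul_sq_le hμ (hf m) (hg n)).trans (le_of_eq ?_))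
        have h3 : ∀ k : ℕ, (√3 ^ k) ^ 2 = (3 : ℝ) ^ k := fun k => by
          rw [← pow_mul, mul_comm, pow_mul, Real.sq_sqrt (by norm_num)]
        rw [mul_pow, mul_pow, mul_pow, h3, h3]
      have h4 : Real.exp ((a + 1) * j) ≤ Real.exp ((a + 1) * m) * Real.exp ((a + 1) * n) := by
        rw [← Real.exp_add, ← mul_add]
        refine Real.exp_le_exp.mpr (mul_le_mul_of_nonneg_left ?_ (by linarith))
        exact_mod_cast h
      calc _ ≤ Real.exp ((a + 1) * m) * Real.exp ((a + 1) * n)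
            * (√3 ^ m * ‖ev hμ (f m)‖ * (√3 ^ n * ‖ev hμ (g n)‖)) := by gcongr
        _ = _ := by ring
  calc _ ≤ Real.exp ((a + 1) * j) * (√(j.factorial) *
        ∑ m ∈ Finset.range N, ∑ n ∈ Finset.range M, ‖ker hμ j (f m * g n)‖) := by
        gcongr
        refine (norm_sum_le _ _).trans (Finset.sum_le_sum fun m _ => norm_sum_le _ _)
    _ = ∑ m ∈ Finset.range N, ∑ n ∈ Finset.range M,
        Real.exp ((a + 1) * j) * (√(j.factorial) * ‖ker hμ j (f m * g n)‖) := by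
        simp only [Finset.mul_sum]
    _ ≤ _ := Finset.sum_le_sum fun m _ => Finset.sum_le_sum fun n _ => h1 m n

lemma sum_exp_mul_norm_ev_le (hμ : IsWhiteNoiseMeasure μ) (b : ℝ) {f : ℕ → Poly}
    (hf : ∀ n, f n ∈ chaos n) (N : ℕ) :
    ENNReal.ofReal (∑ m ∈ Finset.range N, Real.exp (2 * b * m) * ‖ev hμ (f m)‖ ^ 2)
      ≤ normSq b (kers hμ (∑ m ∈ Finset.range N, f m)) := by
  rw [ENNReal.ofReal_sum_of_nonneg fun _ _ => by positivity, normSq_eq]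
  refine le_trans (le_of_eq (Finset.sum_congr rfl fun m hm => ?_)) (ENNReal.sum_le_tsum _)
  rw [normTerm, kers_apply, ker_sum_chaos hμ hf, if_pos (Finset.mem_range.mp hm),
    norm_ev_sq_of_mem_chaos hμ (hf m)]
  ring_nf

/-- Continuity of the product of polynomial random variables in the norms of `G`. -/
theorem normSq_kers_mul_le (hμ : IsWhiteNoiseMeasure μ) {a : ℝ} (ha : 0 ≤ a) (p q : Poly) :
    normSq a (kers hμ (p * q)) ≤ 8 * normSq (a + 2) (kers hμ p) * normSq (a + 2) (kers hμ q) := by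
  obtain ⟨N, f, hf, rfl⟩ := exists_sum_chaos p
  obtain ⟨M, g, hg, rfl⟩ := exists_sum_chaos q
  set P := ∑ m ∈ Finset.range N, Real.exp (2 * (a + 2) * m) * ‖ev hμ (f m)‖ ^ 2 with hP
  set Q := ∑ m ∈ Finset.range M, Real.exp (2 * (a + 2) * m) * ‖ev hμ (g m)‖ ^ 2 with hQ
  have hP0 : 0 ≤ P := Finset.sum_nonneg fun _ _ => by positivity
  have hQ0 : 0 ≤ Q := Finset.sum_nonneg fun _ _ => by positivity
  -- Of the two units of index lost, one has absorbed `√3 ^ m`; the other leaves `e^{-2j} ≤ 2^{-j}`,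
  -- summable in `j`. The constant `4` comes from the two Cauchy–Schwarz estimates, and summing
  -- `2^{-j}` doubles it.
  have h1 : ∀ j : ℕ, normTerm a (kers hμ ((∑ m ∈ Finset.range N, f m) *
      ∑ n ∈ Finset.range M, g n)) j ≤ (1 / 2) ^ j * (4 * P * Q) := by
    intro j
    have h2 := exp_mul_norm_ker_mul_le hμ ha hf hg N M j
    have h3 := pow_le_pow_left₀ (by positivity) h2 2
    rw [mul_pow, mul_pow, mul_pow, Real.sq_sqrt (by positivity)] at h3
    have h4 := sq_sum_pow_mul_norm_ev_le hμ a f N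
    have h5 := sq_sum_pow_mul_norm_ev_le hμ a g M
    have h6 := h3.trans (mul_le_mul h4 h5 (by positivity) (by positivity))
    rw [normTerm, kers_apply]
    have h7 : Real.exp ((a + 1) * j) ^ 2 = Real.exp 2 ^ j * Real.exp (2 * a * j) := by
      rw [← Real.exp_nat_mul, ← Real.exp_nat_mul, ← Real.exp_add]
      push_cast
      ring_nf
    rw [h7] at h6
    have h8 : (2 : ℝ) ^ j ≤ Real.exp 2 ^ j :=
      pow_le_pow_left₀ (by norm_num) (by linarith [exp_two_gt]) j
    rw [one_div, inv_pow, inv_mul_eq_div, le_div_iff₀ (by positivity)]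
    set x := (j.factorial : ℝ) * ‖ker hμ j ((∑ m ∈ Finset.range N, f m) *
      ∑ n ∈ Finset.range M, g n)‖ ^ 2 with hx
    have hx0 : 0 ≤ x := by positivity
    calc _ = 2 ^ j * (Real.exp (2 * a * j) * x) := by rw [hx]; ring
      _ ≤ Real.exp 2 ^ j * (Real.exp (2 * a * j) * x) := by gcongr
      _ ≤ 2 * P * (2 * Q) := by rw [← mul_assoc]; exact h6
      _ = _ := by ring
  rw [normSq_eq]
  calc _ ≤ ∑' j : ℕ, ENNReal.ofReal ((1 / 2) ^ j * (4 * P * Q)) :=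
        ENNReal.tsum_le_tsum fun j => ENNReal.ofReal_le_ofReal (h1 j)
    _ = ENNReal.ofReal (2 * (4 * P * Q)) := by
        rw [← ENNReal.ofReal_tsum_of_nonneg (fun j => by positivity)
          (summable_geometric_two.mul_right _), tsum_mul_right, tsum_geometric_two]
    _ = 8 * ENNReal.ofReal P * ENNReal.ofReal Q := by
        rw [show 2 * (4 * P * Q) = 8 * P * Q by ring, ENNReal.ofReal_mul (by positivity),
          ENNReal.ofReal_mul (by norm_num)]
        simp
    _ ≤ _ := by
        gcongr
        · exact sum_exp_mul_norm_ev_le hμ (a + 2) hf N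
        · exact sum_exp_mul_norm_ev_le hμ (a + 2) hg M

/-! ### The Wiener integral -/

/-- The generators on both sides agree: the kernel and the random variable of `herm c n` depend on
`c` only through `tot c`, and every `ξ` is `tot (single ξ 1)`. -/
lemma wienerGraph_eq (hμ : IsWhiteNoiseMeasure μ) (n : ℕ) :
    wienerGraph μ n
      = ((chaos n).map ((ker hμ n).prod (ev hμ))).topologicalClosure := by
  rw [Submodule.topologicalClosure_coe, wienerGraph, chaos, Submodule.map_span]
  congr 3
  ext p
  constructor
  · rintro ⟨ξ, h1, h2⟩
    refine ⟨herm (Finsupp.single ξ 1) n, ⟨_, rfl⟩, Prod.ext ?_ ?_⟩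
    · rw [LinearMap.prod_apply, Function.prod_apply, ker_herm, tot_single, one_smul]
      exact Lp.ext ((tensor_ae _).trans h1.symm)
    · rw [LinearMap.prod_apply]
      refine Lp.ext ?_
      filter_upwards [ev_ae hμ (herm (Finsupp.single ξ 1) n), h2] with ω k1 k2
      rw [k2]
      refine k1.trans ?_
      rw [rv_herm, tot_single, one_smul]
  · rintro ⟨_, ⟨c, rfl⟩, rfl⟩
    refine ⟨tot c, ?_, ?_⟩
    · rw [LinearMap.prod_apply, Function.prod_apply, ker_herm]
      exact tensor_ae _
    · rw [LinearMap.prod_apply]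
      exact (ev_ae hμ (herm c n)).trans (ae_of_all _ (rv_herm c n))

lemma mk_mem_wienerGraph (hμ : IsWhiteNoiseMeasure μ) {n : ℕ} {p : Poly} (hp : p ∈ chaos n) :
    (ker hμ n p, ev hμ p) ∈ wienerGraph μ n := by
  rw [wienerGraph_eq hμ]
  exact Submodule.le_topologicalClosure _ ⟨p, hp, rfl⟩

/-- A closed relation between chaos elements of order `n` and `m` holds if it does for
polynomials. -/
lemma wienerGraph_induction₂ (hμ : IsWhiteNoiseMeasure μ) {n m : ℕ}
    {P : (L2 n × Lp ℝ 2 μ) → (L2 m × Lp ℝ 2 μ) → Prop} (hP : IsClosed {x : _ × _ | P x.1 x.2})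
    (h : ∀ p ∈ chaos n, ∀ q ∈ chaos m, P (ker hμ n p, ev hμ p) (ker hμ m q, ev hμ q))
    {x : L2 n × Lp ℝ 2 μ} {y : L2 m × Lp ℝ 2 μ} (hx : x ∈ wienerGraph μ n)
    (hy : y ∈ wienerGraph μ m) : P x y := by
  rw [wienerGraph_eq hμ, Submodule.topologicalClosure_coe] at hx hy
  have hxy : (x, y) ∈ closure ((((chaos n).map ((ker hμ n).prod (ev hμ)) : Submodule ℝ _) : Set _)
      ×ˢ (((chaos m).map ((ker hμ m).prod (ev hμ)) : Submodule ℝ _) : Set _)) := by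
    rw [closure_prod_eq]
    exact ⟨hx, hy⟩
  refine closure_minimal ?_ hP hxy
  rintro ⟨_, _⟩ ⟨⟨p, hp, rfl⟩, ⟨q, hq, rfl⟩⟩
  exact h p hp q hq

lemma inner_of_mem_wienerGraph (hμ : IsWhiteNoiseMeasure μ) {n : ℕ} {f g : L2 n} {Y Z : Lp ℝ 2 μ}
    (hf : (f, Y) ∈ wienerGraph μ n) (hg : (g, Z) ∈ wienerGraph μ n) :
    inner ℝ Y Z = (n.factorial : ℝ) * inner ℝ f g :=
  wienerGraph_induction₂ hμ
    (P := fun x y => inner ℝ x.2 y.2 = (n.factorial : ℝ) * inner ℝ x.1 y.1)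
    (isClosed_eq (by fun_prop) (by fun_prop))
    (fun _ hp q _ => inner_ev_of_mem_chaos hμ hp q) hf hg

lemma inner_eq_zero_of_mem_wienerGraph (hμ : IsWhiteNoiseMeasure μ) {n m : ℕ} (hnm : n ≠ m)
    {f : L2 n} {g : L2 m} {Y Z : Lp ℝ 2 μ} (hf : (f, Y) ∈ wienerGraph μ n)
    (hg : (g, Z) ∈ wienerGraph μ m) : inner ℝ Y Z = (0 : ℝ) :=
  wienerGraph_induction₂ hμ (P := fun x y => inner ℝ x.2 y.2 = (0 : ℝ))
    (isClosed_eq (by fun_prop) (by fun_prop))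
    (fun _ hp q hq => by
      rw [inner_ev_of_mem_chaos hμ hp q, ker_eq_zero_of_mem_chaos hμ hnm hq]
      simp) hf hg

/-- The difference between `f` and its projection to the closure is symmetric and orthogonal to
every `ξ ⊗ ⋯ ⊗ ξ`, hence zero. -/
lemma mem_closure_map_ker (hμ : IsWhiteNoiseMeasure μ) {n : ℕ} {f : L2 n} (hf : IsSymm f) :
    f ∈ closure ((chaos n).map (ker hμ n) : Set (L2 n)) := by
  set M := ((chaos n).map (ker hμ n)).topologicalClosure with hM
  have hMs : M ≤ symmSub n := by
    refine Submodule.topologicalClosure_minimal _ ?_ (isClosed_symmSub n)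
    rintro _ ⟨p, _, rfl⟩
    exact isSymm_ker hμ n p
  have : CompleteSpace M := (Submodule.isClosed_topologicalClosure _).completeSpace_coe
  have h1 : f - M.starProjection f = 0 := by
    refine eq_zero_of_forall_inner_tensor
      ((symmSub n).sub_mem hf (hMs (M.starProjection_apply_mem f))) fun ξ => ?_
    have h2 : (tensor fun _ : Fin n => ξ) ∈ M := by
      refine Submodule.le_topologicalClosure _
        ⟨herm (Finsupp.single ξ 1) n, herm_mem_chaos _ n, ?_⟩
      rw [ker_herm, tot_single, one_smul]
    exact Submodule.starProjection_inner_eq_zero f _ h2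
  have h3 : f = M.starProjection f := sub_eq_zero.mp h1
  rw [← Submodule.topologicalClosure_coe, ← hM, h3]
  exact M.starProjection_apply_mem f

/-- On polynomials of order `n` the Wiener integral multiplies distances by `√n!`, so it maps
sequences converging in kernel to Cauchy sequences in `(L²)`. -/
lemma exists_mem_wienerGraph (hμ : IsWhiteNoiseMeasure μ) {n : ℕ} {f : L2 n} (hf : IsSymm f) :
    ∃ Y, (f, Y) ∈ wienerGraph μ n := by
  obtain ⟨u, hu, hlim⟩ := mem_closure_iff_seq_limit.mp (mem_closure_map_ker hμ hf)
  choose p hp hpu using hu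
  have hdist : ∀ k l, dist (ev hμ (p k)) (ev hμ (p l)) = √(n.factorial) * dist (u k) (u l) := by
    intro k l
    rw [dist_eq_norm, dist_eq_norm, ← hpu, ← hpu, ← map_sub, ← map_sub]
    have h := norm_ev_sq_of_mem_chaos hμ ((chaos n).sub_mem (hp k) (hp l))
    rw [← Real.sqrt_sq (norm_nonneg (ev hμ _)), h, Real.sqrt_mul (by positivity),
      Real.sqrt_sq (norm_nonneg _)]
  have hc : CauchySeq fun k => ev hμ (p k) := by
    rw [cauchySeq_iff_tendsto_dist_atTop_0]
    simp only [hdist]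
    simpa using (cauchySeq_iff_tendsto_dist_atTop_0.mp hlim.cauchySeq).const_mul (√(n.factorial))
  obtain ⟨Y, hY⟩ := cauchySeq_tendsto_of_complete hc
  refine ⟨Y, ?_⟩
  have hcl : IsClosed (wienerGraph μ n) := isClosed_closure
  refine hcl.mem_of_tendsto (hlim.prodMk_nhds hY) (Eventually.of_forall fun k => ?_)
  rw [← hpu]
  exact mk_mem_wienerGraph hμ (hp k)

lemma sub_mem_wienerGraph (hμ : IsWhiteNoiseMeasure μ) {n : ℕ} {x y : L2 n × Lp ℝ 2 μ}
    (hx : x ∈ wienerGraph μ n) (hy : y ∈ wienerGraph μ n) : x - y ∈ wienerGraph μ n := by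
  rw [wienerGraph_eq hμ] at *
  exact Submodule.sub_mem _ hx hy

/-! ### Chaos expansions -/

lemma HasChaos.sub (hμ : IsWhiteNoiseMeasure μ) {F H : Kernels} {X Y : Lp ℝ 2 μ}
    (hF : HasChaos μ F X) (hH : HasChaos μ H Y) : HasChaos μ (F - H) (X - Y) := by
  obtain ⟨x, hx, hX⟩ := hF
  obtain ⟨y, hy, hY⟩ := hH
  exact ⟨fun n => x n - y n, fun n => sub_mem_wienerGraph hμ (hx n) (hy n), hX.sub hY⟩

/-- Parseval: the components are orthogonal with squared norms `n! |F n|²`. Applied to differences,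
it shows that kernels and random variable determine each other. -/
lemma HasChaos.enorm_sq (hμ : IsWhiteNoiseMeasure μ) {F : Kernels} {X : Lp ℝ 2 μ}
    (hF : HasChaos μ F X) : ‖X‖ₑ ^ 2 = normSq 0 F := by
  obtain ⟨Y, hY, hX⟩ := hF
  have h1 : ∀ n, inner ℝ (Y n) X = normTerm 0 F n := by
    intro n
    have h2 := hX.mapL (innerSL ℝ (Y n))
    have h3 := hasSum_single (f := fun m => innerSL ℝ (Y n) (Y m)) n fun m hm =>
      inner_eq_zero_of_mem_wienerGraph hμ (Ne.symm hm) (hY n) (hY m)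
    have h4 := h2.unique h3
    simp only [innerSL_apply_apply] at h4
    rw [h4, inner_of_mem_wienerGraph hμ (hY n) (hY n), real_inner_self_eq_norm_sq, normTerm]
    simp
  have h5 := hX.mapL (innerSL ℝ X)
  have h6 : HasSum (normTerm 0 F) (‖X‖ ^ 2) := by
    rw [← real_inner_self_eq_norm_sq]
    have h7 : normTerm 0 F = fun n => innerSL ℝ X (Y n) := by
      ext1 n
      rw [← h1, real_inner_comm, innerSL_apply_apply]
    rw [h7]
    exact h5
  rw [normSq_eq, ← ENNReal.ofReal_tsum_of_nonneg (normTerm_nonneg 0 F) h6.summable, h6.tsum_eq,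
    ENNReal.ofReal_pow (norm_nonneg _), ofReal_norm]

lemma HasChaos.unique (hμ : IsWhiteNoiseMeasure μ) {F : Kernels} {X Y : Lp ℝ 2 μ}
    (hX : HasChaos μ F X) (hY : HasChaos μ F Y) : X = Y := by
  have h := (hX.sub hμ hY).enorm_sq hμ
  rw [sub_self, normSq_zero] at h
  simpa [sub_eq_zero] using h

lemma HasChaos.unique_kernels (hμ : IsWhiteNoiseMeasure μ) {F H : Kernels} {X : Lp ℝ 2 μ}
    (hF : HasChaos μ F X) (hH : HasChaos μ H X) : F = H := by
  have h := (hF.sub hμ hH).enorm_sq hμ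
  rw [sub_self, enorm_zero, zero_pow two_ne_zero] at h
  exact sub_eq_zero.mp (eq_zero_of_normSq_eq_zero h.symm)

lemma exists_hasChaos (hμ : IsWhiteNoiseMeasure μ) {F : Kernels} (hF : ∀ n, IsSymm (F n))
    (h : normSq 0 F ≠ ∞) : ∃ X, HasChaos μ F X := by
  choose Y hY using fun n => exists_mem_wienerGraph hμ (hF n)
  -- The summability criterion for orthogonal series concerns families of subspaces; here they are
  -- the lines spanned by the `Y n`.
  have hV : OrthogonalFamily ℝ (fun n => (ℝ ∙ Y n : Submodule ℝ (Lp ℝ 2 μ)))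
      fun n => (ℝ ∙ Y n : Submodule ℝ (Lp ℝ 2 μ)).subtypeₗᵢ := by
    refine OrthogonalFamily.of_pairwise fun n m hnm => ?_
    refine Submodule.isOrtho_span.mpr ?_
    rintro _ rfl _ rfl
    exact inner_eq_zero_of_mem_wienerGraph hμ hnm (hY n) (hY m)
  have h1 := hV.summable_iff_norm_sq_summable
    fun n => (⟨Y n, Submodule.mem_span_singleton_self _⟩ : (ℝ ∙ Y n : Submodule ℝ (Lp ℝ 2 μ)))
  have h2 : Summable Y := by
    refine h1.mpr ?_
    have h3 : ∀ n, ‖Y n‖ ^ 2 = normTerm 0 F n := by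
      intro n
      rw [← real_inner_self_eq_norm_sq, inner_of_mem_wienerGraph hμ (hY n) (hY n),
        real_inner_self_eq_norm_sq, normTerm]
      simp
    simp only [Submodule.coe_norm, h3]
    rw [normSq_eq] at h
    have h4 := ENNReal.summable_toReal h
    simpa only [ENNReal.toReal_ofReal (normTerm_nonneg 0 F _)] using h4
  exact ⟨∑' n, Y n, Y, hY, h2.hasSum⟩

lemma hasChaos_kers (hμ : IsWhiteNoiseMeasure μ) (p : Poly) : HasChaos μ (kers hμ p) (ev hμ p) := by
  obtain ⟨N, f, hf, rfl⟩ := exists_sum_chaos p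
  refine ⟨fun n => ev hμ (if n < N then f n else 0), fun n => ?_, ?_⟩
  · rw [kers_apply, ker_sum_chaos hμ hf, ← map_zero (ker hμ n), ← apply_ite]
    refine mk_mem_wienerGraph hμ ?_
    split_ifs
    · exact hf n
    · exact Submodule.zero_mem _
  · rw [map_sum]
    have h : ∑ n ∈ Finset.range N, ev hμ (f n)
        = ∑ n ∈ Finset.range N, ev hμ (if n < N then f n else 0) :=
      Finset.sum_congr rfl fun n hn => by rw [if_pos (Finset.mem_range.mp hn)]
    rw [h]
    exact hasSum_sum_of_ne_finset_zero fun n hn => by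
      rw [if_neg (fun h => hn (Finset.mem_range.mpr h)), map_zero]

/-! ### The spaces `G_l` and `G` -/

lemma mem_G_iff {F : Kernels} :
    F ∈ G ↔ (∀ n, IsSymm (F n)) ∧ ∀ l : ℝ, normSq l F < ∞ := by
  refine ⟨fun h => ⟨(h 1 one_pos).1, fun l => ?_⟩, fun h l _ => ⟨h.1, h.2 l⟩⟩
  exact (normSq_mono (le_max_left l 1) F).trans_lt (h _ (lt_max_of_lt_right one_pos)).2

lemma sub_mem_G {F H : Kernels} (hF : F ∈ G) (hH : H ∈ G) : F - H ∈ G := by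
  rw [mem_G_iff] at *
  refine ⟨fun n => (symmSub n).sub_mem (hF.1 n) (hH.1 n), fun l => ?_⟩
  exact (normSq_sub_le l F H).trans_lt
    (ENNReal.mul_lt_top (by simp) (ENNReal.add_lt_top.mpr ⟨hF.2 l, hH.2 l⟩))

lemma zero_mem_G : (0 : Kernels) ∈ G := by
  rw [mem_G_iff]
  exact ⟨fun n => (symmSub n).zero_mem, fun l => by simp [normSq_zero]⟩

lemma add_mem_G {F H : Kernels} (hF : F ∈ G) (hH : H ∈ G) : F + H ∈ G := by
  have := sub_mem_G hF (sub_mem_G zero_mem_G hH)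
  simpa using this

lemma normSq_lt_top_of_forall_ge {l : ℝ} {F : Kernels} {N : ℕ} (h : ∀ n, N ≤ n → F n = 0) :
    normSq l F < ∞ := by
  rw [normSq_eq, tsum_eq_sum (s := Finset.range N) fun n hn => ?_]
  · exact ENNReal.sum_lt_top.mpr fun n _ => ENNReal.ofReal_lt_top
  · rw [normTerm, h n (by simpa using hn)]
    simp

lemma kers_mem_G (hμ : IsWhiteNoiseMeasure μ) (p : Poly) : kers hμ p ∈ G := by
  rw [mem_G_iff]
  refine ⟨fun n => isSymm_ker hμ n p, fun l => ?_⟩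
  obtain ⟨N, f, hf, rfl⟩ := exists_sum_chaos p
  refine normSq_lt_top_of_forall_ge (N := N) fun n hn => ?_
  rw [kers_apply, ker_sum_chaos hμ hf, if_neg (by omega)]

lemma exists_mem_chaos_norm_sq_le (hμ : IsWhiteNoiseMeasure μ) {n : ℕ} {f : L2 n}
    (hf : IsSymm f) {C δ : ℝ} (hC : 0 < C) (hδ : 0 < δ) :
    ∃ p ∈ chaos n, C * ‖ker hμ n p - f‖ ^ 2 ≤ δ := by
  have hε : 0 < √(δ / C) := by positivity
  obtain ⟨_, ⟨p, hp, rfl⟩, hd⟩ := Metric.mem_closure_iff.mp (mem_closure_map_ker hμ hf) _ hε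
  refine ⟨p, hp, ?_⟩
  rw [dist_comm, dist_eq_norm] at hd
  have h2 := pow_le_pow_left₀ (norm_nonneg _) hd.le 2
  rw [Real.sq_sqrt (by positivity), le_div_iff₀ hC] at h2
  linarith

lemma normSq_le_of_head_of_tail {b ε : ℝ} (hε : 0 < ε) {H : Kernels} {N : ℕ}
    (h1 : ∀ n < N, normTerm b H n ≤ (1 / 2) ^ n * (ε / 4))
    (h2 : ∑' n, ENNReal.ofReal (normTerm b H (n + N)) ≤ ENNReal.ofReal (ε / 2)) :
    normSq b H ≤ ENNReal.ofReal ε := by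
  rw [normSq_eq, ← Summable.sum_add_tsum_nat_add' (k := N) ENNReal.summable]
  have h3 : ∑ n ∈ Finset.range N, ENNReal.ofReal (normTerm b H n) ≤ ENNReal.ofReal (ε / 2) := by
    rw [← ENNReal.ofReal_sum_of_nonneg fun _ _ => normTerm_nonneg _ _ _]
    refine ENNReal.ofReal_le_ofReal ?_
    calc _ ≤ ∑ n ∈ Finset.range N, (1 / 2 : ℝ) ^ n * (ε / 4) :=
          Finset.sum_le_sum fun n hn => h1 n (Finset.mem_range.mp hn)
      _ ≤ 2 * (ε / 4) := by
          rw [← Finset.sum_mul]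
          gcongr
          exact sum_range_half_pow_le N
      _ = ε / 2 := by ring
  calc _ ≤ ENNReal.ofReal (ε / 2) + ENNReal.ofReal (ε / 2) := add_le_add h3 h2
    _ = ENNReal.ofReal ε := by
        rw [← ENNReal.ofReal_add (by positivity) (by positivity), add_halves]

/-- Polynomial random variables are dense in `G`. -/
lemma exists_normSq_kers_sub_le (hμ : IsWhiteNoiseMeasure μ) {F : Kernels} (hF : F ∈ G) (b : ℝ)
    {ε : ℝ} (hε : 0 < ε) : ∃ p, normSq b (kers hμ p - F) ≤ ENNReal.ofReal ε := by
  rw [mem_G_iff] at hF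
  have hfin : ∑' n, ENNReal.ofReal (normTerm b F n) ≠ ∞ := by
    rw [← normSq_eq]
    exact (hF.2 b).ne
  have htail := ENNReal.tendsto_sum_nat_add (fun n => ENNReal.ofReal (normTerm b F n)) hfin
  have hpos : (0 : ℝ≥0∞) < ENNReal.ofReal (ε / 2) := ENNReal.ofReal_pos.mpr (half_pos hε)
  -- The kernels from order `N` on are dropped at cost `ε / 2`; those below are approximated within
  -- `2^{-n} ε / 4`, which again sums to at most `ε / 2`.
  obtain ⟨N, hN⟩ := (htail.eventually (ge_mem_nhds hpos)).exists
  choose f hf hfe using fun n : ℕ => exists_mem_chaos_norm_sq_le hμ (hF.1 n)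
    (show 0 < (n.factorial : ℝ) * Real.exp (2 * b * n) by positivity)
    (show 0 < (1 / 2 : ℝ) ^ n * (ε / 4) by positivity)
  have hHn : ∀ n, (kers hμ (∑ n ∈ Finset.range N, f n) - F) n
      = (if n < N then ker hμ n (f n) else 0) - F n := fun n => by
    rw [Pi.sub_apply, kers_apply, ker_sum_chaos hμ hf]
  refine ⟨∑ n ∈ Finset.range N, f n, normSq_le_of_head_of_tail hε (N := N) (fun n hn => ?_) ?_⟩
  · rw [normTerm, hHn, if_pos hn]
    exact hfe n
  · refine le_trans (ENNReal.tsum_le_tsum fun n => ENNReal.ofReal_le_ofReal ?_) hN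
    rw [normTerm, hHn, if_neg (Nat.not_lt.mpr (Nat.le_add_left N n)), zero_sub, norm_neg, normTerm]

/-- Letting index and precision vary together gives one sequence converging in all norms of `G`. The
geometric rate makes the errors summable, which convergence of derivatives at almost every `t`
relies on. -/
lemma exists_approx (hμ : IsWhiteNoiseMeasure μ) {F : Kernels} (hF : F ∈ G) :
    ∃ p : ℕ → Poly, ∀ k : ℕ, normSq k (kers hμ (p k) - F) ≤ ENNReal.ofReal ((1 / 2) ^ k) := by
  choose p hp using fun k : ℕ => exists_normSq_kers_sub_le hμ hF k
    (show (0 : ℝ) < (1 / 2) ^ k by positivity)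
  exact ⟨p, hp⟩

/-! ### Convergence in the norms of `G` -/

/-- Convergence in the norm of `G_b`. -/
def Conv (b : ℝ) (F : ℕ → Kernels) (H : Kernels) : Prop :=
  Tendsto (fun k => normSq b (F k - H)) atTop (𝓝 0)

lemma Conv.of_le {b : ℝ} {F : ℕ → Kernels} {H : Kernels} {c : ℕ → ℝ≥0∞}
    (hc : Tendsto c atTop (𝓝 0)) (h : ∀ᶠ k in atTop, normSq b (F k - H) ≤ c k) : Conv b F H :=
  tendsto_of_tendsto_of_tendsto_of_le_of_le' tendsto_const_nhds hc
    (Eventually.of_forall fun _ => zero_le) h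

lemma Conv.mono {b b' : ℝ} (h : b ≤ b') {F : ℕ → Kernels} {H : Kernels} (hF : Conv b' F H) :
    Conv b F H :=
  Conv.of_le hF (Eventually.of_forall fun k => normSq_mono h (F k - H))

lemma Conv.add {b : ℝ} {F F' : ℕ → Kernels} {H H' : Kernels} (hF : Conv b F H)
    (hF' : Conv b F' H') : Conv b (fun k => F k + F' k) (H + H') := by
  have h : Tendsto (fun k => 2 * (normSq b (F k - H) + normSq b (F' k - H'))) atTop (𝓝 0) := by
    simpa using ENNReal.Tendsto.const_mul (a := 2) (Tendsto.add hF hF') (Or.inr (by simp))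
  refine Conv.of_le h (Eventually.of_forall fun k => ?_)
  rw [add_sub_add_comm]
  exact normSq_add_le b _ _

lemma Conv.unique {b : ℝ} {F : ℕ → Kernels} {H H' : Kernels} (h : Conv b F H)
    (h' : Conv b F H') : H = H' := by
  have h1 : Tendsto (fun k => 2 * (normSq b (F k - H') + normSq b (F k - H))) atTop (𝓝 0) := by
    simpa using ENNReal.Tendsto.const_mul (a := 2) (Tendsto.add h' h) (Or.inr (by simp))
  have h2 : normSq b (H - H') ≤ 0 := by
    refine ge_of_tendsto h1 (Eventually.of_forall fun k => ?_)
    rw [show H - H' = (F k - H') - (F k - H) by abel]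
    exact normSq_sub_le b _ _
  exact sub_eq_zero.mp (eq_zero_of_normSq_eq_zero (nonpos_iff_eq_zero.mp h2))

lemma Conv.eventually_normSq_le {b : ℝ} {F : ℕ → Kernels} {H : Kernels} (h : Conv b F H) :
    ∀ᶠ k in atTop, normSq b (F k) ≤ 2 * (1 + normSq b H) := by
  filter_upwards [h.eventually (ge_mem_nhds one_pos)] with k hk
  have h1 := normSq_add_le b (F k - H) H
  rw [sub_add_cancel] at h1
  refine h1.trans ?_
  gcongr

lemma conv_kers_approx (hμ : IsWhiteNoiseMeasure μ) {F : Kernels} {p : ℕ → Poly}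
    (hp : ∀ k : ℕ, normSq k (kers hμ (p k) - F) ≤ ENNReal.ofReal ((1 / 2) ^ k)) (b : ℝ) :
    Conv b (fun k => kers hμ (p k)) F := by
  refine Conv.of_le (c := fun k => ENNReal.ofReal ((1 / 2) ^ k)) ?_ ?_
  · have := ENNReal.tendsto_ofReal
      (tendsto_pow_atTop_nhds_zero_of_lt_one (r := (1 : ℝ) / 2) (by norm_num) (by norm_num))
    simpa using this
  · filter_upwards [eventually_ge_atTop ⌈b⌉₊] with k hk
    exact (normSq_mono (Nat.ceil_le.mp hk) _).trans (hp k)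

lemma HasChaos.tendsto (hμ : IsWhiteNoiseMeasure μ) {F : ℕ → Kernels} {H : Kernels}
    {X : ℕ → Lp ℝ 2 μ} {Z : Lp ℝ 2 μ} (hF : ∀ k, HasChaos μ (F k) (X k)) (hH : HasChaos μ H Z)
    (h : Conv 0 F H) : Tendsto X atTop (𝓝 Z) := by
  rw [tendsto_iff_edist_tendsto_0]
  have h1 : ∀ k, edist (X k) Z = normSq 0 (F k - H) ^ (1 / 2 : ℝ) := by
    intro k
    rw [← ((hF k).sub hμ hH).enorm_sq hμ, edist_eq_enorm_sub, ← ENNReal.rpow_natCast,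
      ← ENNReal.rpow_mul]
    norm_num
  simp only [h1]
  have h2 := h.ennrpow_const (1 / 2)
  simpa using h2

lemma exists_subseq_tendsto_ae {X : ℕ → Lp ℝ 2 μ} {Z : Lp ℝ 2 μ} (h : Tendsto X atTop (𝓝 Z)) :
    ∃ ns : ℕ → ℕ, StrictMono ns ∧ ∀ᵐ ω ∂μ, Tendsto (fun k => X (ns k) ω) atTop (𝓝 (Z ω)) :=
  (tendstoInMeasure_of_tendsto_Lp h).exists_seq_tendsto_ae

lemma normSq_kers_mul_sub_le (hμ : IsWhiteNoiseMeasure μ) {a : ℝ} (ha : 0 ≤ a) (p p' q q' : Poly) :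
    normSq a (kers hμ (p * q) - kers hμ (p' * q'))
      ≤ 16 * (normSq (a + 2) (kers hμ p - kers hμ p') * normSq (a + 2) (kers hμ q)
        + normSq (a + 2) (kers hμ p') * normSq (a + 2) (kers hμ q - kers hμ q')) := by
  have h1 : kers hμ (p * q) - kers hμ (p' * q')
      = kers hμ ((p - p') * q) + kers hμ (p' * (q - q')) := by
    rw [← map_sub, ← map_add]
    congr 1
    ring
  rw [h1, ← map_sub, ← map_sub]
  refine (normSq_add_le a _ _).trans ?_
  refine (mul_le_mul_right (add_le_add (normSq_kers_mul_le hμ ha (p - p') q)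
    (normSq_kers_mul_le hμ ha p' (q - q'))) 2).trans (le_of_eq ?_)
  ring

lemma tendsto_normSq_kers_mul_sub (hμ : IsWhiteNoiseMeasure μ) {ψ φ : Kernels} (hψ : ψ ∈ G)
    (hφ : φ ∈ G) {p q : ℕ → Poly} (hp : ∀ b, Conv b (fun k => kers hμ (p k)) ψ)
    (hq : ∀ b, Conv b (fun k => kers hμ (q k)) φ) {a : ℝ} (ha : 0 ≤ a) :
    Tendsto (fun x : ℕ × ℕ => normSq a (kers hμ (p x.1 * q x.1) - kers hμ (p x.2 * q x.2)))
      (atTop ×ˢ atTop) (𝓝 0) := by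
  rw [mem_G_iff] at hψ hφ
  have hdiff : ∀ {F : ℕ → Kernels} {H : Kernels}, Conv (a + 2) F H →
      Tendsto (fun x : ℕ × ℕ => normSq (a + 2) (F x.1 - F x.2)) (atTop ×ˢ atTop) (𝓝 0) := by
    intro F H hF
    have h1 : Tendsto (fun x : ℕ × ℕ => 2 * (normSq (a + 2) (F x.1 - H)
        + normSq (a + 2) (F x.2 - H))) (atTop ×ˢ atTop) (𝓝 0) := by
      simpa using ENNReal.Tendsto.const_mul
        ((hF.comp tendsto_fst).add (hF.comp (tendsto_snd (f := atTop)))) (Or.inr (by simp))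
    refine tendsto_of_tendsto_of_tendsto_of_le_of_le tendsto_const_nhds h1
      (fun _ => zero_le) fun x => ?_
    have := normSq_sub_le (a + 2) (F x.1 - H) (F x.2 - H)
    rwa [sub_sub_sub_cancel_right] at this
  have h1 := hdiff (hp (a + 2))
  have h2 := hdiff (hq (a + 2))
  have hA : 2 * (1 + normSq (a + 2) ψ) ≠ ∞ :=
    ENNReal.mul_ne_top (by simp) (ENNReal.add_ne_top.mpr ⟨by simp, (hψ.2 _).ne⟩)
  have hB : 2 * (1 + normSq (a + 2) φ) ≠ ∞ :=
    ENNReal.mul_ne_top (by simp) (ENNReal.add_ne_top.mpr ⟨by simp, (hφ.2 _).ne⟩)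
  have h3 := ENNReal.Tendsto.const_mul (a := 16)
    ((ENNReal.Tendsto.mul_const h1 (Or.inr hB)).add (ENNReal.Tendsto.const_mul h2 (Or.inr hA)))
    (Or.inr (by simp))
  simp only [zero_mul, mul_zero, add_zero] at h3
  refine tendsto_of_tendsto_of_tendsto_of_le_of_le' tendsto_const_nhds h3
    (Eventually.of_forall fun _ => zero_le) ?_
  filter_upwards [tendsto_fst.eventually (hq (a + 2)).eventually_normSq_le,
    tendsto_snd.eventually (hp (a + 2)).eventually_normSq_le] with x hx1 hx2
  refine (normSq_kers_mul_sub_le hμ ha _ _ _ _).trans ?_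
  gcongr

lemma cauchySeq_of_tendsto_enorm_sq {E : Type*} [NormedAddCommGroup E] {u : ℕ → E}
    (h : Tendsto (fun x : ℕ × ℕ => ‖u x.1 - u x.2‖ₑ ^ 2) (atTop ×ˢ atTop) (𝓝 0)) :
    CauchySeq u := by
  rw [cauchySeq_iff_tendsto_dist_atTop_0, ← prod_atTop_atTop_eq]
  have h1 := h.ennrpow_const (1 / 2)
  have h2 := (ENNReal.tendsto_toReal (by simp)).comp h1
  have h3 : ∀ x : ℕ × ℕ, dist (u x.1) (u x.2)
      = ((‖u x.1 - u x.2‖ₑ ^ 2) ^ (1 / 2 : ℝ)).toReal := by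
    intro x
    rw [← ENNReal.rpow_natCast, ← ENNReal.rpow_mul, dist_eq_norm]
    norm_num
  simp only [h3]
  simpa [Function.comp_def] using h2

/-- Completeness of `G`: the products are Cauchy in every norm, so each kernel converges, and lower
semicontinuity of the norms upgrades this to convergence in norm. -/
lemma exists_conv_kers_mul (hμ : IsWhiteNoiseMeasure μ) {ψ φ : Kernels} (hψ : ψ ∈ G)
    (hφ : φ ∈ G) {p q : ℕ → Poly} (hp : ∀ b, Conv b (fun k => kers hμ (p k)) ψ)
    (hq : ∀ b, Conv b (fun k => kers hμ (q k)) φ) :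
    ∃ ρ ∈ G, ∀ a, Conv a (fun k => kers hμ (p k * q k)) ρ := by
  have hcau : ∀ n, CauchySeq fun k => ker hμ n (p k * q k) := by
    intro n
    refine cauchySeq_of_tendsto_enorm_sq (tendsto_of_tendsto_of_tendsto_of_le_of_le
      tendsto_const_nhds (tendsto_normSq_kers_mul_sub hμ hψ hφ hp hq le_rfl)
      (fun _ => zero_le) fun x => ?_)
    have h1 := enorm_sq_le_normSq 0 (kers hμ (p x.1 * q x.1) - kers hμ (p x.2 * q x.2)) n
    simp only [mul_zero, zero_mul, neg_zero, Real.exp_zero, ENNReal.ofReal_one, one_mul] at h1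
    exact h1
  choose ρ hρ using fun n => cauchySeq_tendsto_of_complete (hcau n)
  have hconv : ∀ a, 0 ≤ a → Conv a (fun k => kers hμ (p k * q k)) ρ := by
    intro a ha
    have h1 := tendsto_normSq_kers_mul_sub hμ hψ hφ hp hq ha
    refine ENNReal.tendsto_nhds_zero.mpr fun ε hε => ?_
    have h2 := ENNReal.tendsto_nhds_zero.mp h1 ε hε
    -- For fixed large `k`, the other index tends to infinity inside the norm.
    filter_upwards [h2.curry] with k hk
    refine normSq_le_of_tendsto (F := fun l => kers hμ (p k * q k) - kers hμ (p l * q l))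
      (fun n => ?_) hk
    exact tendsto_const_nhds.sub (hρ n)
  have hconv' : ∀ a, Conv a (fun k => kers hμ (p k * q k)) ρ :=
    fun a => (hconv _ (le_max_right a 0)).mono (le_max_left a 0)
  refine ⟨ρ, mem_G_iff.mpr ⟨fun n => ?_, fun l => ?_⟩, hconv'⟩
  · exact (isClosed_symmSub n).mem_of_tendsto (hρ n)
      (Eventually.of_forall fun k => isSymm_ker hμ n _)
  · obtain ⟨k, hk⟩ := ((hconv' l).eventually (gt_mem_nhds one_pos)).exists
    have h1 := normSq_sub_le l (kers hμ (p k * q k)) (kers hμ (p k * q k) - ρ)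
    rw [sub_sub_cancel] at h1
    exact h1.trans_lt (ENNReal.mul_lt_top (by simp) (ENNReal.add_lt_top.mpr
      ⟨(mem_G_iff.mp (kers_mem_G hμ _)).2 l, hk.trans (by simp)⟩))

/-! ### The algebra `G` -/

lemma IsPointwiseProduct.unique (hμ : IsWhiteNoiseMeasure μ) {ψ φ ρ ρ' : Kernels}
    (h : IsPointwiseProduct μ ψ φ ρ) (h' : IsPointwiseProduct μ ψ φ ρ') : ρ = ρ' := by
  obtain ⟨X, Y, Z, hX, hY, hZ, hXY⟩ := h
  obtain ⟨X', Y', Z', hX', hY', hZ', hXY'⟩ := h'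
  rw [hX'.unique hμ hX, hY'.unique hμ hY] at hXY'
  have h1 : Z = Z' := Lp.ext (hXY.trans hXY'.symm)
  rw [← h1] at hZ'
  exact hZ.unique_kernels hμ hZ'

lemma IsPointwiseProduct.symm {ψ φ ρ : Kernels} (h : IsPointwiseProduct μ ψ φ ρ) :
    IsPointwiseProduct μ φ ψ ρ := by
  obtain ⟨X, Y, Z, hX, hY, hZ, hXY⟩ := h
  refine ⟨Y, X, Z, hY, hX, hZ, hXY.trans (ae_of_all _ fun ω => mul_comm _ _)⟩

lemma IsPointwiseProduct.sub_left (hμ : IsWhiteNoiseMeasure μ) {ψ ψ' φ ρ ρ' : Kernels}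
    (h : IsPointwiseProduct μ ψ φ ρ) (h' : IsPointwiseProduct μ ψ' φ ρ') :
    IsPointwiseProduct μ (ψ - ψ') φ (ρ - ρ') := by
  obtain ⟨X, Y, Z, hX, hY, hZ, hXY⟩ := h
  obtain ⟨X', Y', Z', hX', hY', hZ', hXY'⟩ := h'
  rw [hY'.unique hμ hY] at hXY'
  refine ⟨X - X', Y, Z - Z', hX.sub hμ hX', hY, hZ.sub hμ hZ', ?_⟩
  filter_upwards [hXY, hXY', Lp.coeFn_sub X X', Lp.coeFn_sub Z Z'] with ω h1 h2 h3 h4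
  rw [h4, h3, Pi.sub_apply, Pi.sub_apply, h1, h2, sub_mul]

lemma hasChaos_of_mem_G (hμ : IsWhiteNoiseMeasure μ) {F : Kernels} (hF : F ∈ G) :
    ∃ X, HasChaos μ F X := by
  rw [mem_G_iff] at hF
  exact exists_hasChaos hμ hF.1 (hF.2 0).ne

/-- The three sequences converge in `(L²)`, hence almost surely along a common subsequence obtained
by three nested extractions, and there the pointwise product passes to the limit. -/
lemma isPointwiseProduct_of_conv (hμ : IsWhiteNoiseMeasure μ) {ψ φ ρ : Kernels} (hψ : ψ ∈ G)
    (hφ : φ ∈ G) (hρ : ρ ∈ G) {p q : ℕ → Poly} (hp : Conv 0 (fun k => kers hμ (p k)) ψ)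
    (hq : Conv 0 (fun k => kers hμ (q k)) φ) (hpq : Conv 0 (fun k => kers hμ (p k * q k)) ρ) :
    IsPointwiseProduct μ ψ φ ρ := by
  obtain ⟨X, hX⟩ := hasChaos_of_mem_G hμ hψ
  obtain ⟨Y, hY⟩ := hasChaos_of_mem_G hμ hφ
  obtain ⟨Z, hZ⟩ := hasChaos_of_mem_G hμ hρ
  refine ⟨X, Y, Z, hX, hY, hZ, ?_⟩
  have h1 := HasChaos.tendsto hμ (fun k => hasChaos_kers hμ (p k)) hX hp
  have h2 := HasChaos.tendsto hμ (fun k => hasChaos_kers hμ (q k)) hY hq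
  have h3 := HasChaos.tendsto hμ (fun k => hasChaos_kers hμ (p k * q k)) hZ hpq
  obtain ⟨n1, hn1, k1⟩ := exists_subseq_tendsto_ae h1
  obtain ⟨n2, hn2, k2⟩ := exists_subseq_tendsto_ae (h2.comp hn1.tendsto_atTop)
  obtain ⟨n3, hn3, k3⟩ := exists_subseq_tendsto_ae
    (h3.comp (hn1.tendsto_atTop.comp hn2.tendsto_atTop))
  filter_upwards [k1, k2, k3, ae_all_iff.mpr fun k => ev_ae hμ (p k),
    ae_all_iff.mpr fun k => ev_ae hμ (q k), ae_all_iff.mpr fun k => ev_ae hμ (p k * q k)]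
    with ω l1 l2 l3 e1 e2 e3
  simp only [Function.comp_def, e1, e2, e3, rv_mul] at l1 l2 l3
  exact tendsto_nhds_unique l3 ((l1.comp (hn2.comp hn3).tendsto_atTop).mul
    (l2.comp hn3.tendsto_atTop))

lemma exists_mul (hμ : IsWhiteNoiseMeasure μ) {ψ φ : Kernels} (hψ : ψ ∈ G) (hφ : φ ∈ G) :
    ∃ ρ ∈ G, IsPointwiseProduct μ ψ φ ρ := by
  obtain ⟨p, hp⟩ := exists_approx hμ hψ
  obtain ⟨q, hq⟩ := exists_approx hμ hφ
  obtain ⟨ρ, hρ, hconv⟩ := exists_conv_kers_mul hμ hψ hφ (conv_kers_approx hμ hp)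
    (conv_kers_approx hμ hq)
  exact ⟨ρ, hρ, isPointwiseProduct_of_conv hμ hψ hφ hρ (conv_kers_approx hμ hp 0)
    (conv_kers_approx hμ hq 0) (hconv 0)⟩

open Classical in
/-- The product of the algebra `G` (and `0` outside of `G`). -/
def mul (μ : Measure Dist) (ψ φ : Kernels) : Kernels :=
  if h : ∃ ρ ∈ G, IsPointwiseProduct μ ψ φ ρ then h.choose else 0

lemma mul_mem_G (ψ φ : Kernels) : mul μ ψ φ ∈ G := by
  rw [mul]
  split_ifs with h
  · exact h.choose_spec.1
  · exact zero_mem_G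

lemma isPointwiseProduct_mul (hμ : IsWhiteNoiseMeasure μ) {ψ φ : Kernels} (hψ : ψ ∈ G)
    (hφ : φ ∈ G) : IsPointwiseProduct μ ψ φ (mul μ ψ φ) := by
  have h := exists_mul hμ hψ hφ
  rw [mul, dif_pos h]
  exact h.choose_spec.2

lemma IsPointwiseProduct.eq_mul (hμ : IsWhiteNoiseMeasure μ) {ψ φ ρ : Kernels} (hψ : ψ ∈ G)
    (hφ : φ ∈ G) (h : IsPointwiseProduct μ ψ φ ρ) : ρ = mul μ ψ φ :=
  h.unique hμ (isPointwiseProduct_mul hμ hψ hφ)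

lemma mul_comm_G (hμ : IsWhiteNoiseMeasure μ) {ψ φ : Kernels} (hψ : ψ ∈ G) (hφ : φ ∈ G) :
    mul μ ψ φ = mul μ φ ψ :=
  (isPointwiseProduct_mul hμ hψ hφ).symm.eq_mul hμ hφ hψ

lemma sub_mul_G (hμ : IsWhiteNoiseMeasure μ) {ψ ψ' φ : Kernels} (hψ : ψ ∈ G) (hψ' : ψ' ∈ G)
    (hφ : φ ∈ G) : mul μ (ψ - ψ') φ = mul μ ψ φ - mul μ ψ' φ :=
  (((isPointwiseProduct_mul hμ hψ hφ).sub_left hμ (isPointwiseProduct_mul hμ hψ' hφ)).eq_mul hμ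
    (sub_mem_G hψ hψ') hφ).symm

lemma mul_sub_G (hμ : IsWhiteNoiseMeasure μ) {ψ φ φ' : Kernels} (hψ : ψ ∈ G) (hφ : φ ∈ G)
    (hφ' : φ' ∈ G) : mul μ ψ (φ - φ') = mul μ ψ φ - mul μ ψ φ' := by
  rw [mul_comm_G hμ hψ (sub_mem_G hφ hφ'), sub_mul_G hμ hφ hφ' hψ, mul_comm_G hμ hφ hψ,
    mul_comm_G hμ hφ' hψ]

lemma mul_kers (hμ : IsWhiteNoiseMeasure μ) (p q : Poly) :
    mul μ (kers hμ p) (kers hμ q) = kers hμ (p * q) := by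
  refine (IsPointwiseProduct.eq_mul hμ (kers_mem_G hμ p) (kers_mem_G hμ q)
    ⟨ev hμ p, ev hμ q, ev hμ (p * q), hasChaos_kers hμ p, hasChaos_kers hμ q,
      hasChaos_kers hμ (p * q), ?_⟩).symm
  filter_upwards [ev_ae hμ p, ev_ae hμ q, ev_ae hμ (p * q)] with ω h1 h2 h3
  rw [h1, h2, h3, rv_mul]

/-- Continuity of the product of `G`. -/
theorem normSq_mul_le (hμ : IsWhiteNoiseMeasure μ) {a : ℝ} (ha : 0 ≤ a) {ψ φ : Kernels}
    (hψ : ψ ∈ G) (hφ : φ ∈ G) :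
    normSq a (mul μ ψ φ) ≤ 64 * normSq (a + 2) ψ * normSq (a + 2) φ := by
  obtain ⟨p, hp⟩ := exists_approx hμ hψ
  obtain ⟨q, hq⟩ := exists_approx hμ hφ
  have hp' := conv_kers_approx hμ hp
  have hq' := conv_kers_approx hμ hq
  obtain ⟨ρ, hρ, hconv⟩ := exists_conv_kers_mul hμ hψ hφ hp' hq'
  rw [← (isPointwiseProduct_of_conv hμ hψ hφ hρ (hp' 0) (hq' 0) (hconv 0)).eq_mul hμ hψ hφ]
  have hA := ((mem_G_iff.mp hψ).2 (a + 2)).ne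
  have hB := ((mem_G_iff.mp hφ).2 (a + 2)).ne
  -- The bound for polynomials has constant `8`; replacing the product and each of the two factors
  -- by its limit doubles it, whence `64`.
  have hlim : Tendsto (fun k => 2 * (normSq a (kers hμ (p k * q k) - ρ) +
      8 * (2 * (normSq (a + 2) (kers hμ (p k) - ψ) + normSq (a + 2) ψ)) *
        (2 * (normSq (a + 2) (kers hμ (q k) - φ) + normSq (a + 2) φ)))) atTop
      (𝓝 (2 * (0 + 8 * (2 * (0 + normSq (a + 2) ψ)) * (2 * (0 + normSq (a + 2) φ))))) := by
    have h1 := ENNReal.Tendsto.const_mul (a := 2)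
      (Tendsto.add_const (normSq (a + 2) ψ) (hp' (a + 2))) (Or.inr (by simp))
    have h2 := ENNReal.Tendsto.const_mul (a := 2)
      (Tendsto.add_const (normSq (a + 2) φ) (hq' (a + 2))) (Or.inr (by simp))
    have h3 := ENNReal.Tendsto.const_mul (a := 8) h1 (Or.inr (by simp))
    have h4 := ENNReal.Tendsto.mul h3
      (Or.inr (ENNReal.mul_ne_top (by simp) (by simpa using hB))) h2
      (Or.inr (ENNReal.mul_ne_top (by simp) (ENNReal.mul_ne_top (by simp) (by simpa using hA))))
    exact ENNReal.Tendsto.const_mul (Tendsto.add (hconv a) h4) (Or.inr (by simp))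
  have hle : normSq a ρ ≤ 2 * (0 + 8 * (2 * (0 + normSq (a + 2) ψ)) *
      (2 * (0 + normSq (a + 2) φ))) := by
    refine ge_of_tendsto hlim (Eventually.of_forall fun k => ?_)
    have h1 := normSq_sub_le a (kers hμ (p k * q k)) (kers hμ (p k * q k) - ρ)
    rw [sub_sub_cancel, add_comm (normSq a _)] at h1
    refine h1.trans ?_
    have h2 := normSq_add_le (a + 2) (kers hμ (p k) - ψ) ψ
    have h3 := normSq_add_le (a + 2) (kers hμ (q k) - φ) φ
    rw [sub_add_cancel] at h2 h3
    gcongr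
    refine (normSq_kers_mul_le hμ ha (p k) (q k)).trans ?_
    gcongr
  refine hle.trans (le_of_eq ?_)
  ring

lemma Conv.mul (hμ : IsWhiteNoiseMeasure μ) {a : ℝ} (ha : 0 ≤ a) {F H : ℕ → Kernels}
    {F' H' : Kernels} (hF : ∀ k, F k ∈ G) (hH : ∀ k, H k ∈ G) (hF' : F' ∈ G) (hH' : H' ∈ G)
    (hcF : Conv (a + 2) F F') (hcH : Conv (a + 2) H H') :
    Conv a (fun k => mul μ (F k) (H k)) (mul μ F' H') := by
  have hA := ((mem_G_iff.mp hF').2 (a + 2)).ne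
  have hB : 2 * (1 + normSq (a + 2) H') ≠ ∞ := ENNReal.mul_ne_top (by simp)
    (ENNReal.add_ne_top.mpr ⟨by simp, ((mem_G_iff.mp hH').2 (a + 2)).ne⟩)
  have hlim : Tendsto (fun k => 2 * (64 * normSq (a + 2) (F k - F') * (2 * (1 + normSq (a + 2) H'))
      + 64 * normSq (a + 2) F' * normSq (a + 2) (H k - H'))) atTop (𝓝 0) := by
    have h1 := ENNReal.Tendsto.mul_const
      (ENNReal.Tendsto.const_mul (a := 64) hcF (Or.inr (by simp))) (Or.inr hB)
    have h2 := ENNReal.Tendsto.const_mul (a := 64 * normSq (a + 2) F') hcH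
      (Or.inr (ENNReal.mul_ne_top (by simp) hA))
    simpa using ENNReal.Tendsto.const_mul (a := 2) (h1.add h2) (Or.inr (by simp))
  refine Conv.of_le hlim ?_
  filter_upwards [hcH.eventually_normSq_le] with k hk
  have h1 : WhiteNoise.mul μ (F k) (H k) - WhiteNoise.mul μ F' H'
      = WhiteNoise.mul μ (F k - F') (H k) + WhiteNoise.mul μ F' (H k - H') := by
    rw [sub_mul_G hμ (hF k) hF' (hH k), mul_sub_G hμ hF' (hH k) hH']
    abel
  rw [h1]
  refine (normSq_add_le a _ _).trans ?_
  gcongr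
  · refine (normSq_mul_le hμ ha (sub_mem_G (hF k) hF') (hH k)).trans ?_
    gcongr
  · exact normSq_mul_le hμ ha hF' (sub_mem_G (hH k) hH')

/-! ### The stochastic derivative -/

/-- The stochastic derivative, in terms of slices. -/
def sliceDeriv (t : ℝ) (F : Kernels) : Kernels := fun n => ((n : ℝ) + 1) • slice (F (n + 1)) t

lemma stochDeriv_ae (F : Kernels) : ∀ᵐ t : ℝ, stochDeriv t F = sliceDeriv t F := by
  filter_upwards [ae_all_iff.mpr fun n => memLp_snocR (F (n + 1)),
    ae_all_iff.mpr fun n => slice_ae (F (n + 1))] with t h1 h2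
  funext n
  have h3 : MemLp (fun x : Fin n → ℝ =>
      ((n : ℝ) + 1) * F (n + 1) (Fin.snoc (α := fun _ => ℝ) x t)) 2 volume :=
    (h1 n).const_mul _
  rw [stochDeriv, dif_pos h3, sliceDeriv]
  refine Lp.ext ?_
  filter_upwards [h3.coeFn_toLp, h2 n, Lp.coeFn_smul ((n : ℝ) + 1) (slice (F (n + 1)) t)]
    with x k1 k2 k3
  rw [k1, k3, Pi.smul_apply, k2]
  rfl

lemma sliceDeriv_sub (F H : Kernels) :
    ∀ᵐ t : ℝ, sliceDeriv t (F - H) = sliceDeriv t F - sliceDeriv t H := by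
  filter_upwards [ae_all_iff.mpr fun n => slice_sub (F (n + 1)) (H (n + 1))] with t ht
  funext n
  simp only [sliceDeriv, Pi.sub_apply, ht n, smul_sub]

lemma sliceDeriv_kers (hμ : IsWhiteNoiseMeasure μ) (p : Poly) :
    ∀ᵐ t : ℝ, sliceDeriv t (kers hμ p) = kers hμ (ptDeriv t p) := by
  filter_upwards [ae_all_iff.mpr fun n => slice_ker hμ n p] with t ht
  funext n
  rw [sliceDeriv, kers_apply, ht n, smul_smul, mul_inv_cancel₀ (by positivity), one_smul, kers_apply]

lemma measurable_normSq_sliceDeriv_term (l : ℝ) (F : Kernels) (n : ℕ) :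
    AEMeasurable fun t => ENNReal.ofReal ((n.factorial : ℝ) * Real.exp (2 * l * n))
      * ‖sliceDeriv t F n‖ₑ ^ 2 :=
  (((aestronglyMeasurable_slice (F (n + 1))).const_smul ((n : ℝ) + 1)).enorm.pow_const 2).const_mul _

lemma aemeasurable_normSq_sliceDeriv (l : ℝ) (F : Kernels) :
    AEMeasurable fun t => normSq l (sliceDeriv t F) :=
  AEMeasurable.tsum fun n => measurable_normSq_sliceDeriv_term l F n

/-- The weight is `n! (n + 1)² = (n + 1)! (n + 1)`, and the surplus factor `n + 1` is at most the
`e^{2(n+1)}` that one unit of the index provides. -/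
lemma lintegral_normSq_sliceDeriv_le {l : ℝ} (hl : 0 ≤ l) (F : Kernels) :
    ∫⁻ t, normSq l (sliceDeriv t F) ≤ normSq (l + 1) F := by
  simp only [normSq]
  rw [lintegral_tsum fun n => measurable_normSq_sliceDeriv_term l F n]
  have h1 : ∀ n : ℕ, ∫⁻ t, ENNReal.ofReal ((n.factorial : ℝ) * Real.exp (2 * l * n))
      * ‖sliceDeriv t F n‖ₑ ^ 2
      ≤ ENNReal.ofReal (((n + 1).factorial : ℝ) * Real.exp (2 * (l + 1) * (n + 1 : ℕ)))
        * ‖F (n + 1)‖ₑ ^ 2 := by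
    intro n
    have h2 : ∀ t, ENNReal.ofReal ((n.factorial : ℝ) * Real.exp (2 * l * n))
        * ‖sliceDeriv t F n‖ₑ ^ 2
        = ENNReal.ofReal ((n.factorial : ℝ) * Real.exp (2 * l * n) * ((n : ℝ) + 1) ^ 2)
          * ‖slice (F (n + 1)) t‖ₑ ^ 2 := by
      intro t
      have h3 : ‖(n : ℝ) + 1‖ₑ = ENNReal.ofReal ((n : ℝ) + 1) :=
        Real.enorm_of_nonneg (by positivity)
      rw [sliceDeriv, enorm_smul, mul_pow, h3, ENNReal.ofReal_mul (p := _ * _) (by positivity),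
        ENNReal.ofReal_pow (by positivity)]
      exact (mul_assoc _ _ _).symm
    simp only [h2]
    rw [lintegral_const_mul' _ _ (by simp), lintegral_enorm_slice]
    refine mul_le_mul' (ENNReal.ofReal_le_ofReal ?_) le_rfl
    rw [Nat.factorial_succ]
    push_cast
    have h4 : (n : ℝ) + 1 ≤ Real.exp (2 * (n + 1)) := by
      have := Real.add_one_le_exp (2 * ((n : ℝ) + 1))
      have hn : (0 : ℝ) ≤ n := by positivity
      linarith
    have h5 : Real.exp (2 * l * n) ≤ Real.exp (2 * l * (n + 1)) :=
      Real.exp_le_exp.mpr (by nlinarith)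
    have h6 : Real.exp (2 * (l + 1) * (n + 1))
        = Real.exp (2 * (n + 1)) * Real.exp (2 * l * (n + 1)) := by
      rw [← Real.exp_add]
      ring_nf
    calc (n.factorial : ℝ) * Real.exp (2 * l * n) * ((n : ℝ) + 1) ^ 2
        = ((n : ℝ) + 1) * n.factorial * (((n : ℝ) + 1) * Real.exp (2 * l * n)) := by ring
      _ ≤ _ := by
        rw [h6]
        gcongr
  calc _ ≤ ∑' n : ℕ, ENNReal.ofReal (((n + 1).factorial : ℝ)
        * Real.exp (2 * (l + 1) * (n + 1 : ℕ))) * ‖F (n + 1)‖ₑ ^ 2 := ENNReal.tsum_le_tsum h1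
    _ ≤ _ := ENNReal.tsum_comp_le_tsum_of_injective (add_left_injective 1)
      fun n : ℕ => ENNReal.ofReal ((n.factorial : ℝ) * Real.exp (2 * (l + 1) * n)) * ‖F n‖ₑ ^ 2

lemma sliceDeriv_mem_G {F : Kernels} (hF : F ∈ G) : ∀ᵐ t : ℝ, sliceDeriv t F ∈ G := by
  rw [mem_G_iff] at hF
  -- Integer indices suffice by monotonicity of the norms, so only countably many null sets are
  -- discarded.
  have h1 : ∀ k : ℕ, ∀ᵐ t : ℝ, normSq k (sliceDeriv t F) < ∞ := by
    intro k
    refine ae_lt_top' (aemeasurable_normSq_sliceDeriv k F) ?_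
    exact ((lintegral_normSq_sliceDeriv_le (by positivity) F).trans_lt (hF.2 _)).ne
  filter_upwards [ae_all_iff.mpr h1, ae_all_iff.mpr fun n => isSymm_slice (hF.1 (n + 1))]
    with t h2 h3
  rw [mem_G_iff]
  refine ⟨fun n => (symmSub n).smul_mem _ (h3 n), fun l => ?_⟩
  exact (normSq_mono (Nat.le_ceil l) _).trans_lt (h2 ⌈l⌉₊)

/-- Summable errors make `∑ₖ ‖D_t (F k - H)‖_l²` integrable in `t`, so it is finite and its terms
tend to zero for almost every `t`, without extracting a subsequence. -/
lemma ae_conv_sliceDeriv {l : ℝ} (hl : 0 ≤ l) {F : ℕ → Kernels} {H : Kernels}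
    (h : ∑' k, normSq (l + 1) (F k - H) ≠ ∞) :
    ∀ᵐ t : ℝ, Conv l (fun k => sliceDeriv t (F k)) (sliceDeriv t H) := by
  have h1 : ∫⁻ t, ∑' k, normSq l (sliceDeriv t (F k - H)) ≠ ∞ := by
    rw [lintegral_tsum fun k => aemeasurable_normSq_sliceDeriv l _]
    exact ne_top_of_le_ne_top h
      (ENNReal.tsum_le_tsum fun k => lintegral_normSq_sliceDeriv_le hl _)
  have h2 := ae_lt_top' (AEMeasurable.tsum fun k => aemeasurable_normSq_sliceDeriv l _) h1
  filter_upwards [h2, ae_all_iff.mpr fun k => sliceDeriv_sub (F k) H] with t ht hs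
  have h3 := ENNReal.tendsto_atTop_zero_of_tsum_ne_top ht.ne
  simp only [hs] at h3
  exact h3

lemma tsum_ne_top_of_eventually_le_half_pow {u : ℕ → ℝ≥0∞} (hu : ∀ k, u k ≠ ∞) {C : ℝ≥0∞}
    (hC : C ≠ ∞) (h : ∀ᶠ k in atTop, u k ≤ C * ENNReal.ofReal ((1 / 2) ^ k)) :
    ∑' k, u k ≠ ∞ := by
  obtain ⟨N, hN⟩ := eventually_atTop.mp h
  rw [← Summable.sum_add_tsum_nat_add' (k := N) ENNReal.summable]
  refine ENNReal.add_ne_top.mpr ⟨ENNReal.sum_ne_top.mpr fun k _ => hu k, ?_⟩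
  have h1 : ∑' k, C * ENNReal.ofReal ((1 / 2) ^ k) ≠ ∞ := by
    rw [ENNReal.tsum_mul_left, ← ENNReal.ofReal_tsum_of_nonneg (fun k => by positivity)
      summable_geometric_two]
    exact ENNReal.mul_ne_top hC ENNReal.ofReal_ne_top
  refine ne_top_of_le_ne_top h1 ?_
  calc _ ≤ ∑' k, C * ENNReal.ofReal ((1 / 2) ^ (k + N)) :=
        ENNReal.tsum_le_tsum fun k => hN _ (Nat.le_add_left N k)
    _ ≤ _ := ENNReal.tsum_comp_le_tsum_of_injective (add_left_injective N)
      fun k => C * ENNReal.ofReal ((1 / 2) ^ k)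

lemma normSq_sub_ne_top {F H : Kernels} (hF : F ∈ G) (hH : H ∈ G) (b : ℝ) :
    normSq b (F - H) ≠ ∞ := ((mem_G_iff.mp (sub_mem_G hF hH)).2 b).ne

lemma tsum_normSq_kers_sub_ne_top (hμ : IsWhiteNoiseMeasure μ) {F : Kernels} (hF : F ∈ G)
    {p : ℕ → Poly} (hp : ∀ k : ℕ, normSq k (kers hμ (p k) - F) ≤ ENNReal.ofReal ((1 / 2) ^ k))
    (b : ℝ) : ∑' k, normSq b (kers hμ (p k) - F) ≠ ∞ := by
  refine tsum_ne_top_of_eventually_le_half_pow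
    (fun k => normSq_sub_ne_top (kers_mem_G hμ _) hF b) ENNReal.one_ne_top ?_
  filter_upwards [eventually_ge_atTop ⌈b⌉₊] with k hk
  rw [one_mul]
  exact (normSq_mono (Nat.ceil_le.mp hk) _).trans (hp k)

lemma tsum_normSq_kers_mul_sub_ne_top (hμ : IsWhiteNoiseMeasure μ) {ψ φ : Kernels} (hψ : ψ ∈ G)
    (hφ : φ ∈ G) {p q : ℕ → Poly}
    (hp : ∀ k : ℕ, normSq k (kers hμ (p k) - ψ) ≤ ENNReal.ofReal ((1 / 2) ^ k))
    (hq : ∀ k : ℕ, normSq k (kers hμ (q k) - φ) ≤ ENNReal.ofReal ((1 / 2) ^ k))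
    {a : ℝ} (ha : 0 ≤ a) : ∑' k, normSq a (kers hμ (p k * q k) - mul μ ψ φ) ≠ ∞ := by
  have hA := ((mem_G_iff.mp hψ).2 (a + 2)).ne
  have hB := ((mem_G_iff.mp hφ).2 (a + 2)).ne
  refine tsum_ne_top_of_eventually_le_half_pow
    (C := 2 * (64 * (2 * (1 + normSq (a + 2) φ)) + 64 * normSq (a + 2) ψ))
    (fun k => normSq_sub_ne_top (kers_mem_G hμ _) (mul_mem_G _ _) a) ?_ ?_
  · have h1 : 64 * (2 * (1 + normSq (a + 2) φ)) ≠ ∞ := ENNReal.mul_ne_top (by simp)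
      (ENNReal.mul_ne_top (by simp) (ENNReal.add_ne_top.mpr ⟨by simp, hB⟩))
    exact ENNReal.mul_ne_top (by simp)
      (ENNReal.add_ne_top.mpr ⟨h1, ENNReal.mul_ne_top (by simp) hA⟩)
  · filter_upwards [eventually_ge_atTop ⌈a + 2⌉₊,
      (conv_kers_approx hμ hq (a + 2)).eventually_normSq_le] with k hk hk2
    have h1 := (normSq_mono (Nat.ceil_le.mp hk) _).trans (hp k)
    have h2 := (normSq_mono (Nat.ceil_le.mp hk) _).trans (hq k)
    have h3 : kers hμ (p k * q k) - mul μ ψ φ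
        = mul μ (kers hμ (p k) - ψ) (kers hμ (q k)) + mul μ ψ (kers hμ (q k) - φ) := by
      rw [← mul_kers, sub_mul_G hμ (kers_mem_G hμ _) hψ (kers_mem_G hμ _),
        mul_sub_G hμ hψ (kers_mem_G hμ _) hφ]
      abel
    rw [h3]
    calc _ ≤ _ := normSq_add_le a _ _
      _ ≤ 2 * (64 * ENNReal.ofReal ((1 / 2) ^ k) * (2 * (1 + normSq (a + 2) φ))
          + 64 * normSq (a + 2) ψ * ENNReal.ofReal ((1 / 2) ^ k)) := by
          gcongr
          · refine (normSq_mul_le hμ ha (sub_mem_G (kers_mem_G hμ _) hψ) (kers_mem_G hμ _)).trans ?_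
            gcongr
          · refine (normSq_mul_le hμ ha hψ (sub_mem_G (kers_mem_G hμ _) hφ)).trans ?_
            gcongr
      _ = _ := by ring

/-- The Leibniz rule. -/
theorem sliceDeriv_mul (hμ : IsWhiteNoiseMeasure μ) {ψ φ : Kernels} (hψ : ψ ∈ G) (hφ : φ ∈ G) :
    ∀ᵐ t : ℝ, sliceDeriv t (mul μ ψ φ)
      = mul μ ψ (sliceDeriv t φ) + mul μ (sliceDeriv t ψ) φ := by
  obtain ⟨p, hp⟩ := exists_approx hμ hψ
  obtain ⟨q, hq⟩ := exists_approx hμ hφ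
  -- For the approximating polynomials the rule is that of the derivation `ptDeriv t`. Both sides
  -- converge in the norm of index `0`; the derivatives of the factors must converge in index `2`
  -- because the product loses two units.
  filter_upwards [ae_conv_sliceDeriv le_rfl
      (tsum_normSq_kers_mul_sub_ne_top hμ hψ hφ hp hq (a := 0 + 1) (by norm_num)),
    ae_conv_sliceDeriv zero_le_two (tsum_normSq_kers_sub_ne_top hμ hψ hp (2 + 1)),
    ae_conv_sliceDeriv zero_le_two (tsum_normSq_kers_sub_ne_top hμ hφ hq (2 + 1)),
    sliceDeriv_mem_G hψ, sliceDeriv_mem_G hφ,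
    ae_all_iff.mpr fun k => sliceDeriv_kers hμ (p k),
    ae_all_iff.mpr fun k => sliceDeriv_kers hμ (q k),
    ae_all_iff.mpr fun k => sliceDeriv_kers hμ (p k * q k)] with t h1 h2 h3 h4 h5 h6 h7 h8
  simp only [h6, h7, h8] at h1 h2 h3
  have h9 := (Conv.mul hμ le_rfl (fun k => kers_mem_G hμ (p k))
    (fun k => kers_mem_G hμ (ptDeriv t (q k))) hψ h5 (conv_kers_approx hμ hp (0 + 2))
    (by simpa using h3)).add
    (Conv.mul hμ le_rfl (fun k => kers_mem_G hμ (ptDeriv t (p k)))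
    (fun k => kers_mem_G hμ (q k)) h4 hφ (by simpa using h2) (conv_kers_approx hμ hq (0 + 2)))
  refine h1.unique ?_
  convert h9 using 2 with k
  rw [mul_kers, mul_kers, ← map_add, Derivation.leibniz, smul_eq_mul, smul_eq_mul,
    mul_comm (q k)]

/-! ### The pairing of `G*` and `G` -/

lemma abs_pairing_term_le (l : ℝ) (Φ ψ : Kernels) (n : ℕ) :
    |(n.factorial : ℝ) * inner ℝ (Φ n) (ψ n)| ≤ √(normTerm (-l) Φ n) * √(normTerm l ψ n) := by
  rw [← Real.sqrt_mul (normTerm_nonneg _ _ _)]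
  refine Real.le_sqrt_of_sq_le ?_
  have h1 : |(inner ℝ (Φ n) (ψ n) : ℝ)| ≤ ‖Φ n‖ * ‖ψ n‖ := abs_real_inner_le_norm _ _
  have h2 : normTerm (-l) Φ n * normTerm l ψ n
      = (n.factorial : ℝ) ^ 2 * (‖Φ n‖ * ‖ψ n‖) ^ 2 := by
    have h3 : Real.exp (2 * -l * n) * Real.exp (2 * l * n) = 1 := by
      rw [← Real.exp_add, ← Real.exp_zero]
      congr 1
      ring
    simp only [normTerm]
    linear_combination (n.factorial : ℝ) ^ 2 * (‖Φ n‖ * ‖ψ n‖) ^ 2 * h3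
  rw [h2, abs_mul, mul_pow, Nat.abs_cast]
  gcongr

lemma summable_normTerm {l : ℝ} {F : Kernels} (h : normSq l F ≠ ∞) : Summable (normTerm l F) := by
  rw [normSq_eq] at h
  have h1 := ENNReal.summable_toReal h
  simpa only [ENNReal.toReal_ofReal (normTerm_nonneg _ _ _)] using h1

lemma toReal_normSq (l : ℝ) (F : Kernels) (h : normSq l F ≠ ∞) :
    (normSq l F).toReal = ∑' n, normTerm l F n := by
  rw [normSq_eq, ← ENNReal.ofReal_tsum_of_nonneg (normTerm_nonneg _ _) (summable_normTerm h),
    ENNReal.toReal_ofReal (tsum_nonneg (normTerm_nonneg _ _))]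

lemma sum_abs_pairing_le {l : ℝ} {Φ ψ : Kernels} (hΦ : normSq (-l) Φ ≠ ∞) (hψ : normSq l ψ ≠ ∞)
    (s : Finset ℕ) : ∑ n ∈ s, |(n.factorial : ℝ) * inner ℝ (Φ n) (ψ n)|
      ≤ √(normSq (-l) Φ).toReal * √(normSq l ψ).toReal := by
  calc _ ≤ ∑ n ∈ s, √(normTerm (-l) Φ n) * √(normTerm l ψ n) :=
        Finset.sum_le_sum fun n _ => abs_pairing_term_le l Φ ψ n
    _ ≤ √(∑ n ∈ s, normTerm (-l) Φ n) * √(∑ n ∈ s, normTerm l ψ n) :=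
        Real.sum_sqrt_mul_sqrt_le _ (normTerm_nonneg _ _) (normTerm_nonneg _ _)
    _ ≤ _ := by
        rw [toReal_normSq _ _ hΦ, toReal_normSq _ _ hψ]
        gcongr
        · exact (summable_normTerm hΦ).sum_le_tsum _ fun n _ => normTerm_nonneg _ _ _
        · exact (summable_normTerm hψ).sum_le_tsum _ fun n _ => normTerm_nonneg _ _ _

lemma summable_pairing {l : ℝ} {Φ ψ : Kernels} (hΦ : normSq (-l) Φ ≠ ∞) (hψ : normSq l ψ ≠ ∞) :
    Summable fun n => (n.factorial : ℝ) * inner ℝ (Φ n) (ψ n) :=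
  (summable_of_sum_le (fun _ => abs_nonneg _) (sum_abs_pairing_le hΦ hψ)).of_abs

lemma sq_pairing_le {l : ℝ} {Φ ψ : Kernels} (hΦ : normSq (-l) Φ ≠ ∞) (hψ : normSq l ψ ≠ ∞) :
    pairing Φ ψ ^ 2 ≤ (normSq (-l) Φ).toReal * (normSq l ψ).toReal := by
  have h1 : |pairing Φ ψ| ≤ √(normSq (-l) Φ).toReal * √(normSq l ψ).toReal := by
    have hs : Summable fun n => ‖(n.factorial : ℝ) * inner ℝ (Φ n) (ψ n)‖ :=
      (summable_pairing hΦ hψ).norm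
    calc |pairing Φ ψ| ≤ ∑' n, ‖(n.factorial : ℝ) * inner ℝ (Φ n) (ψ n)‖ :=
          norm_tsum_le_tsum_norm hs
      _ ≤ _ := hs.tsum_le_of_sum_le (sum_abs_pairing_le hΦ hψ)
  rw [← sq_abs]
  refine (pow_le_pow_left₀ (abs_nonneg _) h1 2).trans ?_
  rw [mul_pow, Real.sq_sqrt ENNReal.toReal_nonneg, Real.sq_sqrt ENNReal.toReal_nonneg]

lemma normSq_ne_top_of_mem_G {F : Kernels} (hF : F ∈ G) (l : ℝ) : normSq l F ≠ ∞ :=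
  ((mem_G_iff.mp hF).2 l).ne

lemma pairing_sub_right {Φ ψ ψ' : Kernels} (hΦ : Φ ∈ GStar) (hψ : ψ ∈ G) (hψ' : ψ' ∈ G) :
    pairing Φ (ψ - ψ') = pairing Φ ψ - pairing Φ ψ' := by
  obtain ⟨l, hl, h⟩ := hΦ
  have h1 := summable_pairing h.2.ne (normSq_ne_top_of_mem_G hψ l)
  have h2 := summable_pairing h.2.ne (normSq_ne_top_of_mem_G hψ' l)
  simp only [pairing, Pi.sub_apply, inner_sub_right, mul_sub]
  exact h1.tsum_sub h2

lemma pairing_zero_right (Φ : Kernels) : pairing Φ 0 = 0 := by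
  simp [pairing]

lemma pairing_add_right {Φ ψ ψ' : Kernels} (hΦ : Φ ∈ GStar) (hψ : ψ ∈ G) (hψ' : ψ' ∈ G) :
    pairing Φ (ψ + ψ') = pairing Φ ψ + pairing Φ ψ' := by
  have h := pairing_sub_right hΦ (add_mem_G hψ hψ') hψ'
  rw [add_sub_cancel_right] at h
  linarith

lemma pairing_sub_left {Φ Φ' ψ : Kernels} (hΦ : Φ ∈ GStar) (hΦ' : Φ' ∈ GStar) (hψ : ψ ∈ G) :
    pairing (Φ - Φ') ψ = pairing Φ ψ - pairing Φ' ψ := by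
  obtain ⟨l, hl, h⟩ := hΦ
  obtain ⟨l', hl', h'⟩ := hΦ'
  have h1 := summable_pairing h.2.ne (normSq_ne_top_of_mem_G hψ l)
  have h2 := summable_pairing h'.2.ne (normSq_ne_top_of_mem_G hψ l')
  simp only [pairing, Pi.sub_apply, inner_sub_left, mul_sub]
  exact h1.tsum_sub h2

lemma sub_mem_GStar {Φ Φ' : Kernels} (hΦ : Φ ∈ GStar) (hΦ' : Φ' ∈ GStar) : Φ - Φ' ∈ GStar := by
  obtain ⟨l, hl, h⟩ := hΦ
  obtain ⟨l', hl', h'⟩ := hΦ'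
  refine ⟨max l l', lt_max_of_lt_left hl, fun n => (symmSub n).sub_mem (h.1 n) (h'.1 n), ?_⟩
  refine (normSq_sub_le _ _ _).trans_lt
    (ENNReal.mul_lt_top (by simp) (ENNReal.add_lt_top.mpr ⟨?_, ?_⟩))
  · exact (normSq_mono (neg_le_neg (le_max_left l l')) _).trans_lt h.2
  · exact (normSq_mono (neg_le_neg (le_max_right l l')) _).trans_lt h'.2

/-- The kernels of a random variable in the chaos of order `n`. -/
def single (n : ℕ) (f : L2 n) : Kernels := Pi.single n f

lemma single_same (n : ℕ) (f : L2 n) : single n f n = f := Pi.single_eq_same _ _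

lemma single_of_ne {n m : ℕ} (h : m ≠ n) (f : L2 n) : single n f m = 0 := Pi.single_eq_of_ne h _

lemma single_add (n : ℕ) (f g : L2 n) : single n (f + g) = single n f + single n g :=
  Pi.single_add _ _ _

lemma single_mem_G {n : ℕ} {f : L2 n} (hf : IsSymm f) : single n f ∈ G := by
  rw [mem_G_iff]
  refine ⟨fun m => ?_, fun l => normSq_lt_top_of_forall_ge (N := n + 1) fun m hm =>
    single_of_ne (by omega) f⟩
  by_cases h : m = n
  · subst h
    rwa [single_same]
  · rw [single_of_ne h]
    exact (symmSub m).zero_mem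

lemma normSq_single (l : ℝ) (n : ℕ) (f : L2 n) :
    normSq l (single n f) = ENNReal.ofReal ((n.factorial : ℝ) * Real.exp (2 * l * n)) * ‖f‖ₑ ^ 2 := by
  rw [normSq, tsum_eq_single n fun m hm => by rw [single_of_ne hm]; simp, single_same]

lemma pairing_single (Φ : Kernels) (n : ℕ) (f : L2 n) :
    pairing Φ (single n f) = (n.factorial : ℝ) * inner ℝ (Φ n) f := by
  rw [pairing, tsum_eq_single n fun m hm => by rw [single_of_ne hm]; simp, single_same]

/-- Testing on the single kernel `Φ n - Ψ n`, which is symmetric and so gives an element of `G`,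
shows that its norm vanishes. -/
lemma eq_of_pairing_eq {Φ Ψ : Kernels} (hΦ : Φ ∈ GStar) (hΨ : Ψ ∈ GStar)
    (h : ∀ ψ ∈ G, pairing Φ ψ = pairing Ψ ψ) : Φ = Ψ := by
  obtain ⟨l, hl, hΦ⟩ := hΦ
  obtain ⟨l', hl', hΨ⟩ := hΨ
  funext n
  have h1 := h _ (single_mem_G ((symmSub n).sub_mem (hΦ.1 n) (hΨ.1 n)))
  rw [pairing_single, pairing_single] at h1
  have h2 := mul_left_cancel₀ (Nat.cast_ne_zero.mpr n.factorial_ne_zero) h1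
  rw [← sub_eq_zero, ← inner_sub_left, inner_self_eq_zero, sub_eq_zero] at h2
  exact h2

/-- The truncation of a chaos expansion. -/
def trunc (N : ℕ) (F : Kernels) : Kernels := fun n => if n < N then F n else 0

lemma trunc_zero (F : Kernels) : trunc 0 F = 0 := rfl

lemma trunc_succ (N : ℕ) (F : Kernels) : trunc (N + 1) F = trunc N F + single N (F N) := by
  funext n
  rw [Pi.add_apply, trunc, trunc]
  rcases lt_trichotomy n N with h | rfl | h
  · rw [if_pos (by omega), if_pos h, single_of_ne h.ne, add_zero]
  · rw [if_pos (by omega), if_neg (by omega), single_same, zero_add]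
  · rw [if_neg (by omega), if_neg (by omega), single_of_ne h.ne', add_zero]

lemma trunc_mem_G (N : ℕ) {F : Kernels} (hF : ∀ n, IsSymm (F n)) : trunc N F ∈ G := by
  induction N with
  | zero => exact zero_mem_G
  | succ N ih => exact trunc_succ N F ▸ add_mem_G ih (single_mem_G (hF N))

lemma normSq_trunc (l : ℝ) (N : ℕ) (F : Kernels) :
    normSq l (trunc N F) = ENNReal.ofReal (∑ n ∈ Finset.range N, normTerm l F n) := by
  rw [normSq_eq, tsum_eq_sum (s := Finset.range N) fun n hn => ?_,
    ENNReal.ofReal_sum_of_nonneg fun _ _ => normTerm_nonneg _ _ _]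
  · refine Finset.sum_congr rfl fun n hn => ?_
    rw [normTerm, trunc, if_pos (Finset.mem_range.mp hn), normTerm]
  · rw [normTerm, trunc, if_neg (by simpa using hn)]
    simp

lemma tendsto_normSq_sub_trunc {l : ℝ} {F : Kernels} (h : normSq l F ≠ ∞) :
    Tendsto (fun N => normSq l (F - trunc N F)) atTop (𝓝 0) := by
  have h1 : ∀ N, normSq l (F - trunc N F) = ∑' n, ENNReal.ofReal (normTerm l F (n + N)) := by
    intro N
    rw [normSq_eq, ← Summable.sum_add_tsum_nat_add' (k := N) ENNReal.summable,
      Finset.sum_eq_zero fun n hn => ?_, zero_add]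
    · refine tsum_congr fun n => ?_
      rw [normTerm, Pi.sub_apply, trunc, if_neg (by omega), sub_zero, normTerm]
    · rw [normTerm, Pi.sub_apply, trunc, if_pos (Finset.mem_range.mp hn), sub_self]
      simp
  simp only [h1]
  rw [normSq_eq] at h
  exact ENNReal.tendsto_sum_nat_add _ h

/-! ### Products of generalized and test random variables -/

lemma zero_mul_G (hμ : IsWhiteNoiseMeasure μ) {φ : Kernels} (hφ : φ ∈ G) : mul μ 0 φ = 0 := by
  have h := sub_mul_G hμ zero_mem_G zero_mem_G hφ
  rwa [sub_self, sub_self] at h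

lemma add_mul_G (hμ : IsWhiteNoiseMeasure μ) {ψ ψ' φ : Kernels} (hψ : ψ ∈ G) (hψ' : ψ' ∈ G)
    (hφ : φ ∈ G) : mul μ (ψ + ψ') φ = mul μ ψ φ + mul μ ψ' φ := by
  have h := sub_mul_G hμ (add_mem_G hψ hψ') hψ' hφ
  rw [add_sub_cancel_right] at h
  rw [h, sub_add_cancel]

lemma sq_pairing_mul_le (hμ : IsWhiteNoiseMeasure μ) {l : ℝ} (hl : 0 < l) {Φ φ ψ : Kernels}
    (hΦ : normSq (-l) Φ ≠ ∞) (hφ : φ ∈ G) (hψ : ψ ∈ G) :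
    pairing Φ (mul μ ψ φ) ^ 2 ≤ (64 * normSq (-l) Φ * normSq (l + 2) φ).toReal
      * (normSq (l + 2) ψ).toReal := by
  have h1 := normSq_ne_top_of_mem_G hφ (l + 2)
  have h2 := normSq_ne_top_of_mem_G hψ (l + 2)
  refine (sq_pairing_le hΦ (normSq_ne_top_of_mem_G (mul_mem_G ψ φ) l)).trans ?_
  rw [← ENNReal.toReal_mul, ← ENNReal.toReal_mul]
  refine ENNReal.toReal_mono (by finiteness) ?_
  calc _ ≤ normSq (-l) Φ * (64 * normSq (l + 2) ψ * normSq (l + 2) φ) := by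
        gcongr
        exact normSq_mul_le hμ hl.le hψ hφ
    _ = _ := by ring

lemma continuous_of_sq_le {E : Type*} [NormedAddCommGroup E] (T : E →+ ℝ) {C : ℝ}
    (h : ∀ f, T f ^ 2 ≤ C * ‖f‖ ^ 2) : Continuous T := by
  refine AddMonoidHomClass.continuous_of_bound T (√C) fun f => ?_
  rcases le_or_gt 0 C with hC | hC
  · refine abs_le_of_sq_le_sq ?_ (by positivity)
    rw [mul_pow, Real.sq_sqrt hC]
    exact h f
  · have h1 : T f ^ 2 ≤ 0 := (h f).trans (mul_nonpos_of_nonpos_of_nonneg hC.le (sq_nonneg _))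
    rw [pow_eq_zero_iff two_ne_zero |>.mp (le_antisymm h1 (sq_nonneg _)), norm_zero]
    positivity

lemma exists_inner_eq_pairing_mul (hμ : IsWhiteNoiseMeasure μ) {Φ φ : Kernels} (hΦ : Φ ∈ GStar)
    (hφ : φ ∈ G) (n : ℕ) : ∃ g : L2 n, IsSymm g ∧ ∀ f : L2 n, IsSymm f →
      (n.factorial : ℝ) * inner ℝ g f = pairing Φ (mul μ (single n f) φ) := by
  -- Riesz representation needs a functional on all of `L²(ℝⁿ)`, while only symmetric kernels yield
  -- elements of `G`; hence the symmetrization.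
  let T : L2 n →+ ℝ :=
    { toFun := fun f => pairing Φ (mul μ (single n (symL n f)) φ)
      map_zero' := by
        rw [map_zero, single, Pi.single_zero, zero_mul_G hμ hφ, pairing_zero_right]
      map_add' := fun f g => by
        rw [map_add, single_add, add_mul_G hμ (single_mem_G (isSymm_symL _))
          (single_mem_G (isSymm_symL _)) hφ, pairing_add_right hΦ (mul_mem_G _ _) (mul_mem_G _ _)] }
  have hT : Continuous T := by
    obtain ⟨l, hl, h⟩ := hΦ
    refine continuous_of_sq_le T (C := (64 * normSq (-l) Φ * normSq (l + 2) φ).toReal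
      * ((n.factorial : ℝ) * Real.exp (2 * (l + 2) * n))) fun f => ?_
    refine (sq_pairing_mul_le hμ hl h.2.ne hφ (single_mem_G (isSymm_symL f))).trans ?_
    rw [normSq_single, ENNReal.toReal_mul (a := ENNReal.ofReal _),
      ENNReal.toReal_ofReal (by positivity), ENNReal.toReal_pow, toReal_enorm, mul_assoc (ENNReal.toReal _)]
    gcongr
    exact norm_symL_le f
  let g := (InnerProductSpace.toDual ℝ (L2 n)).symm (T.toRealLinearMap hT)
  refine ⟨symL n ((n.factorial : ℝ)⁻¹ • g), isSymm_symL _, fun f hf => ?_⟩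
  rw [real_inner_comm, inner_symL_of_isSymm hf, real_inner_comm, inner_smul_left,
    InnerProductSpace.toDual_symm_apply]
  simp only [RCLike.conj_to_real]
  rw [mul_inv_cancel_left₀ (Nat.cast_ne_zero.mpr n.factorial_ne_zero)]
  change pairing Φ (mul μ (single n (symL n f)) φ) = _
  rw [symL_of_isSymm hf]

/-- Riesz representation in each chaos gives the kernels of `Ψ`, so the pairing formula holds on
truncated expansions. The norm bound follows by duality, and continuity in `ψ` extends the formula
to `G`. -/
lemma exists_product (hμ : IsWhiteNoiseMeasure μ) {Φ φ : Kernels} (hΦ : Φ ∈ GStar) (hφ : φ ∈ G) :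
    ∃ Ψ ∈ GStar, (∀ ψ ∈ G, pairing Ψ ψ = pairing Φ (mul μ ψ φ)) ∧
      ∀ l : ℝ, 0 < l → normSq (-l) Φ ≠ ∞ →
        normSq (-(l + 2)) Ψ ≤ 64 * normSq (-l) Φ * normSq (l + 2) φ := by
  choose Ψ hΨ hΨ' using exists_inner_eq_pairing_mul hμ hΦ hφ
  have h1 : ∀ (N : ℕ) {F : Kernels} (_ : ∀ n, IsSymm (F n)), pairing Φ (mul μ (trunc N F) φ)
      = ∑ n ∈ Finset.range N, (n.factorial : ℝ) * inner ℝ (Ψ n) (F n) := by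
    intro N F hF
    induction N with
    | zero => rw [trunc_zero, zero_mul_G hμ hφ, pairing_zero_right, Finset.sum_range_zero]
    | succ N ih =>
      rw [trunc_succ, add_mul_G hμ (trunc_mem_G N hF) (single_mem_G (hF N)) hφ,
        pairing_add_right hΦ (mul_mem_G _ _) (mul_mem_G _ _), ih, Finset.sum_range_succ,
        hΨ' N _ (hF N)]
  have h2 : ∀ l : ℝ, 0 < l → normSq (-l) Φ ≠ ∞ →
      normSq (-(l + 2)) Ψ ≤ 64 * normSq (-l) Φ * normSq (l + 2) φ := by
    intro l hl hfin
    set K := 64 * normSq (-l) Φ * normSq (l + 2) φ with hK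
    have hK' : K ≠ ∞ := by
      have := normSq_ne_top_of_mem_G hφ (l + 2)
      finiteness
    -- The extremal test element: for its truncations the pairing with `Ψ` and the squared norm of
    -- index `l + 2` are the same partial sum `S` of `‖Ψ‖²_{-(l+2)}`, so continuity reads `S² ≤ K
    -- S`, that is `S ≤ K`.
    let F : Kernels := fun n => Real.exp (-(2 * (l + 2) * n)) • Ψ n
    have hF : ∀ n, IsSymm (F n) := fun n => (symmSub n).smul_mem _ (hΨ n)
    have k1 : ∀ n : ℕ, (n.factorial : ℝ) * inner ℝ (Ψ n) (F n) = normTerm (-(l + 2)) Ψ n := by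
      intro n
      rw [inner_smul_right, real_inner_self_eq_norm_sq, normTerm]
      ring_nf
    have k2 : ∀ n : ℕ, normTerm (l + 2) F n = normTerm (-(l + 2)) Ψ n := by
      intro n
      have k3 : Real.exp (2 * (l + 2) * n) * Real.exp (-(2 * (l + 2) * n)) = 1 := by
        rw [← Real.exp_add, add_neg_cancel, Real.exp_zero]
      have k4 : Real.exp (2 * -(l + 2) * n) = Real.exp (-(2 * (l + 2) * n)) := by
        congr 1
        ring
      simp only [normTerm, F, norm_smul, Real.norm_eq_abs, Real.abs_exp, k4]
      linear_combination (n.factorial : ℝ) * Real.exp (-(2 * (l + 2) * n)) * ‖Ψ n‖ ^ 2 * k3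
    have k5 : ∀ N, ∑ n ∈ Finset.range N, normTerm (-(l + 2)) Ψ n ≤ K.toReal := by
      intro N
      have k6 := sq_pairing_mul_le hμ hl hfin hφ (trunc_mem_G N hF)
      have k7 : 0 ≤ ∑ n ∈ Finset.range N, normTerm (-(l + 2)) Ψ n :=
        Finset.sum_nonneg fun _ _ => normTerm_nonneg _ _ _
      rw [h1 N hF, normSq_trunc, Finset.sum_congr rfl fun n _ => k1 n,
        Finset.sum_congr rfl fun n _ => k2 n, ENNReal.toReal_ofReal k7, ← hK, sq] at k6
      rcases k7.eq_or_lt with k8 | k8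
      · rw [← k8]
        exact ENNReal.toReal_nonneg
      · exact le_of_mul_le_mul_right k6 k8
    rw [normSq_eq, ENNReal.tsum_eq_iSup_nat]
    refine iSup_le fun N => ?_
    rw [← ENNReal.ofReal_sum_of_nonneg fun _ _ => normTerm_nonneg _ _ _]
    exact ENNReal.ofReal_le_of_le_toReal (k5 N)
  obtain ⟨l, hl, hfin⟩ : ∃ l : ℝ, 0 < l ∧ normSq (-l) Φ ≠ ∞ :=
    hΦ.imp fun _ h => ⟨h.1, h.2.2.ne⟩
  have hmem : normSq (-(l + 2)) Ψ < ∞ := by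
    have := normSq_ne_top_of_mem_G hφ (l + 2)
    exact (h2 l hl hfin).trans_lt (by finiteness)
  refine ⟨Ψ, ⟨l + 2, by linarith, hΨ, hmem⟩, fun ψ hψ => ?_, h2⟩
  have hψs := (mem_G_iff.mp hψ).1
  have k1 := (summable_pairing hmem.ne (normSq_ne_top_of_mem_G hψ _)).hasSum.tendsto_sum_nat
  refine tendsto_nhds_unique k1 ?_
  simp only [← h1 _ hψs]
  have k2 : Tendsto (fun N => (64 * normSq (-l) Φ * normSq (l + 2) φ).toReal
      * (normSq (l + 2) (ψ - trunc N ψ)).toReal) atTop (𝓝 0) := by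
    have k3 := (ENNReal.tendsto_toReal ENNReal.zero_ne_top).comp
      (tendsto_normSq_sub_trunc (normSq_ne_top_of_mem_G hψ (l + 2)))
    simpa using k3.const_mul (64 * normSq (-l) Φ * normSq (l + 2) φ).toReal
  have k4 : Tendsto (fun N => (pairing Φ (mul μ ψ φ) - pairing Φ (mul μ (trunc N ψ) φ)) ^ 2)
      atTop (𝓝 0) := by
    refine squeeze_zero (fun _ => sq_nonneg _) (fun N => ?_) k2
    rw [← pairing_sub_right hΦ (mul_mem_G _ _) (mul_mem_G _ _),
      ← sub_mul_G hμ hψ (trunc_mem_G N hψs) hφ]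
    exact sq_pairing_mul_le hμ hl hfin hφ (sub_mem_G hψ (trunc_mem_G N hψs))
  have k5 := k4.sqrt
  simp only [Real.sqrt_sq_eq_abs, Real.sqrt_zero] at k5
  have k6 := (tendsto_zero_iff_abs_tendsto_zero _).mpr k5
  simpa using k6.const_sub (pairing Φ (mul μ ψ φ))

lemma hasProduct (hμ : IsWhiteNoiseMeasure μ) {Φ φ : Kernels} (hΦ : Φ ∈ GStar) (hφ : φ ∈ G) :
    HasProduct μ φ Φ := by
  obtain ⟨Ψ, hΨ, h, -⟩ := exists_product hμ hΦ hφ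
  exact ⟨Ψ, hΨ, fun ψ hψ => ⟨mul μ ψ φ, mul_mem_G _ _, isPointwiseProduct_mul hμ hψ hφ, h ψ hψ⟩⟩

lemma product_mem_GStar (hμ : IsWhiteNoiseMeasure μ) {Φ φ : Kernels} (hΦ : Φ ∈ GStar)
    (hφ : φ ∈ G) : product μ φ Φ ∈ GStar := by
  have h := hasProduct hμ hΦ hφ
  rw [product, dif_pos h]
  exact h.choose_spec.1

lemma pairing_product (hμ : IsWhiteNoiseMeasure μ) {Φ φ ψ : Kernels} (hΦ : Φ ∈ GStar)
    (hφ : φ ∈ G) (hψ : ψ ∈ G) : pairing (product μ φ Φ) ψ = pairing Φ (mul μ ψ φ) := by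
  have h := hasProduct hμ hΦ hφ
  rw [product, dif_pos h]
  obtain ⟨ρ, -, h1, h2⟩ := h.choose_spec.2 ψ hψ
  rw [h2, h1.eq_mul hμ hψ hφ]

lemma normSq_product_le (hμ : IsWhiteNoiseMeasure μ) {l : ℝ} (hl : 0 < l) {Φ φ : Kernels}
    (hΦ : Φ ∈ GStar) (hφ : φ ∈ G) (h : normSq (-l) Φ ≠ ∞) :
    normSq (-(l + 2)) (product μ φ Φ) ≤ 64 * normSq (-l) Φ * normSq (l + 2) φ := by
  obtain ⟨Ψ, hΨ, h1, h2⟩ := exists_product hμ hΦ hφ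
  have h3 : product μ φ Φ = Ψ := eq_of_pairing_eq (product_mem_GStar hμ hΦ hφ) hΨ fun ψ hψ => by
    rw [pairing_product hμ hΦ hφ hψ, h1 ψ hψ]
  rw [h3]
  exact h2 l hl h

/-! ### The Skorohod integral -/

lemma aemeasurable_normSq {U : ℝ → Kernels} (hm : ∀ n, AEStronglyMeasurable fun t => U t n) (l : ℝ) :
    AEMeasurable fun t => normSq l (U t) :=
  AEMeasurable.tsum fun n => ((hm n).enorm.pow_const 2).const_mul _

lemma memLp_of_lintegral_normSq {U : ℝ → Kernels} (hm : ∀ n, AEStronglyMeasurable fun t => U t n)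
    {l : ℝ} (hint : ∫⁻ t, normSq l (U t) ≠ ∞) (n : ℕ) : MemLp (fun t => U t n) 2 := by
  rw [memLp_two_iff_lintegral (hm n)]
  calc _ ≤ ∫⁻ t, ENNReal.ofReal (Real.exp (-(2 * l * n))) * normSq l (U t) :=
        lintegral_mono fun t => enorm_sq_le_normSq l (U t) n
    _ < ∞ := by
        rw [lintegral_const_mul' _ _ ENNReal.ofReal_ne_top]
        exact ENNReal.mul_lt_top ENNReal.ofReal_lt_top hint.lt_top

/-- The kernels of the Skorohod integral, from those of the integrand. -/
def raise (g : (n : ℕ) → L2 (n + 1)) : Kernels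
  | 0 => 0
  | n + 1 => symL (n + 1) (g n)

/-- Raising the order replaces `n!` by `(n + 1)!`; lowering the index by one pays for the factor `n
+ 1`. -/
lemma normSq_raise_le {l : ℝ} (hl : 0 < l) (g : (n : ℕ) → L2 (n + 1)) :
    normSq (-(l + 1)) (raise g)
      ≤ ∑' n : ℕ, ENNReal.ofReal ((n.factorial : ℝ) * Real.exp (2 * -l * n)) * ‖g n‖ₑ ^ 2 := by
  rw [normSq, tsum_eq_zero_add' ENNReal.summable]
  have h0 : ‖raise g 0‖ₑ = 0 := by simp [raise]
  rw [h0, zero_pow two_ne_zero, mul_zero, zero_add]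
  refine ENNReal.tsum_le_tsum fun n => mul_le_mul' (ENNReal.ofReal_le_ofReal ?_) ?_
  · rw [Nat.factorial_succ]
    push_cast
    have h1 : (n : ℝ) + 1 ≤ Real.exp (2 * l + 2 * (n + 1)) := by
      have := Real.add_one_le_exp (2 * l + 2 * ((n : ℝ) + 1))
      have hn : (0 : ℝ) ≤ n := by positivity
      linarith
    have h2 : Real.exp (2 * -l * n)
        = Real.exp (2 * l + 2 * (n + 1)) * Real.exp (2 * -(l + 1) * (n + 1)) := by
      rw [← Real.exp_add]
      ring_nf
    rw [h2, mul_comm ((n : ℝ) + 1), mul_assoc]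
    gcongr
  · exact pow_le_pow_left' (enorm_le_iff_norm_le.mpr (norm_symL_le (g n))) 2

/-- Integrability of the squared norms makes each `t ↦ U t n` square integrable with values in
`L²(ℝⁿ)`, hence a function in `L²(ℝⁿ⁺¹)`, which is then symmetrized. -/
lemma exists_isSkorohodIntegral {U : ℝ → Kernels} (hsym : ∀ᵐ t, ∀ n, IsSymm (U t n))
    (hm : ∀ n, AEStronglyMeasurable fun t => U t n) {l : ℝ} (hl : 0 < l)
    (hint : ∫⁻ t, normSq (-l) (U t) ≠ ∞) : ∃ Ψ, IsSkorohodIntegral U Ψ := by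
  choose g hg using fun n => exists_slice_eq (memLp_of_lintegral_normSq hm hint n)
  refine ⟨raise g, ?_, ⟨l + 1, by linarith, ?_, ?_⟩, rfl, fun n => ⟨g n, ?_, symL_ae (g n)⟩⟩
  · filter_upwards [hsym, ae_lt_top' (aemeasurable_normSq hm _) hint] with t h1 h2
    exact ⟨l, hl, h1, h2⟩
  · rintro (_ | n)
    · exact (symmSub 0).zero_mem
    · exact isSymm_symL (g n)
  · refine ((normSq_raise_le hl g).trans_eq ?_).trans_lt hint.lt_top
    simp only [normSq]
    rw [lintegral_tsum fun n => ((hm n).enorm.pow_const 2).const_mul _]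
    refine tsum_congr fun n => ?_
    rw [lintegral_const_mul' _ _ ENNReal.ofReal_ne_top, ← lintegral_enorm_slice]
    congr 1
    refine lintegral_congr_ae ?_
    filter_upwards [hg n] with t ht
    rw [ht]
  · filter_upwards [hg n, slice_ae (g n)] with t h1 h2
    rw [h1] at h2
    exact h2.symm

lemma IsSkorohodIntegral.exists_slice {U : ℝ → Kernels} {Ψ : Kernels}
    (h : IsSkorohodIntegral U Ψ) (n : ℕ) :
    ∃ g : L2 (n + 1), (∀ᵐ t, slice g t = U t n) ∧ Ψ (n + 1) = symL (n + 1) g := by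
  obtain ⟨g, h1, h2⟩ := h.2.2.2 n
  exact ⟨g, slice_eq_of_ae g h1, Lp.ext (h2.trans (symL_ae g).symm)⟩

lemma enorm_pairing_term_le (l : ℝ) (Φ ψ : Kernels) (n : ℕ) :
    ‖(n.factorial : ℝ) * inner ℝ (Φ n) (ψ n)‖ₑ
      ≤ ENNReal.ofReal (normTerm (-l) Φ n) + ENNReal.ofReal (normTerm l ψ n) := by
  rw [← ofReal_norm, ← ENNReal.ofReal_add (normTerm_nonneg _ _ _) (normTerm_nonneg _ _ _)]
  refine ENNReal.ofReal_le_ofReal ((abs_pairing_term_le l Φ ψ n).trans ?_)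
  have h1 := Real.sq_sqrt (normTerm_nonneg (-l) Φ n)
  have h2 := Real.sq_sqrt (normTerm_nonneg l ψ n)
  nlinarith [sq_nonneg (√(normTerm (-l) Φ n) - √(normTerm l ψ n)),
    normTerm_nonneg (-l) Φ n, normTerm_nonneg l ψ n]

/-- The Skorohod integral is the adjoint of the stochastic derivative. -/
theorem IsSkorohodIntegral.integrable_pairing {U : ℝ → Kernels} {Ψ : Kernels}
    (h : IsSkorohodIntegral U Ψ) {l : ℝ} (hl : 0 < l) (hint : ∫⁻ t, normSq (-l) (U t) ≠ ∞)
    {ψ : Kernels} (hψ : ψ ∈ G) :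
    Integrable (fun t => pairing (U t) (sliceDeriv t ψ)) ∧
      pairing Ψ ψ = ∫ t, pairing (U t) (sliceDeriv t ψ) := by
  choose g hg hΨ using h.exists_slice
  have hψs := (mem_G_iff.mp hψ).1
  -- The factor `n + 1` of the derivative is exactly what turns `n!` into the `(n + 1)!` of the
  -- raised order. The symmetrization drops out because the kernels of `ψ` are symmetric.
  have h1 : ∀ n : ℕ, (fun t => ((n + 1).factorial : ℝ)
      * inner ℝ (slice (g n) t) (slice (ψ (n + 1)) t))
      =ᵐ[volume] fun t => (n.factorial : ℝ) * inner ℝ (U t n) (sliceDeriv t ψ n) := by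
    intro n
    filter_upwards [hg n] with t ht
    rw [ht, sliceDeriv, inner_smul_right, Nat.factorial_succ]
    push_cast
    ring
  have h2 : ∀ n : ℕ, Integrable fun t => (n.factorial : ℝ) * inner ℝ (U t n) (sliceDeriv t ψ n) :=
    fun n => ((integrable_inner_slice (g n) (ψ (n + 1))).const_mul _).congr (h1 n)
  have h3 : ∀ n : ℕ, ∫ t, (n.factorial : ℝ) * inner ℝ (U t n) (sliceDeriv t ψ n)
      = ((n + 1).factorial : ℝ) * inner ℝ (Ψ (n + 1)) (ψ (n + 1)) := by
    intro n
    rw [← integral_congr_ae (h1 n), integral_const_mul, integral_inner_slice, hΨ n,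
      real_inner_comm (ψ (n + 1)) (symL (n + 1) (g n)), inner_symL_of_isSymm (hψs (n + 1)),
      real_inner_comm]
  -- Absolute convergence, for the exchange of sum and integral: each term is bounded by a term of
  -- `‖U t‖²_{-l}` plus a term of `‖D_t ψ‖²_l`, both integrable over `t`.
  have h4 : ∫⁻ t, ∑' n : ℕ, ‖(n.factorial : ℝ) * inner ℝ (U t n) (sliceDeriv t ψ n)‖ₑ < ∞ := by
    calc _ ≤ ∫⁻ t, (normSq (-l) (U t) + normSq l (sliceDeriv t ψ)) := by
          refine lintegral_mono fun t => ?_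
          rw [normSq_eq, normSq_eq, ← ENNReal.tsum_add]
          exact ENNReal.tsum_le_tsum fun n => enorm_pairing_term_le l _ _ n
      _ = (∫⁻ t, normSq (-l) (U t)) + ∫⁻ t, normSq l (sliceDeriv t ψ) :=
          lintegral_add_right' _ (aemeasurable_normSq_sliceDeriv l ψ)
      _ < ∞ := ENNReal.add_lt_top.mpr ⟨hint.lt_top,
          (lintegral_normSq_sliceDeriv_le hl.le ψ).trans_lt (normSq_ne_top_of_mem_G hψ _).lt_top⟩
  refine ⟨⟨?_, lt_of_le_of_lt (lintegral_mono fun t => enorm_tsum_le_tsum_enorm) h4⟩, ?_⟩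
  · exact (AEMeasurable.tsum fun n => (h2 n).aestronglyMeasurable.aemeasurable).aestronglyMeasurable
  · simp only [pairing]
    rw [integral_tsum (fun n => (h2 n).aestronglyMeasurable), tsum_congr h3]
    · obtain ⟨l', hl', h'⟩ := h.2.1
      have hs := summable_pairing h'.2.ne (normSq_ne_top_of_mem_G hψ l')
      rw [hs.tsum_eq_zero_add, h.2.2.1, inner_zero_left, mul_zero, zero_add]
    · rw [← lintegral_tsum fun n => (h2 n).aestronglyMeasurable.enorm]
      exact h4.ne

/-! ### Processes on a set -/

lemma indicator_kernels (S : Set ℝ) (Φ : ℝ → Kernels) (n : ℕ) :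
    (fun t => S.indicator Φ t n) = S.indicator fun t => Φ t n := by
  funext t
  by_cases h : t ∈ S <;> simp [h]

lemma normSq_indicator (S : Set ℝ) (Φ : ℝ → Kernels) (l : ℝ) :
    (fun t => normSq l (S.indicator Φ t)) = S.indicator fun t => normSq l (Φ t) := by
  funext t
  by_cases h : t ∈ S <;> simp [h, normSq_zero]

/-- Testing on elements of a single chaos gives weak measurability of each kernel, and separability
of `L²(ℝⁿ)` makes it strong. Symmetrizing the test function is harmless since the kernels of `Φ t`
are symmetric. -/
lemma WeaklyMeasurableOn.aestronglyMeasurable {S : Set ℝ} (hS : MeasurableSet S)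
    {Φ : ℝ → Kernels} (hΦ : ∀ t ∈ S, Φ t ∈ GStar) (h : WeaklyMeasurableOn S Φ) (n : ℕ) :
    AEStronglyMeasurable fun t => S.indicator Φ t n := by
  rw [indicator_kernels, aestronglyMeasurable_indicator_iff hS]
  refine aestronglyMeasurable_of_inner fun f => ?_
  have h1 := ((h _ (single_mem_G (isSymm_symL f))).const_mul (n.factorial : ℝ)⁻¹).aestronglyMeasurable
  refine h1.congr ?_
  filter_upwards [ae_restrict_mem hS] with t ht
  obtain ⟨l, hl, hs⟩ := hΦ t ht
  rw [pairing_single, inv_mul_cancel_left₀ (Nat.cast_ne_zero.mpr n.factorial_ne_zero),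
    inner_symL_of_isSymm (hs.1 n)]

lemma skorohodIntegrableOn {S : Set ℝ} (hS : MeasurableSet S) {Φ : ℝ → Kernels}
    (hΦ : ∀ t ∈ S, Φ t ∈ GStar) (hm : WeaklyMeasurableOn S Φ) {l : ℝ} (hl : 0 < l)
    (hint : ∫⁻ t in S, normSq (-l) (Φ t) ≠ ∞) : SkorohodIntegrableOn S Φ := by
  refine exists_isSkorohodIntegral (ae_of_all _ fun t n => ?_) (hm.aestronglyMeasurable hS hΦ) hl ?_
  · by_cases ht : t ∈ S
    · obtain ⟨l', hl', h⟩ := hΦ t ht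
      rw [Set.indicator_of_mem ht]
      exact h.1 n
    · rw [Set.indicator_of_notMem ht]
      exact (symmSub n).zero_mem
  · rwa [normSq_indicator, lintegral_indicator hS]

lemma SkorohodIntegrableOn.isSkorohodIntegral {S : Set ℝ} {Φ : ℝ → Kernels}
    (h : SkorohodIntegrableOn S Φ) : IsSkorohodIntegral (S.indicator Φ) (skorohod S Φ) := by
  rw [skorohod, dif_pos h]
  exact h.choose_spec

lemma SkorohodIntegrableOn.integrableOn_pairing {S : Set ℝ} (hS : MeasurableSet S)
    {Φ : ℝ → Kernels} (h : SkorohodIntegrableOn S Φ) {l : ℝ} (hl : 0 < l)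
    (hint : ∫⁻ t in S, normSq (-l) (Φ t) ≠ ∞) {ψ : Kernels} (hψ : ψ ∈ G) :
    IntegrableOn (fun t => pairing (Φ t) (sliceDeriv t ψ)) S ∧
      pairing (skorohod S Φ) ψ = ∫ t in S, pairing (Φ t) (sliceDeriv t ψ) := by
  have h1 : (fun t => pairing (S.indicator Φ t) (sliceDeriv t ψ))
      = S.indicator fun t => pairing (Φ t) (sliceDeriv t ψ) := by
    funext t
    by_cases h : t ∈ S <;> simp [h, pairing]
  have h2 := h.isSkorohodIntegral.integrable_pairing hl
    (by rwa [normSq_indicator, lintegral_indicator hS]) hψ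
  rw [h1, integrable_indicator_iff hS, integral_indicator hS] at h2
  exact h2

/-- Pairings with `G` separate `G*`, so the value chosen in `pettis` is the only one. -/
lemma pettis_eq {S : Set ℝ} {Φ : ℝ → Kernels} {Ψ : Kernels} (h : IsPettisIntegral S Φ Ψ) :
    pettis S Φ = Ψ := by
  have h1 : PettisIntegrableOn S Φ := ⟨Ψ, h⟩
  rw [pettis, dif_pos h1]
  exact eq_of_pairing_eq h1.choose_spec.2.1 h.2.1 fun ψ hψ => by
    rw [(h1.choose_spec.2.2 ψ hψ).2, (h.2.2 ψ hψ).2]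

/-! ### Integration by parts -/

lemma lintegral_normSq_product_ne_top (hμ : IsWhiteNoiseMeasure μ) {S : Set ℝ}
    (hS : MeasurableSet S) {Φ : ℝ → Kernels} (hΦ : ∀ t ∈ S, Φ t ∈ GStar)
    (hm : WeaklyMeasurableOn S Φ) {φ : Kernels} (hφ : φ ∈ G) {l : ℝ} (hl : 0 < l)
    (hint : ∫⁻ t in S, normSq (-l) (Φ t) ≠ ∞) :
    ∫⁻ t in S, normSq (-(l + 2)) (product μ φ (Φ t)) ≠ ∞ := by
  have h1 : ∀ᵐ t ∂volume.restrict S, normSq (-l) (Φ t) < ∞ := by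
    refine ae_lt_top' ?_ hint
    rw [← aemeasurable_indicator_iff hS, ← normSq_indicator]
    exact aemeasurable_normSq (hm.aestronglyMeasurable hS hΦ) _
  have h2 := normSq_ne_top_of_mem_G hφ (l + 2)
  refine ne_top_of_le_ne_top (b := 64 * normSq (l + 2) φ * ∫⁻ t in S, normSq (-l) (Φ t))
    (by finiteness) ?_
  rw [← lintegral_const_mul' _ _ (by finiteness)]
  refine lintegral_mono_ae ?_
  filter_upwards [h1, ae_restrict_mem hS] with t ht htS
  refine (normSq_product_le hμ hl (hΦ t htS) hφ ht.ne).trans_eq ?_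
  ring

lemma weaklyMeasurableOn_product (hμ : IsWhiteNoiseMeasure μ) {S : Set ℝ} (hS : MeasurableSet S)
    {Φ : ℝ → Kernels} (hΦ : ∀ t ∈ S, Φ t ∈ GStar) (hm : WeaklyMeasurableOn S Φ) {φ : Kernels}
    (hφ : φ ∈ G) : WeaklyMeasurableOn S fun t => product μ φ (Φ t) := by
  intro ψ hψ
  refine (hm _ (mul_mem_G (μ := μ) ψ φ)).congr ?_
  filter_upwards [ae_restrict_mem hS] with t ht
  rw [pairing_product hμ (hΦ t ht) hφ hψ]

/-- This is the theorem itself: the difference of the two Skorohod terms is shown to be the Pettis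
integral. Both terms are paired with `ψ` by adjointness, the first one against `D_t (ψ φ)`, and the
Leibniz rule leaves `⟪Φ(t), ψ D_t φ⟫` under the integral. Pettis integrability comes along, as a
difference of two integrable functions. -/
theorem isPettisIntegral_product_stochDeriv (hμ : IsWhiteNoiseMeasure μ) {S : Set ℝ}
    (hS : MeasurableSet S) {Φ : ℝ → Kernels} (hΦ : ∀ t ∈ S, Φ t ∈ GStar)
    (hm : WeaklyMeasurableOn S Φ) {φ : Kernels} (hφ : φ ∈ G) {l : ℝ} (hl : 0 < l)
    (hint : ∫⁻ t in S, normSq (-l) (Φ t) ≠ ∞) :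
    IsPettisIntegral S (fun t => product μ (stochDeriv t φ) (Φ t))
      (product μ φ (skorohod S Φ) - skorohod S fun t => product μ φ (Φ t)) := by
  have hD : ∀ᵐ t ∂volume.restrict S, stochDeriv t φ = sliceDeriv t φ ∧ sliceDeriv t φ ∈ G :=
    ae_restrict_of_ae ((stochDeriv_ae φ).and (sliceDeriv_mem_G hφ))
  have i1 := skorohodIntegrableOn hS hΦ hm hl hint
  have hint2 := lintegral_normSq_product_ne_top hμ hS hΦ hm hφ hl hint
  have i2 := skorohodIntegrableOn hS (fun t ht => product_mem_GStar hμ (hΦ t ht) hφ)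
    (weaklyMeasurableOn_product hμ hS hΦ hm hφ) (by linarith) hint2
  have m1 := i1.isSkorohodIntegral.2.1
  have m2 := i2.isSkorohodIntegral.2.1
  have m3 := product_mem_GStar hμ m1 hφ
  refine ⟨?_, sub_mem_GStar m3 m2, fun ψ hψ => ?_⟩
  · filter_upwards [hD, ae_restrict_mem hS] with t ht htS
    rw [ht.1]
    exact product_mem_GStar hμ (hΦ t htS) ht.2
  obtain ⟨j1, e1⟩ := i1.integrableOn_pairing hS hl hint (mul_mem_G (μ := μ) ψ φ)
  obtain ⟨j2, e2⟩ := i2.integrableOn_pairing hS (by linarith) hint2 hψ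
  have h1 : (fun t => pairing (Φ t) (sliceDeriv t (mul μ ψ φ))
      - pairing (product μ φ (Φ t)) (sliceDeriv t ψ))
      =ᵐ[volume.restrict S] fun t => pairing (product μ (stochDeriv t φ) (Φ t)) ψ := by
    filter_upwards [hD, ae_restrict_mem hS, ae_restrict_of_ae (sliceDeriv_mul hμ hψ hφ),
      ae_restrict_of_ae (sliceDeriv_mem_G hψ)] with t ht htS hL hψt
    rw [ht.1, pairing_product hμ (hΦ t htS) ht.2 hψ, pairing_product hμ (hΦ t htS) hφ hψt, hL,
      pairing_add_right (hΦ t htS) (mul_mem_G _ _) (mul_mem_G _ _), add_sub_cancel_right]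
  refine ⟨(j1.sub j2).congr h1, ?_⟩
  rw [pairing_sub_left m3 m2 hψ, pairing_product hμ m1 hφ hψ, e1, e2, ← integral_congr_ae h1,
    integral_sub j1 j2]

end WhiteNoise

end

theorem mainTheorem8
    (μ : MeasureTheory.Measure WhiteNoise.Dist) (hμ : WhiteNoise.IsWhiteNoiseMeasure μ)
    (T : ℝ) (hT : 0 ≤ T)
    (φ : WhiteNoise.Kernels) (hφ : φ ∈ WhiteNoise.G)
    (Φ : ℝ → WhiteNoise.Kernels) (hΦ : ∀ t ∈ Set.Icc 0 T, Φ t ∈ WhiteNoise.GStar)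
    (hmeas : WhiteNoise.WeaklyMeasurableOn (Set.Icc 0 T) Φ)
    (lam ν : ℝ) (hlam : 0 < lam) (hν : 1 / 2 * Real.log (2 + Real.sqrt 2) < ν)
    (hint : ∫⁻ t in Set.Icc 0 T, WhiteNoise.normSq (-lam + ν) (Φ t) < ⊤) :
    -- the integral of `φ Φ(t)` is well defined
    (∀ t ∈ Set.Icc 0 T, WhiteNoise.HasProduct μ φ (Φ t)) ∧
    WhiteNoise.SkorohodIntegrableOn (Set.Icc 0 T) (fun t => WhiteNoise.product μ φ (Φ t)) ∧
    -- the integral of `Φ(t)` and its product with `φ` are well defined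
    WhiteNoise.SkorohodIntegrableOn (Set.Icc 0 T) Φ ∧
    WhiteNoise.HasProduct μ φ (WhiteNoise.skorohod (Set.Icc 0 T) Φ) ∧
    -- the Pettis integral of `Φ(t) D_t φ` is well defined
    (∀ᵐ t ∂MeasureTheory.volume.restrict (Set.Icc 0 T),
      WhiteNoise.stochDeriv t φ ∈ WhiteNoise.G ∧
      WhiteNoise.HasProduct μ (WhiteNoise.stochDeriv t φ) (Φ t)) ∧
    WhiteNoise.PettisIntegrableOn (Set.Icc 0 T)
      (fun t => WhiteNoise.product μ (WhiteNoise.stochDeriv t φ) (Φ t)) ∧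
    -- all terms are generalized random variables
    WhiteNoise.skorohod (Set.Icc 0 T) (fun t => WhiteNoise.product μ φ (Φ t))
      ∈ WhiteNoise.GStar ∧
    WhiteNoise.product μ φ (WhiteNoise.skorohod (Set.Icc 0 T) Φ) ∈ WhiteNoise.GStar ∧
    WhiteNoise.pettis (Set.Icc 0 T)
      (fun t => WhiteNoise.product μ (WhiteNoise.stochDeriv t φ) (Φ t)) ∈ WhiteNoise.GStar ∧
    -- integration by parts
    WhiteNoise.skorohod (Set.Icc 0 T) (fun t => WhiteNoise.product μ φ (Φ t))
      = WhiteNoise.product μ φ (WhiteNoise.skorohod (Set.Icc 0 T) Φ)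
        - WhiteNoise.pettis (Set.Icc 0 T)
            (fun t => WhiteNoise.product μ (WhiteNoise.stochDeriv t φ) (Φ t)) := by
  have hS : MeasurableSet (Set.Icc 0 T) := measurableSet_Icc
  obtain ⟨l, hl, hint⟩ : ∃ l : ℝ, 0 < l ∧
      ∫⁻ t in Set.Icc 0 T, WhiteNoise.normSq (-l) (Φ t) ≠ ⊤ := by
    -- The norms increase with the index, so any `l ≥ lam - ν` will do; the maximum with `1` makes
    -- `l` positive, as the estimates in `G*` require.
    refine ⟨max (lam - ν) 1, lt_max_of_lt_right one_pos, ?_⟩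
    refine ne_top_of_le_ne_top hint.ne (MeasureTheory.lintegral_mono fun t => ?_)
    refine WhiteNoise.normSq_mono ?_ _
    linarith [le_max_left (lam - ν) 1]
  have hP := WhiteNoise.isPettisIntegral_product_stochDeriv hμ hS hΦ hmeas hφ hl hint
  have i1 := WhiteNoise.skorohodIntegrableOn hS hΦ hmeas hl hint
  have i2 := WhiteNoise.skorohodIntegrableOn hS
    (fun t ht => WhiteNoise.product_mem_GStar hμ (hΦ t ht) hφ)
    (WhiteNoise.weaklyMeasurableOn_product hμ hS hΦ hmeas hφ) (by linarith)
    (WhiteNoise.lintegral_normSq_product_ne_top hμ hS hΦ hmeas hφ hl hint)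
  have m1 := i1.isSkorohodIntegral.2.1
  -- With the Pettis integral replaced by the difference of the other two terms, the formula becomes
  -- `x = y - (y - x)`.
  rw [WhiteNoise.pettis_eq hP]
  refine ⟨fun t ht => WhiteNoise.hasProduct hμ (hΦ t ht) hφ, i2, i1,
    WhiteNoise.hasProduct hμ m1 hφ, ?_, ⟨_, hP⟩, i2.isSkorohodIntegral.2.1,
    WhiteNoise.product_mem_GStar hμ m1 hφ, hP.2.1, (sub_sub_cancel _ _).symm⟩
  filter_upwards [MeasureTheory.ae_restrict_of_ae (WhiteNoise.stochDeriv_ae φ),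
    MeasureTheory.ae_restrict_of_ae (WhiteNoise.sliceDeriv_mem_G hφ),
    MeasureTheory.ae_restrict_mem hS] with t h1 h2 ht
  rw [h1]
  exact ⟨h2, WhiteNoise.hasProduct hμ (hΦ t ht) h2⟩
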